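/- Conventions. Banach lattices are real, and $m\ge 1$. Let $E_1,\dots,E_m$ and $G$ be Banach lattices. An $m$-linear operator $T\colon E_1\times\cdots\times E_m\to G$ is positive if $T(x_1,\dots,x_m)\ge 0$ whenever $x_1,\dots,x_m\ge 0$, and regular if it is the difference of two positive $m$-linear operators (for $m=1$: positive and regular linear operators). A lattice $m$-morphism is an $m$-linear operator $T$ with $|T(x_1,\dots,x_m)|=T(|x_1|,\dots,|x_m|)$ for all $x_1,\dots,x_m$. Let $E_1\bar\otimes\cdots\bar\otimes E_m$ be the (Fremlin) vector lattice tensor product, that is, the Archimedean vector lattice with a lattice $m$-morphism $(x_1,\dots,x_m)\mapsto x_1\otimes\cdots\otimes x_m$ through which every lattice $m$-morphism from $E_1\times\cdots\times E_m$ into an Archimedean vector lattice factors by a unique lattice homomorphism. The positive projective tensor product $E_1\hat\otimes_{|\pi|}\cdots\hat\otimes_{|\pi|}E_m$ is the Banach lattice obtained by completing it with respect to $$\|u\|_{|\pi|}=\inf\Big\{\sum_{k=1}^n\|x_{1,k}\|\cdots\|x_{m,k}\| : n\in\mathbb N,\ x_{i,k}\in E_i,\ x_{i,k}\ge 0,\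 |u|\le\sum_{k=1}^n x_{1,k}\otimes\cdots\otimes x_{m,k}\Big\}.$$ For every regular $m$-linear $T\colon E_1\times\cdots\times E_m\to G$, the linearization $T^\otimes\colon E_1\hat\otimes_{|\pi|}\cdots\hat\otimes_{|\pi|}E_m\to G$ is the unique regular linear operator with $T^\otimes(x_1\otimes\cdots\otimes x_m)=T(x_1,\dots,x_m)$ for all $x_1,\dots,x_m$. A Banach lattice has the positive Schur property (PSP) if each of its weakly null sequences of positive vectors is norm null. A linear operator $u$ from a Banach lattice $H$ to a Banach space is almost Dunford–Pettis if $\|u(x_n)\|\to 0$ for every weakly null sequence $(x_n)$ in $H$ that is pairwise disjoint ($|x_k|\wedge|x_l|=0$ for $k\neq l$). Theorem. For Banach lattices $E_1,\dots,E_m$ the following are equivalent. 1. $E_1\hat\otimes_{|\pi|}\cdots\hat\otimes_{|\pi|}E_m$ has the PSP. 2. For every Banach lattice $G$ and every regular $m$-linear operator $T\colon E_1\times\cdots\times E_m\to G$, the linearization $T^\otimes$ (which exists and is unique) is almost Dunford–Pettis. 3. For every Banach lattice $G$ and every regular $m$-linear operator $T\colon E_1\times\cdots\times E_m\to G$ there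 are a Banach lattice $H$, a regular $m$-linear operator $A\colon E_1\times\cdots\times E_m\to H$ and a regular almost Dunford–Pettis linear operator $u\colon H\to G$ such that $T=u\circ A$. -/

import Mathlib

open Filter Topology

universe u

namespace BanachLatticeTensor

/-! ## Regular multilinear and linear operators, lattice multimorphisms -/

section Operators

variable {m : ℕ} {E : Fin m → Type u} {F : Type u}

/-- A multilinear operator is positive if it maps tuples of positive vectors to positive vectors. -/
def IsPositiveMultilinear [∀ i, AddCommGroup (E i)] [∀ i, Module ℝ (E i)] [∀ i, Lattice (E i)]
    [AddCommGroup F] [Module ℝ F] [Lattice F] (T : MultilinearMap ℝ E F) : Prop :=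
  ∀ x : ∀ i, E i, (∀ i, 0 ≤ x i) → 0 ≤ T x

/-- A multilinear operator is regular if it is the difference of two positive ones. -/
def IsRegularMultilinear [∀ i, AddCommGroup (E i)] [∀ i, Module ℝ (E i)] [∀ i, Lattice (E i)]
    [AddCommGroup F] [Module ℝ F] [Lattice F] (T : MultilinearMap ℝ E F) : Prop :=
  ∃ T₁ T₂ : MultilinearMap ℝ E F,
    IsPositiveMultilinear T₁ ∧ IsPositiveMultilinear T₂ ∧ T = T₁ - T₂

/-- A lattice `m`-morphism: a multilinear map with `|T (x₁, …, x_m)| = T (|x₁|, …, |x_m|)`. -/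
def IsLatticeMultimorphism [∀ i, AddCommGroup (E i)] [∀ i, Module ℝ (E i)] [∀ i, Lattice (E i)]
    [AddCommGroup F] [Module ℝ F] [Lattice F] (T : MultilinearMap ℝ E F) : Prop :=
  ∀ x : ∀ i, E i, |T x| = T (fun i => |x i|)

/-- A linear operator is positive if it maps positive vectors to positive vectors. -/
def IsPositiveLinear {X Y : Type u} [AddCommGroup X] [Module ℝ X] [Lattice X]
    [AddCommGroup Y] [Module ℝ Y] [Lattice Y] (S : X →ₗ[ℝ] Y) : Prop :=
  ∀ x : X, 0 ≤ x → 0 ≤ S x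

/-- A linear operator is regular if it is the difference of two positive ones. -/
def IsRegularLinear {X Y : Type u} [AddCommGroup X] [Module ℝ X] [Lattice X]
    [AddCommGroup Y] [Module ℝ Y] [Lattice Y] (S : X →ₗ[ℝ] Y) : Prop :=
  ∃ S₁ S₂ : X →ₗ[ℝ] Y, IsPositiveLinear S₁ ∧ IsPositiveLinear S₂ ∧ S = S₁ - S₂

end Operators

/-! ## Weakly null sequences, positive Schur property, almost Dunford–Pettis operators -/

/-- A sequence is weakly null if every continuous linear functional maps it to a null sequence. -/
def WeaklyNull {X : Type u} [NormedAddCommGroup X] [NormedSpace ℝ X] (x : ℕ → X) : Prop :=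
  ∀ f : X →L[ℝ] ℝ, Tendsto (fun n => f (x n)) atTop (𝓝 0)

/-- The positive Schur property: weakly null sequences of positive vectors are norm null. -/
def HasPositiveSchurProperty (X : Type u) [NormedAddCommGroup X] [NormedSpace ℝ X]
    [Lattice X] : Prop :=
  ∀ x : ℕ → X, (∀ n, 0 ≤ x n) → WeaklyNull x → Tendsto (fun n => ‖x n‖) atTop (𝓝 0)

/-- A linear operator is almost Dunford–Pettis if it maps pairwise disjoint weakly null sequences
to norm null sequences. -/
def IsAlmostDunfordPettis {X Y : Type u} [NormedAddCommGroup X] [NormedSpace ℝ X] [Lattice X]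
    [NormedAddCommGroup Y] [NormedSpace ℝ Y] (S : X →ₗ[ℝ] Y) : Prop :=
  ∀ x : ℕ → X, (∀ k l, k ≠ l → |x k| ⊓ |x l| = 0) → WeaklyNull x →
    Tendsto (fun n => ‖S (x n)‖) atTop (𝓝 0)

/-! ## The vector lattice tensor product -/

/-- A vector lattice is Archimedean if `n x ≤ y` for all `n` forces `x ≤ 0`. -/
def IsArchimedeanLattice (F : Type u) [AddCommGroup F] [Lattice F] : Prop :=
  ∀ x y : F, (∀ n : ℕ, n • x ≤ y) → x ≤ 0

section Fremlin

variable {m : ℕ} (E : Fin m → Type u)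

/-- Formal vector lattice expressions in the symbols `x₁ ⊗ ⋯ ⊗ x_m`. -/
inductive LatticeTerm : Type u
  | tmul (x : ∀ i, E i) : LatticeTerm
  | zero : LatticeTerm
  | add (a b : LatticeTerm) : LatticeTerm
  | smul (c : ℝ) (a : LatticeTerm) : LatticeTerm
  | sup (a b : LatticeTerm) : LatticeTerm

variable [∀ i, AddCommGroup (E i)] [∀ i, Module ℝ (E i)] [∀ i, Lattice (E i)]

/-- An Archimedean vector lattice together with a lattice `m`-morphism from `E₁ × ⋯ × E_m`
into it. -/
structure LatticeTarget where
  carrier : Type u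
  [addCommGroup : AddCommGroup carrier]
  [module : Module ℝ carrier]
  [lattice : Lattice carrier]
  [isOrderedAddMonoid : IsOrderedAddMonoid carrier]
  [isOrderedModule : IsOrderedModule ℝ carrier]
  archimedean : IsArchimedeanLattice carrier
  map : MultilinearMap ℝ E carrier
  isLatticeMultimorphism : IsLatticeMultimorphism map

attribute [instance] LatticeTarget.addCommGroup LatticeTarget.module LatticeTarget.lattice
  LatticeTarget.isOrderedAddMonoid LatticeTarget.isOrderedModule

variable {E}

/-- The value of a formal expression in a vector lattice, the symbol `x₁ ⊗ ⋯ ⊗ x_m` being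
interpreted by the given lattice `m`-morphism. -/
def LatticeTarget.eval (t : LatticeTarget E) : LatticeTerm E → t.carrier
  | .tmul x => t.map x
  | .zero => 0
  | .add a b => t.eval a + t.eval b
  | .smul c a => c • t.eval a
  | .sup a b => t.eval a ⊔ t.eval b

variable (E)

/-- Two formal expressions are identified if they agree under every lattice `m`-morphism into an
Archimedean vector lattice. -/
def latticeTermSetoid : Setoid (LatticeTerm E) where
  r a b := ∀ t : LatticeTarget E, t.eval a = t.eval b
  iseqv := ⟨fun _ _ => rfl, fun h t => (h t).symm, fun h h' t => (h t).trans (h' t)⟩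

/-- The vector lattice tensor product `E₁ ⊗̄ ⋯ ⊗̄ E_m`: the Archimedean vector lattice generated by
the elementary tensors and universal for lattice `m`-morphisms from `E₁ × ⋯ × E_m` into
Archimedean vector lattices. -/
def LatticeTensor : Type u := Quotient (latticeTermSetoid E)

namespace LatticeTensor

variable {E}

/-- The map on the tensor product induced by a lattice `m`-morphism (a lattice homomorphism, by
the simp lemmas below). -/
def lift (t : LatticeTarget E) : LatticeTensor E → t.carrier :=
  Quotient.lift t.eval fun _ _ h => h t

theorem ext_lift {a b : LatticeTensor E} (h : ∀ t : LatticeTarget E, lift t a = lift t b) :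
    a = b := by
  induction a using Quotient.inductionOn
  induction b using Quotient.inductionOn
  exact Quotient.sound h

instance : Zero (LatticeTensor E) := ⟨Quotient.mk _ .zero⟩

instance : Add (LatticeTensor E) :=
  ⟨Quotient.map₂ .add fun _ _ h _ _ h' t => congrArg₂ (· + ·) (h t) (h' t)⟩

instance : SMul ℝ (LatticeTensor E) :=
  ⟨fun c => Quotient.map (.smul c) fun _ _ h t => congrArg (c • ·) (h t)⟩

instance : Neg (LatticeTensor E) := ⟨fun a => (-1 : ℝ) • a⟩

/-- The supremum of two elements of the tensor product. -/
def supFun : LatticeTensor E → LatticeTensor E → LatticeTensor E :=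
  Quotient.map₂ .sup fun _ _ h _ _ h' t => congrArg₂ (· ⊔ ·) (h t) (h' t)

@[simp] theorem lift_zero (t : LatticeTarget E) : lift t 0 = 0 := rfl

@[simp] theorem lift_add (t : LatticeTarget E) (a b : LatticeTensor E) :
    lift t (a + b) = lift t a + lift t b := by
  induction a using Quotient.inductionOn
  induction b using Quotient.inductionOn
  rfl

@[simp] theorem lift_smul (t : LatticeTarget E) (c : ℝ) (a : LatticeTensor E) :
    lift t (c • a) = c • lift t a := by
  induction a using Quotient.inductionOn
  rfl

@[simp] theorem lift_neg (t : LatticeTarget E) (a : LatticeTensor E) :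
    lift t (-a) = -lift t a := by
  change lift t ((-1 : ℝ) • a) = _
  simp

theorem lift_supFun (t : LatticeTarget E) (a b : LatticeTensor E) :
    lift t (supFun a b) = lift t a ⊔ lift t b := by
  induction a using Quotient.inductionOn
  induction b using Quotient.inductionOn
  rfl

instance : AddCommGroup (LatticeTensor E) where
  add_assoc a b c := ext_lift fun t => by simp [add_assoc]
  zero_add a := ext_lift fun t => by simp
  add_zero a := ext_lift fun t => by simp
  add_comm a b := ext_lift fun t => by simp [add_comm]
  neg_add_cancel a := ext_lift fun t => by simp
  nsmul := nsmulRec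
  zsmul := zsmulRec

instance : Module ℝ (LatticeTensor E) where
  one_smul a := ext_lift fun t => by simp
  mul_smul c d a := ext_lift fun t => by simp [mul_smul]
  smul_zero c := ext_lift fun t => by simp
  smul_add c a b := ext_lift fun t => by simp
  add_smul c d a := ext_lift fun t => by simp [add_smul]
  zero_smul a := ext_lift fun t => by simp

instance : Lattice (LatticeTensor E) where
  le a b := ∀ t : LatticeTarget E, lift t a ≤ lift t b
  sup := supFun
  inf a b := -supFun (-a) (-b)
  le_refl a t := le_rfl
  le_trans a b c h h' t := (h t).trans (h' t)
  le_antisymm a b h h' := ext_lift fun t => (h t).antisymm (h' t)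
  le_sup_left a b t := by simp [lift_supFun]
  le_sup_right a b t := by simp [lift_supFun]
  sup_le a b c h h' t := by simpa [lift_supFun] using ⟨h t, h' t⟩
  inf_le_left a b t := by simp [lift_supFun, neg_sup]
  inf_le_right a b t := by simp [lift_supFun, neg_sup]
  le_inf a b c h h' t := by simpa [lift_supFun, neg_sup] using ⟨h t, h' t⟩

theorem le_iff_lift {a b : LatticeTensor E} :
    a ≤ b ↔ ∀ t : LatticeTarget E, lift t a ≤ lift t b := Iff.rfl

@[simp] theorem lift_sup (t : LatticeTarget E) (a b : LatticeTensor E) :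
    lift t (a ⊔ b) = lift t a ⊔ lift t b := lift_supFun t a b

theorem inf_def (a b : LatticeTensor E) : a ⊓ b = -(-a ⊔ -b) := rfl

@[simp] theorem lift_inf (t : LatticeTarget E) (a b : LatticeTensor E) :
    lift t (a ⊓ b) = lift t a ⊓ lift t b := by
  simp [inf_def, neg_sup]

instance : IsOrderedAddMonoid (LatticeTensor E) where
  add_le_add_left a b h c t := by simpa using h t

instance : IsOrderedModule ℝ (LatticeTensor E) where
  smul_le_smul_of_nonneg_left c hc a b h t := by
    simpa using smul_le_smul_of_nonneg_left (h t) hc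
  smul_le_smul_of_nonneg_right b hb c d h t := by
    simpa using smul_le_smul_of_nonneg_right h (by simpa using hb t)

/-- The elementary tensor `x₁ ⊗ ⋯ ⊗ x_m`. -/
def mk (x : ∀ i, E i) : LatticeTensor E := Quotient.mk _ (.tmul x)

theorem lift_mk (t : LatticeTarget E) (x : ∀ i, E i) : lift t (mk x) = t.map x := rfl

/-- The canonical lattice `m`-morphism `(x₁, …, x_m) ↦ x₁ ⊗ ⋯ ⊗ x_m`. -/
def tmul : MultilinearMap ℝ E (LatticeTensor E) where
  toFun := mk
  map_update_add' x i a b := ext_lift fun t => by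
    simp only [lift_add, lift_mk, t.map.map_update_add]
  map_update_smul' x i c a := ext_lift fun t => by
    simp only [lift_smul, lift_mk, t.map.map_update_smul]

@[simp] theorem lift_tmul (t : LatticeTarget E) (x : ∀ i, E i) : lift t (tmul x) = t.map x := rfl

/-- Every element is obtained from elementary tensors by the vector lattice operations. -/
theorem induction {p : LatticeTensor E → Prop} (tmul : ∀ x, p (tmul x)) (zero : p 0)
    (add : ∀ a b, p a → p b → p (a + b)) (smul : ∀ (c : ℝ) a, p a → p (c • a))
    (sup : ∀ a b, p a → p b → p (a ⊔ b)) (u : LatticeTensor E) : p u := by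
  induction u using Quotient.inductionOn with
  | h a =>
    induction a with
    | tmul x => exact tmul x
    | zero => exact zero
    | add a b ha hb => exact add _ _ ha hb
    | smul c a ha => exact smul c _ ha
    | sup a b ha hb => exact sup _ _ ha hb

theorem smul_sup_eq {c : ℝ} (hc : 0 ≤ c) (a b : LatticeTensor E) :
    c • (a ⊔ b) = (c • a) ⊔ (c • b) := by
  rcases hc.eq_or_lt with rfl | hc'
  · simp
  · exact (OrderIso.smulRight hc').map_sup a b

theorem abs_tmul (x : ∀ i, E i) : |(tmul x : LatticeTensor E)| = tmul fun i => |x i| :=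
  ext_lift fun t => by
    have h := t.isLatticeMultimorphism x
    rw [lift_tmul, ← h]
    simp only [abs, lift_sup, lift_neg, lift_tmul]

theorem archimedean : IsArchimedeanLattice (LatticeTensor E) := fun x y h t => by
  refine t.archimedean (lift t x) (lift t y) fun n => ?_
  simpa [← Nat.cast_smul_eq_nsmul ℝ] using le_iff_lift.1 (h n) t

theorem abs_smul_eq (c : ℝ) (u : LatticeTensor E) : |c • u| = |c| • |u| := by
  rcases le_total 0 c with hc | hc
  · rw [abs_of_nonneg hc, abs, abs, smul_sup_eq hc, smul_neg]
  · rw [abs_of_nonpos hc, abs, abs, smul_sup_eq (neg_nonneg.2 hc), sup_comm]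
    simp

end LatticeTensor

end Fremlin

/-! ## The positive projective tensor norm -/

section Norm

variable {m : ℕ} {E : Fin m → Type u}
  [∀ i, NormedAddCommGroup (E i)] [∀ i, NormedSpace ℝ (E i)] [∀ i, Lattice (E i)]

namespace LatticeTensor

/-- The numbers `∑ₖ ‖x₁ₖ‖ ⋯ ‖x_mₖ‖` over all finite families of positive vectors with
`|u| ≤ ∑ₖ x₁ₖ ⊗ ⋯ ⊗ x_mₖ`. -/
def normSet (u : LatticeTensor E) : Set ℝ :=
  {r | ∃ (n : ℕ) (x : Fin n → ∀ i, E i), (∀ k i, 0 ≤ x k i) ∧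
    |u| ≤ ∑ k, tmul (x k) ∧ r = ∑ k, ∏ i, ‖x k i‖}

/-- The positive projective tensor norm `‖u‖_{|π|}`. -/
noncomputable def projNorm (u : LatticeTensor E) : ℝ := sInf (normSet u)

theorem normSet_nonneg {u : LatticeTensor E} {r : ℝ} (h : r ∈ normSet u) : 0 ≤ r := by
  obtain ⟨n, x, -, -, rfl⟩ := h
  exact Finset.sum_nonneg fun k _ => Finset.prod_nonneg fun i _ => norm_nonneg _

theorem normSet_bddBelow (u : LatticeTensor E) : BddBelow (normSet u) :=
  ⟨0, fun _ h => normSet_nonneg h⟩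

theorem projNorm_nonneg (u : LatticeTensor E) : 0 ≤ projNorm u :=
  Real.sInf_nonneg fun _ h => normSet_nonneg h

theorem normSet_anti {u v : LatticeTensor E} (h : |u| ≤ |v|) : normSet v ⊆ normSet u := by
  rintro r ⟨n, x, hx, hv, rfl⟩
  exact ⟨n, x, hx, h.trans hv, rfl⟩

theorem zero_mem_normSet : (0 : ℝ) ∈ normSet (0 : LatticeTensor E) :=
  ⟨0, fun k => k.elim0, fun k => k.elim0, by simp, by simp⟩

theorem projNorm_zero : projNorm (0 : LatticeTensor E) = 0 :=
  le_antisymm (csInf_le (normSet_bddBelow _) zero_mem_normSet) (projNorm_nonneg _)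

theorem add_mem_normSet {u v w : LatticeTensor E} {r s : ℝ} (hr : r ∈ normSet u)
    (hs : s ∈ normSet v) (hw : |w| ≤ |u| + |v|) : r + s ∈ normSet w := by
  obtain ⟨n, x, hx, hu, rfl⟩ := hr
  obtain ⟨n', x', hx', hv, rfl⟩ := hs
  refine ⟨n + n', Fin.append x x', ?_, ?_, ?_⟩
  · intro k
    induction k using Fin.addCases with
    | left k => simpa using hx k
    | right k => simpa using hx' k
  · simpa [Fin.sum_univ_add] using hw.trans (add_le_add hu hv)
  · simp [Fin.sum_univ_add]

theorem smul_mem_normSet [NeZero m] [∀ i, IsOrderedModule ℝ (E i)] {u : LatticeTensor E} {r c : ℝ} (hc : 0 ≤ c)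
    (hr : r ∈ normSet u) : c * r ∈ normSet (c • u) := by
  obtain ⟨n, x, hx, hu, rfl⟩ := hr
  refine ⟨n, fun k => Function.update (x k) 0 (c • x k 0), ?_, ?_, ?_⟩
  · intro k i
    rcases eq_or_ne i 0 with rfl | hi
    · simpa using smul_nonneg hc (hx k 0)
    · simpa [hi] using hx k i
  · rw [abs_smul_eq, abs_of_nonneg hc]
    simpa [Finset.smul_sum] using smul_le_smul_of_nonneg_left hu hc
  · rw [Finset.mul_sum]
    refine Finset.sum_congr rfl fun k _ => ?_
    rw [← Finset.mul_prod_erase _ _ (Finset.mem_univ (0 : Fin m)),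
      ← Finset.mul_prod_erase _ (fun i => ‖Function.update (x k) 0 (c • x k 0) i‖)
        (Finset.mem_univ (0 : Fin m))]
    have : ∏ i ∈ Finset.univ.erase (0 : Fin m), ‖Function.update (x k) 0 (c • x k 0) i‖ =
        ∏ i ∈ Finset.univ.erase (0 : Fin m), ‖x k i‖ :=
      Finset.prod_congr rfl fun i hi => by
        rw [Function.update_of_ne (Finset.ne_of_mem_erase hi)]
    rw [this]
    simp [norm_smul, abs_of_nonneg hc, mul_assoc]

theorem normSet_nonempty [NeZero m] [∀ i, IsOrderedAddMonoid (E i)]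
    [∀ i, IsOrderedModule ℝ (E i)] (u : LatticeTensor E) : (normSet u).Nonempty := by
  induction u using LatticeTensor.induction with
  | tmul x =>
    refine ⟨_, 1, fun _ i => |x i|, fun _ i => abs_nonneg _, ?_, rfl⟩
    simpa using (abs_tmul x).le
  | zero => exact ⟨_, zero_mem_normSet⟩
  | add a b ha hb =>
    obtain ⟨r, hr⟩ := ha
    obtain ⟨s, hs⟩ := hb
    exact ⟨_, add_mem_normSet hr hs (abs_add_le _ _)⟩
  | smul c a ha =>
    obtain ⟨r, hr⟩ := ha
    refine ⟨_, normSet_anti (?_ : |_| ≤ |_|) (smul_mem_normSet (abs_nonneg c) hr)⟩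
    rw [abs_smul_eq, abs_smul_eq, abs_abs]
  | sup a b ha hb =>
    obtain ⟨r, hr⟩ := ha
    obtain ⟨s, hs⟩ := hb
    refine ⟨_, add_mem_normSet hr hs (abs_le'.2 ⟨sup_le ?_ ?_, ?_⟩)⟩
    · exact (le_abs_self _).trans (le_add_of_nonneg_right (abs_nonneg _))
    · exact (le_abs_self _).trans (le_add_of_nonneg_left (abs_nonneg _))
    · exact (neg_le_neg le_sup_left).trans
        ((neg_le_abs _).trans (le_add_of_nonneg_right (abs_nonneg _)))

variable [∀ i, IsOrderedAddMonoid (E i)] [∀ i, IsOrderedModule ℝ (E i)]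

theorem projNorm_le_of_abs_le [NeZero m] {u v : LatticeTensor E} (h : |u| ≤ |v|) :
    projNorm u ≤ projNorm v :=
  csInf_le_csInf (normSet_bddBelow u) (normSet_nonempty v) (normSet_anti h)

theorem projNorm_add_le [NeZero m] (u v : LatticeTensor E) :
    projNorm (u + v) ≤ projNorm u + projNorm v := by
  refine le_of_forall_pos_le_add fun ε hε => ?_
  obtain ⟨r, hr, hr'⟩ := Real.lt_sInf_add_pos (normSet_nonempty u) (half_pos hε)
  obtain ⟨s, hs, hs'⟩ := Real.lt_sInf_add_pos (normSet_nonempty v) (half_pos hε)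
  have := csInf_le (normSet_bddBelow _) (add_mem_normSet hr hs (abs_add_le u v))
  simp only [projNorm]
  linarith

theorem projNorm_smul_le [NeZero m] (c : ℝ) (u : LatticeTensor E) :
    projNorm (c • u) ≤ ‖c‖ * projNorm u := by
  have h1 : projNorm (c • u) ≤ projNorm (|c| • u) :=
    projNorm_le_of_abs_le (by rw [abs_smul_eq, abs_smul_eq, abs_abs])
  refine h1.trans ?_
  rw [Real.norm_eq_abs, projNorm, projNorm, ← smul_eq_mul,
    ← Real.sInf_smul_of_nonneg (abs_nonneg c)]
  refine csInf_le_csInf (normSet_bddBelow _) ((normSet_nonempty u).smul_set) ?_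
  rintro _ ⟨r, hr, rfl⟩
  exact smul_mem_normSet (abs_nonneg c) hr

theorem projNorm_neg [NeZero m] (u : LatticeTensor E) : projNorm (-u) = projNorm u :=
  le_antisymm (projNorm_le_of_abs_le (abs_neg u).le) (projNorm_le_of_abs_le (abs_neg u).ge)

noncomputable instance [NeZero m] : SeminormedAddCommGroup (LatticeTensor E) :=
  AddGroupSeminorm.toSeminormedAddCommGroup
    { toFun := projNorm
      map_zero' := projNorm_zero
      add_le' := projNorm_add_le
      neg' := projNorm_neg }

theorem norm_def [NeZero m] (u : LatticeTensor E) : ‖u‖ = projNorm u := rfl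

noncomputable instance [NeZero m] : NormedSpace ℝ (LatticeTensor E) where
  norm_smul_le := projNorm_smul_le

theorem norm_le_of_abs_le [NeZero m] {u v : LatticeTensor E} (h : |u| ≤ |v|) : ‖u‖ ≤ ‖v‖ :=
  projNorm_le_of_abs_le h

theorem norm_sup_sub_sup_le [NeZero m] (a b c d : LatticeTensor E) :
    ‖a ⊔ b - c ⊔ d‖ ≤ ‖a - c‖ + ‖b - d‖ := by
  have h1 : ‖a ⊔ b - c ⊔ b‖ ≤ ‖a - c‖ := norm_le_of_abs_le (abs_sup_sub_sup_le_abs a c b)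
  have h2 : ‖c ⊔ b - c ⊔ d‖ ≤ ‖b - d‖ := by
    rw [sup_comm c b, sup_comm c d]
    exact norm_le_of_abs_le (abs_sup_sub_sup_le_abs b d c)
  calc ‖a ⊔ b - c ⊔ d‖ = ‖(a ⊔ b - c ⊔ b) + (c ⊔ b - c ⊔ d)‖ := by rw [sub_add_sub_cancel]
    _ ≤ _ := (norm_add_le _ _).trans (add_le_add h1 h2)

theorem uniformContinuous_sup [NeZero m] :
    UniformContinuous₂ (fun a b : LatticeTensor E => a ⊔ b) := by
  refine Metric.uniformContinuous_iff.2 fun ε hε => ⟨ε / 2, half_pos hε, ?_⟩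
  rintro ⟨a, b⟩ ⟨c, d⟩ h
  have h1 : dist a c < ε / 2 := (le_max_left _ _).trans_lt h
  have h2 : dist b d < ε / 2 := (le_max_right _ _).trans_lt h
  rw [dist_eq_norm] at h1 h2
  change dist (a ⊔ b) (c ⊔ d) < ε
  rw [dist_eq_norm]
  linarith [norm_sup_sub_sup_le a b c d]

theorem uniformContinuous_inf [NeZero m] :
    UniformContinuous₂ (fun a b : LatticeTensor E => a ⊓ b) := by
  have h : UniformContinuous fun x : LatticeTensor E × LatticeTensor E => (-x.1, -x.2) :=
    uniformContinuous_fst.neg.prodMk uniformContinuous_snd.neg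
  exact (UniformContinuous.comp (uniformContinuous_sup (E := E)) h).neg

end LatticeTensor

end Norm

/-! ## The positive projective tensor product -/

section Completion

variable {m : ℕ} [NeZero m] (E : Fin m → Type u)
  [∀ i, NormedAddCommGroup (E i)] [∀ i, NormedSpace ℝ (E i)] [∀ i, Lattice (E i)]
  [∀ i, IsOrderedAddMonoid (E i)] [∀ i, IsOrderedModule ℝ (E i)]

/-- The positive projective tensor product `E₁ ⊗̂ ⋯ ⊗̂ E_m`: the completion of the vector lattice
tensor product for the positive projective tensor norm, with the lattice operations extended by
continuity. -/
def PosProjTensor : Type u := UniformSpace.Completion (LatticeTensor E)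

namespace PosProjTensor

noncomputable instance : NormedAddCommGroup (PosProjTensor E) :=
  inferInstanceAs (NormedAddCommGroup (UniformSpace.Completion (LatticeTensor E)))

noncomputable instance : NormedSpace ℝ (PosProjTensor E) :=
  inferInstanceAs (NormedSpace ℝ (UniformSpace.Completion (LatticeTensor E)))

instance : CompleteSpace (PosProjTensor E) :=
  inferInstanceAs (CompleteSpace (UniformSpace.Completion (LatticeTensor E)))

variable {E}

/-- The canonical isometric linear map of the vector lattice tensor product into its completion. -/
noncomputable def ofLatticeTensor : LatticeTensor E →ₗᵢ[ℝ] PosProjTensor E :=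
  UniformSpace.Completion.toComplₗᵢ

theorem denseRange_of : DenseRange (ofLatticeTensor (E := E)) :=
  UniformSpace.Completion.denseRange_coe

/-- The supremum, extended by continuity. -/
noncomputable def supFun : PosProjTensor E → PosProjTensor E → PosProjTensor E :=
  UniformSpace.Completion.map₂ fun a b : LatticeTensor E => a ⊔ b

/-- The infimum, extended by continuity. -/
noncomputable def infFun : PosProjTensor E → PosProjTensor E → PosProjTensor E :=
  UniformSpace.Completion.map₂ fun a b : LatticeTensor E => a ⊓ b

theorem supFun_of (a b : LatticeTensor E) :
    supFun (ofLatticeTensor a) (ofLatticeTensor b) = ofLatticeTensor (a ⊔ b) :=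
  UniformSpace.Completion.map₂_coe_coe a b _ LatticeTensor.uniformContinuous_sup

theorem infFun_of (a b : LatticeTensor E) :
    infFun (ofLatticeTensor a) (ofLatticeTensor b) = ofLatticeTensor (a ⊓ b) :=
  UniformSpace.Completion.map₂_coe_coe a b _ LatticeTensor.uniformContinuous_inf

@[fun_prop] theorem continuous_supFun {X : Type*} [TopologicalSpace X] {f g : X → PosProjTensor E}
    (hf : Continuous f) (hg : Continuous g) : Continuous fun x => supFun (f x) (g x) :=
  UniformSpace.Completion.continuous_map₂ hf hg

@[fun_prop] theorem continuous_infFun {X : Type*} [TopologicalSpace X] {f g : X → PosProjTensor E}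
    (hf : Continuous f) (hg : Continuous g) : Continuous fun x => infFun (f x) (g x) :=
  UniformSpace.Completion.continuous_map₂ hf hg

theorem ind₁ {p : PosProjTensor E → Prop} (hp : IsClosed {a | p a})
    (h : ∀ a, p (ofLatticeTensor a)) (a : PosProjTensor E) : p a :=
  UniformSpace.Completion.induction_on a hp h

theorem ind₂ {p : PosProjTensor E → PosProjTensor E → Prop}
    (hp : IsClosed {x : PosProjTensor E × PosProjTensor E | p x.1 x.2})
    (h : ∀ a b, p (ofLatticeTensor a) (ofLatticeTensor b)) (a b : PosProjTensor E) : p a b :=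
  UniformSpace.Completion.induction_on₂ a b hp h

theorem ind₃ {p : PosProjTensor E → PosProjTensor E → PosProjTensor E → Prop}
    (hp : IsClosed {x : PosProjTensor E × PosProjTensor E × PosProjTensor E | p x.1 x.2.1 x.2.2})
    (h : ∀ a b c, p (ofLatticeTensor a) (ofLatticeTensor b) (ofLatticeTensor c))
    (a b c : PosProjTensor E) : p a b c :=
  UniformSpace.Completion.induction_on₃ a b c hp h

noncomputable instance : Lattice (PosProjTensor E) :=
  @Lattice.mk' _ ⟨supFun⟩ ⟨infFun⟩
    (ind₂ (isClosed_eq (continuous_supFun (by fun_prop) (by fun_prop))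
        (continuous_supFun (by fun_prop) (by fun_prop))) fun a b => by
      change supFun _ _ = supFun _ _
      simp only [supFun_of, sup_comm])
    (ind₃ (isClosed_eq (continuous_supFun (continuous_supFun (by fun_prop) (by fun_prop))
        (by fun_prop)) (continuous_supFun (by fun_prop)
          (continuous_supFun (by fun_prop) (by fun_prop)))) fun a b c => by
      change supFun (supFun _ _) _ = supFun _ (supFun _ _)
      simp only [supFun_of, sup_assoc])
    (ind₂ (isClosed_eq (continuous_infFun (by fun_prop) (by fun_prop))
        (continuous_infFun (by fun_prop) (by fun_prop))) fun a b => by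
      change infFun _ _ = infFun _ _
      simp only [infFun_of, inf_comm])
    (ind₃ (isClosed_eq (continuous_infFun (continuous_infFun (by fun_prop) (by fun_prop))
        (by fun_prop)) (continuous_infFun (by fun_prop)
          (continuous_infFun (by fun_prop) (by fun_prop)))) fun a b c => by
      change infFun (infFun _ _) _ = infFun _ (infFun _ _)
      simp only [infFun_of, inf_assoc])
    (ind₂ (isClosed_eq (continuous_supFun (by fun_prop)
        (continuous_infFun (by fun_prop) (by fun_prop))) (by fun_prop)) fun a b => by
      change supFun _ (infFun _ _) = _
      simp only [supFun_of, infFun_of, sup_inf_self])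
    (ind₂ (isClosed_eq (continuous_infFun (by fun_prop)
        (continuous_supFun (by fun_prop) (by fun_prop))) (by fun_prop)) fun a b => by
      change infFun _ (supFun _ _) = _
      simp only [supFun_of, infFun_of, inf_sup_self])

theorem of_sup (a b : LatticeTensor E) :
    ofLatticeTensor (a ⊔ b) = ofLatticeTensor a ⊔ ofLatticeTensor b :=
  (supFun_of a b).symm

theorem of_inf (a b : LatticeTensor E) :
    ofLatticeTensor (a ⊓ b) = ofLatticeTensor a ⊓ ofLatticeTensor b :=
  (infFun_of a b).symm

@[fun_prop] theorem continuous_sup' {X : Type*} [TopologicalSpace X] {f g : X → PosProjTensor E}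
    (hf : Continuous f) (hg : Continuous g) : Continuous fun x => f x ⊔ g x :=
  continuous_supFun hf hg

theorem sup_add' (a b c : PosProjTensor E) : (a ⊔ b) + c = (a + c) ⊔ (b + c) := by
  revert a b c
  refine ind₃ (isClosed_eq (by fun_prop) (by fun_prop)) fun a b c => ?_
  simp only [← of_sup, ← map_add, sup_add]

instance : IsOrderedAddMonoid (PosProjTensor E) where
  add_le_add_left a b h c := by
    rw [← sup_eq_right] at h ⊢
    rw [← sup_add', h]

theorem smul_sup' (r : ℝ) (hr : 0 ≤ r) (a b : PosProjTensor E) :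
    r • (a ⊔ b) = (r • a) ⊔ (r • b) := by
  revert a b
  have hc : Continuous fun a : PosProjTensor E => r • a := continuous_const_smul r
  refine ind₂ (isClosed_eq (hc.comp (continuous_sup' continuous_fst continuous_snd))
    (continuous_sup' (hc.comp continuous_fst) (hc.comp continuous_snd))) fun a b => ?_
  rw [← of_sup, ← map_smul, ← map_smul, ← map_smul, ← of_sup, LatticeTensor.smul_sup_eq hr]

instance : IsOrderedModule ℝ (PosProjTensor E) :=
  have h : ∀ r : ℝ, 0 ≤ r → ∀ a b : PosProjTensor E, a ≤ b → r • a ≤ r • b := by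
    intro r hr a b hab
    rw [← sup_eq_right] at hab ⊢
    rw [← smul_sup' r hr, hab]
  { smul_le_smul_of_nonneg_left := fun r hr a b hab => h r hr a b hab
    smul_le_smul_of_nonneg_right := fun b hb r s hrs => by
      have := h (s - r) (sub_nonneg.2 hrs) 0 b hb
      rw [smul_zero, sub_smul] at this
      exact sub_nonneg.1 this }

theorem of_abs (a : LatticeTensor E) : ofLatticeTensor |a| = |ofLatticeTensor a| := by
  simp only [abs, of_sup, map_neg]

instance : HasSolidNorm (PosProjTensor E) where
  solid x y hxy := by
    have hc : Continuous fun x : PosProjTensor E => |x| := by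
      change Continuous fun x : PosProjTensor E => x ⊔ -x
      fun_prop
    have h1 : ∀ x : PosProjTensor E, ‖|x|‖ = ‖x‖ := by
      refine ind₁ (isClosed_eq hc.norm continuous_norm) fun a => ?_
      rw [← of_abs, LinearIsometry.norm_map, LinearIsometry.norm_map]
      exact le_antisymm (LatticeTensor.norm_le_of_abs_le (abs_abs a).le)
        (LatticeTensor.norm_le_of_abs_le (abs_abs a).ge)
    have h2 : ∀ x y : PosProjTensor E, ‖|x|‖ ≤ ‖|x| ⊔ |y|‖ := by
      refine ind₂ (isClosed_le (hc.comp continuous_fst).norm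
        (continuous_sup' (hc.comp continuous_fst) (hc.comp continuous_snd)).norm) fun a b => ?_
      rw [← of_abs, ← of_abs, ← of_sup, LinearIsometry.norm_map, LinearIsometry.norm_map]
      refine LatticeTensor.norm_le_of_abs_le ?_
      rw [abs_abs]
      exact le_sup_left.trans (le_abs_self _)
    have := h2 x y
    rwa [sup_eq_right.2 hxy, h1, h1] at this

/-- The canonical `m`-morphism `⊗_m : E₁ × ⋯ × E_m → E₁ ⊗̂ ⋯ ⊗̂ E_m`. -/
noncomputable def tmul : MultilinearMap ℝ E (PosProjTensor E) :=
  ofLatticeTensor.toLinearMap.compMultilinearMap LatticeTensor.tmul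

end PosProjTensor

variable {E}

/-- `S` is a linearization of `T` on the positive projective tensor product: `S` is a regular
linear operator with `S (x₁ ⊗ ⋯ ⊗ x_m) = T (x₁, …, x_m)`. -/
def IsLinearization {G : Type u} [NormedAddCommGroup G] [NormedSpace ℝ G] [Lattice G]
    (T : MultilinearMap ℝ E G) (S : PosProjTensor E →ₗ[ℝ] G) : Prop :=
  IsRegularLinear S ∧ ∀ x : ∀ i, E i, S (PosProjTensor.tmul x) = T x

end Completion

end BanachLatticeTensor

set_option linter.unusedSectionVars false

namespace BanachLatticeTensor

/-! ## Vector lattices -/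

section VectorLattice

variable {V : Type u} [AddCommGroup V] [Lattice V] [IsOrderedAddMonoid V]

/-! Write P for the positive projective tensor product. If P has the PSP and `x n` is disjoint and
weakly null, then `|x n|` is weakly null as well (`WeaklyNull.abs_of_disjoint`), hence norm null,
and the bounded operator `T^⊗` sends `x n` to a null sequence. If all linearizations are almost
Dunford–Pettis, then `T = T^⊗ ∘ ⊗` is the required factorization through P. Finally, factor the
canonical map as `⊗ = v ∘ A` with `A = A₁ - A₂` and linearize: `v ∘ (S₁ - S₂)` is the identity of P,
by density. For a positive weakly null sequence `x n` of P, the sequences `S₁ (x n)` and `S₂ (x n)`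
are positive and weakly null, and `v` sends both to null sequences, so `x n` is norm null.

Two facts carry this. The first is the existence of linearizations
(`IsPositiveMultilinear.exists_linearization`). A positive `T` need not be a lattice morphism, so
the universal property does not apply to it. Instead one shows that `T` is nonnegative on every
combination of elementary tensors that is nonnegative in the vector lattice tensor product. Cut each
factor into small parts on which the finitely many vectors involved are almost constant
(`exists_tensor_partition`). The combination is then almost a sum of elementary tensors of the parts
with coefficients `C J`. Since elementary tensors of nonzero positive vectors do not vanish
(`tmul_ne_zero`), nonnegativity forces the coefficients that matter to be almost nonnegative. The
same partitions show that combinations of positive elementary tensors are dense in the positive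
cone.

The second is that a bounded almost Dunford–Pettis operator on a Banach lattice is null along all
positive weakly null sequences, disjoint or not (`IsAlmostDunfordPettis.tendsto_of_nonneg`). This is
a disjointification argument for the lattice seminorm `solidSeminorm`.

Pointwise reasoning in an abstract Archimedean lattice rests on `NonposOn`, an inequality on the
support of a positive vector, and on `exists_isLocalHom`, which provides enough real-valued lattice
homomorphisms for countably many vectors at a time. -/

theorem add_inf_le_add_inf {a b c : V} (ha : 0 ≤ a) (hb : 0 ≤ b) (hc : 0 ≤ c) :
    (a + b) ⊓ c ≤ a ⊓ c + b ⊓ c := by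
  rw [inf_add, add_inf, add_inf]
  refine le_inf (le_inf inf_le_left ?_) (le_inf ?_ ?_)
  · exact inf_le_right.trans (le_add_of_nonneg_left ha)
  · exact inf_le_right.trans (le_add_of_nonneg_right hb)
  · exact inf_le_right.trans (le_add_of_nonneg_right hc)

theorem posPart_add_le (a b : V) : (a + b)⁺ ≤ a⁺ + b⁺ :=
  sup_le (add_le_add (le_posPart a) (le_posPart b)) (add_nonneg (posPart_nonneg a) (posPart_nonneg b))

theorem two_nsmul_inf (a b : V) : 2 • (a ⊓ b) = a + b - |a - b| := by
  have h1 := inf_add_sup a b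
  have h2 := sup_sub_inf_eq_abs_sub a b
  rw [abs_sub_comm, ← h2, ← h1, two_nsmul]
  abel

variable [Module ℝ V] [IsOrderedModule ℝ V]

theorem smul_sup_of_nonneg {c : ℝ} (hc : 0 ≤ c) (a b : V) : c • (a ⊔ b) = (c • a) ⊔ (c • b) := by
  rcases hc.eq_or_lt with rfl | hc'
  · simp
  · exact (OrderIso.smulRight hc').map_sup a b

theorem smul_inf_of_nonneg {c : ℝ} (hc : 0 ≤ c) (a b : V) : c • (a ⊓ b) = (c • a) ⊓ (c • b) := by
  rcases hc.eq_or_lt with rfl | hc'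
  · simp
  · exact (OrderIso.smulRight hc').map_inf a b

theorem posPart_smul_of_nonneg {c : ℝ} (hc : 0 ≤ c) (a : V) : (c • a)⁺ = c • a⁺ := by
  rw [posPart_def, posPart_def, smul_sup_of_nonneg hc, smul_zero]

theorem abs_smul_of_nonneg {c : ℝ} (hc : 0 ≤ c) (a : V) : |c • a| = c • |a| := by
  rw [abs, abs, smul_sup_of_nonneg hc, smul_neg]

theorem abs_real_smul (c : ℝ) (a : V) : |c • a| = |c| • |a| := by
  rcases le_total 0 c with hc | hc
  · rw [abs_smul_of_nonneg hc, abs_of_nonneg hc]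
  · rw [abs_of_nonpos hc, ← abs_smul_of_nonneg (neg_nonneg.2 hc), neg_smul, abs_neg]

theorem smul_inf_eq_zero {c : ℝ} (hc : 0 ≤ c) {a b : V} (ha : 0 ≤ a) (hb : 0 ≤ b)
    (h : a ⊓ b = 0) : (c • a) ⊓ b = 0 := by
  refine le_antisymm ?_ (le_inf (smul_nonneg hc ha) hb)
  calc (c • a) ⊓ b ≤ (max c 1 • a) ⊓ (max c 1 • b) := by
        refine inf_le_inf (smul_le_smul_of_nonneg_right (le_max_left _ _) ha) ?_
        simpa using smul_le_smul_of_nonneg_right (le_max_right c 1) hb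
    _ = 0 := by rw [← smul_inf_of_nonneg (hc.trans (le_max_left _ _)), h, smul_zero]

theorem inf_eq_zero_of_le {a b a' b' : V} (ha : 0 ≤ a) (hb : 0 ≤ b) (haa : a ≤ a') (hbb : b ≤ b')
    (h : a' ⊓ b' = 0) : a ⊓ b = 0 :=
  le_antisymm ((inf_le_inf haa hbb).trans h.le) (le_inf ha hb)

/-! ### Inequalities on the support of a positive vector -/

/-- `x ≤ 0` on the support of `η`. -/
def NonposOn (η x : V) : Prop := x⁺ ⊓ η = 0

namespace NonposOn

variable {η θ x y : V}

theorem mono (hη : 0 ≤ η) (h : NonposOn η x) (hy : y ≤ x) : NonposOn η y :=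
  inf_eq_zero_of_le (posPart_nonneg _) hη (posPart_mono hy) le_rfl h

theorem anti {η' : V} (h : NonposOn η x) (hη' : 0 ≤ η') (hle : η' ≤ η) : NonposOn η' x :=
  inf_eq_zero_of_le (posPart_nonneg _) hη' le_rfl hle h

theorem of_posPart_le_add {z : V} (hη : 0 ≤ η) (hx : NonposOn η x) (hy : NonposOn η y)
    (hz : z⁺ ≤ x⁺ + y⁺) : NonposOn η z := by
  refine le_antisymm ?_ (le_inf (posPart_nonneg _) hη)
  calc z⁺ ⊓ η ≤ (x⁺ + y⁺) ⊓ η := inf_le_inf_right _ hz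
    _ ≤ x⁺ ⊓ η + y⁺ ⊓ η := add_inf_le_add_inf (posPart_nonneg _) (posPart_nonneg _) hη
    _ = 0 := by rw [show x⁺ ⊓ η = 0 from hx, show y⁺ ⊓ η = 0 from hy, add_zero]

theorem add (hη : 0 ≤ η) (hx : NonposOn η x) (hy : NonposOn η y) : NonposOn η (x + y) :=
  of_posPart_le_add hη hx hy (posPart_add_le x y)

theorem sup (hη : 0 ≤ η) (hx : NonposOn η x) (hy : NonposOn η y) : NonposOn η (x ⊔ y) :=
  of_posPart_le_add hη hx hy <| sup_le (sup_le
    ((le_posPart x).trans (le_add_of_nonneg_right (posPart_nonneg _)))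
    ((le_posPart y).trans (le_add_of_nonneg_left (posPart_nonneg _))))
    (add_nonneg (posPart_nonneg _) (posPart_nonneg _))

theorem smul {c : ℝ} (hc : 0 ≤ c) (hη : 0 ≤ η) (hx : NonposOn η x) : NonposOn η (c • x) := by
  rw [NonposOn, posPart_smul_of_nonneg hc]
  exact smul_inf_eq_zero hc (posPart_nonneg _) hη hx

theorem of_nonpos (hη : 0 ≤ η) (hx : x ≤ 0) : NonposOn η x := by
  rw [NonposOn, posPart_eq_zero.2 hx, inf_eq_left.2 hη]

theorem sum {ι : Type*} {s : Finset ι} {f : ι → V} (hη : 0 ≤ η)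
    (h : ∀ i ∈ s, NonposOn η (f i)) : NonposOn η (∑ i ∈ s, f i) :=
  Finset.sum_induction f (NonposOn η) (fun _ _ => add hη) (of_nonpos hη le_rfl) h

/-- `x ≤ 0` on the support of the negative part of `x`. -/
theorem negPart_inf (hη : 0 ≤ η) (x : V) : NonposOn (x⁻ ⊓ η) x := by
  refine anti ?_ (le_inf (negPart_nonneg x) hη) inf_le_left
  exact posPart_inf_negPart_eq_zero x

/-- Turns an inequality on a nonzero support below `θ` into one between real numbers: for `c > 0`
the vector `θ` would be disjoint from `η ≤ θ`, hence `η = 0`. -/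
theorem coe_nonpos {c : ℝ} (hη : 0 ≤ η) (hne : η ≠ 0) (hle : η ≤ θ)
    (h : NonposOn η (c • θ)) : c ≤ 0 := by
  by_contra! hc
  have h1 : NonposOn η θ := by
    have := smul (inv_nonneg.2 hc.le) hη h
    rwa [smul_smul, inv_mul_cancel₀ hc.ne', one_smul] at this
  rw [NonposOn, posPart_of_nonneg (hη.trans hle), inf_eq_right.2 hle] at h1
  exact hne h1

end NonposOn

variable {η θ : V}

/-- In an Archimedean vector lattice every vector `x` is bounded by a multiple of `η` on a smaller
nonzero support. -/
theorem exists_nonposOn_abs_sub (hV : IsArchimedeanLattice V) (hη : 0 ≤ η) (hne : η ≠ 0) (x : V) :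
    ∃ (n : ℕ) (η' : V), 0 ≤ η' ∧ η' ≠ 0 ∧ η' ≤ η ∧ NonposOn η' (|x| - (n : ℝ) • η) := by
  by_contra! hcon
  apply hne
  refine le_antisymm (hV η |x| fun n => ?_) hη
  -- Otherwise this infimum would serve as the smaller support. The negative part is thus disjoint
  -- from `η` and also bounded by `n • η`, so it vanishes; then `n • η ≤ |x|` for all `n`, against
  -- the Archimedean property.
  have h1 : (|x| - (n : ℝ) • η)⁻ ⊓ η = 0 := by
    by_contra h
    exact hcon n _ (le_inf (negPart_nonneg _) hη) h inf_le_right (NonposOn.negPart_inf hη _)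
  have h2 : (|x| - (n : ℝ) • η)⁻ ≤ (n : ℝ) • η := by
    rw [negPart_def, neg_sub]
    exact sup_le (sub_le_self _ (abs_nonneg x)) (smul_nonneg n.cast_nonneg hη)
  have h3 : (|x| - (n : ℝ) • η)⁻ = 0 := by
    rw [inf_comm] at h1
    have := smul_inf_eq_zero (n.cast_nonneg : (0 : ℝ) ≤ n) hη (negPart_nonneg _) h1
    rwa [inf_eq_right.2 h2] at this
  rw [negPart_eq_zero, sub_nonneg] at h3
  rwa [← Nat.cast_smul_eq_nsmul ℝ]

/-- On a smaller nonzero support every vector `x` is almost equal to a multiple of `θ`. -/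
theorem exists_nonposOn_sub_smul (hV : IsArchimedeanLattice V) (hη : 0 ≤ η) (hne : η ≠ 0)
    (hle : η ≤ θ) (x : V) {ε : ℝ} (hε : 0 < ε) :
    ∃ (η' : V) (c : ℝ), 0 ≤ η' ∧ η' ≠ 0 ∧ η' ≤ η ∧ NonposOn η' (x - (c + ε) • θ) ∧
      NonposOn η' ((c - ε) • θ - x) := by
  obtain ⟨n, η₁, h0, h1, h2, h3⟩ := exists_nonposOn_abs_sub hV hη hne x
  have hθ : 0 ≤ θ := hη.trans hle
  have hnle : (n : ℝ) • η ≤ (n : ℝ) • θ := smul_le_smul_of_nonneg_left hle n.cast_nonneg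
  have hub : NonposOn η₁ (x - (n : ℝ) • θ) := h3.mono h0 (sub_le_sub (le_abs_self x) hnle)
  have hlb : NonposOn η₁ (-x - (n : ℝ) • θ) := h3.mono h0 (sub_le_sub (neg_le_abs x) hnle)
  -- The coefficient will be `c = sSup A`. Above `c` the inequality `x ≤ a • θ` holds on all of
  -- `η₁`; for `a ∈ A` just below `c` it fails, and the place of failure is the new support.
  set A : Set ℝ := {a | ¬ NonposOn η₁ (x - a • θ)} with hA
  have hbdd : BddAbove A := by
    refine ⟨n, fun a ha => ?_⟩
    by_contra! hlt
    exact ha (hub.mono h0 (sub_le_sub_left (smul_le_smul_of_nonneg_right hlt.le hθ) x))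
  have hnonempty : A.Nonempty := by
    refine ⟨-n - 1, fun h => ?_⟩
    have := NonposOn.add h0 h hlb
    have h4 : x - (-(n : ℝ) - 1) • θ + (-x - (n : ℝ) • θ) = (1 : ℝ) • θ := by module
    rw [h4] at this
    exact absurd (NonposOn.coe_nonpos h0 h1 (h2.trans hle) this) (by norm_num)
  set c := sSup A
  obtain ⟨a, haA, hac⟩ := exists_lt_of_lt_csSup hnonempty (sub_lt_self c hε)
  have hup : NonposOn η₁ (x - (c + ε) • θ) := by
    by_contra h
    have := le_csSup hbdd (show c + ε ∈ A from h)
    linarith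
  -- This vector is nonzero exactly because `a ∈ A`, and on its support `x ≥ a • θ ≥ (c - ε) • θ`.
  refine ⟨(x - a • θ)⁺ ⊓ η₁, c, le_inf (posPart_nonneg _) h0, haA, inf_le_right.trans h2,
    hup.anti (le_inf (posPart_nonneg _) h0) inf_le_right, ?_⟩
  have h5 := NonposOn.negPart_inf h0 (a • θ - x)
  rw [← neg_sub, negPart_neg] at h5
  refine h5.mono (le_inf (posPart_nonneg _) h0) ?_
  rw [neg_sub]
  exact sub_le_sub_right (smul_le_smul_of_nonneg_right hac.le hθ) x

/-! ### Real-valued lattice homomorphisms on vector sublattices -/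

/-- `ω` is a real-valued lattice homomorphism on the vector sublattice `L`. -/
structure IsLocalHom (L : Submodule ℝ V) (ω : V → ℝ) : Prop where
  map_add : ∀ x ∈ L, ∀ y ∈ L, ω (x + y) = ω x + ω y
  map_smul : ∀ (c : ℝ), ∀ x ∈ L, ω (c • x) = c * ω x
  sup_mem : ∀ x ∈ L, ∀ y ∈ L, x ⊔ y ∈ L
  map_sup : ∀ x ∈ L, ∀ y ∈ L, ω (x ⊔ y) = ω x ⊔ ω y

/-- Every countable set is contained in a vector sublattice with a real-valued lattice homomorphism
that does not vanish at a given nonzero positive vector. -/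
theorem exists_isLocalHom (hV : IsArchimedeanLattice V) (hθ : 0 ≤ θ) (hne : θ ≠ 0)
    (d : ℕ → V) : ∃ (L : Submodule ℝ V) (ω : V → ℝ), IsLocalHom L ω ∧ (∀ n, d n ∈ L) ∧
      θ ∈ L ∧ ω θ = 1 := by
  let P : V → Prop := fun η => 0 ≤ η ∧ η ≠ 0 ∧ η ≤ θ
  -- Stage `n`, decoded as a pair `(k, l)`, shrinks the support until `d k` is within `1 / (l + 1)`
  -- of a multiple of `θ`. The nested nonzero supports play the role of a point.
  have step : ∀ (n : ℕ) (η : {η // P η}), ∃ η' : {η // P η}, η'.1 ≤ η.1 ∧ ∃ c : ℝ,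
      NonposOn η'.1 (d n.unpair.1 - (c + 1 / (n.unpair.2 + 1)) • θ) ∧
      NonposOn η'.1 ((c - 1 / (n.unpair.2 + 1)) • θ - d n.unpair.1) := by
    rintro n ⟨η, h0, h1, h2⟩
    obtain ⟨η', c, h3, h4, h5, h6, h7⟩ := exists_nonposOn_sub_smul hV h0 h1 h2 (d n.unpair.1)
      (show (0 : ℝ) < 1 / (n.unpair.2 + 1) by positivity)
    exact ⟨⟨η', h3, h4, h5.trans h2⟩, h5, c, h6, h7⟩
  choose g hg hgc using step
  let η : ℕ → {η // P η} := fun n => Nat.rec ⟨θ, hθ, hne, le_rfl⟩ (fun n η => g n η) n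
  have hanti : Antitone fun n => (η n).1 := antitone_nat_of_succ_le fun n => hg n (η n)
  have h0 : ∀ n, 0 ≤ (η n).1 := fun n => (η n).2.1
  -- `R x c` says that `x` approaches `c • θ` along the shrinking supports; `ω x` will be this `c`.
  -- Estimates found at stages `n` and `k` both persist at `max n k`, so `R` respects the vector
  -- lattice operations.
  let R : V → ℝ → Prop := fun x c => ∀ ε : ℝ, 0 < ε → ∃ n, NonposOn (η n).1 (x - (c + ε) • θ) ∧
    NonposOn (η n).1 ((c - ε) • θ - x)
  have Rle : ∀ {x y c d}, R x c → R y d → x ≤ y → c ≤ d := by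
    intro x y c d hx hy hxy
    refine le_of_forall_pos_le_add fun ε hε => ?_
    obtain ⟨n, -, h1⟩ := hx (ε / 2) (half_pos hε)
    obtain ⟨k, h2, -⟩ := hy (ε / 2) (half_pos hε)
    have h1' := h1.anti (h0 (max n k)) (hanti (le_max_left n k))
    have h2' := h2.anti (h0 (max n k)) (hanti (le_max_right n k))
    have h3 : NonposOn (η (max n k)).1 ((c - d - ε) • θ) := by
      refine (NonposOn.add (h0 _) h1' h2').mono (h0 _) ?_
      have : (c - ε / 2) • θ - x + (y - (d + ε / 2) • θ) = (c - d - ε) • θ + (y - x) := by module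
      rw [this]
      exact le_add_of_nonneg_right (sub_nonneg.2 hxy)
    have := NonposOn.coe_nonpos (h0 _) (η _).2.2.1 (η _).2.2.2 h3
    linarith
  have Runique : ∀ {x c d}, R x c → R x d → c = d := fun h h' =>
    le_antisymm (Rle h h' le_rfl) (Rle h' h le_rfl)
  have Radd : ∀ {x y c d}, R x c → R y d → R (x + y) (c + d) := by
    intro x y c d hx hy ε hε
    obtain ⟨n, h1, h2⟩ := hx (ε / 2) (half_pos hε)
    obtain ⟨k, h3, h4⟩ := hy (ε / 2) (half_pos hε)
    refine ⟨max n k, ?_, ?_⟩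
    · have := NonposOn.add (h0 _) (h1.anti (h0 (max n k)) (hanti (le_max_left n k)))
        (h3.anti (h0 (max n k)) (hanti (le_max_right n k)))
      refine this.mono (h0 _) (le_of_eq ?_)
      module
    · have := NonposOn.add (h0 _) (h2.anti (h0 (max n k)) (hanti (le_max_left n k)))
        (h4.anti (h0 (max n k)) (hanti (le_max_right n k)))
      refine this.mono (h0 _) (le_of_eq ?_)
      module
  have Rneg : ∀ {x c}, R x c → R (-x) (-c) := by
    intro x c hx ε hε
    obtain ⟨n, h1, h2⟩ := hx ε hε
    exact ⟨n, h2.mono (h0 _) (le_of_eq (by module)), h1.mono (h0 _) (le_of_eq (by module))⟩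
  have Rzero : R 0 0 := fun ε hε => ⟨0, NonposOn.of_nonpos (h0 0) (by
    simpa using smul_nonneg hε.le hθ), NonposOn.of_nonpos (h0 0) (by
    simpa using smul_nonneg hε.le hθ)⟩
  have Rsmul_pos : ∀ {x c} {a : ℝ}, 0 < a → R x c → R (a • x) (a * c) := by
    intro x c a ha hx ε hε
    obtain ⟨n, h1, h2⟩ := hx (ε / a) (by positivity)
    refine ⟨n, (NonposOn.smul ha.le (h0 n) h1).mono (h0 _) (le_of_eq ?_),
      (NonposOn.smul ha.le (h0 n) h2).mono (h0 _) (le_of_eq ?_)⟩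
    · rw [smul_sub, smul_smul, mul_add, mul_div_cancel₀ _ ha.ne']
    · rw [smul_sub, smul_smul, mul_sub, mul_div_cancel₀ _ ha.ne']
  have Rsmul : ∀ {x c} (a : ℝ), R x c → R (a • x) (a * c) := by
    intro x c a hx
    rcases lt_trichotomy a 0 with ha | rfl | ha
    · have := Rneg (Rsmul_pos (neg_pos.2 ha) hx)
      simpa using this
    · simpa using Rzero
    · exact Rsmul_pos ha hx
  have Rsup : ∀ {x y c d}, R x c → R y d → R (x ⊔ y) (c ⊔ d) := by
    intro x y c d hx hy ε hε
    obtain ⟨n, h1, h2⟩ := hx ε hε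
    obtain ⟨k, h3, h4⟩ := hy ε hε
    refine ⟨max n k, ?_, ?_⟩
    · have := NonposOn.sup (h0 _) (h1.anti (h0 (max n k)) (hanti (le_max_left n k)))
        (h3.anti (h0 (max n k)) (hanti (le_max_right n k)))
      refine this.mono (h0 _) ?_
      rw [sup_sub]
      refine sup_le_sup (sub_le_sub_left (smul_le_smul_of_nonneg_right ?_ hθ) _)
        (sub_le_sub_left (smul_le_smul_of_nonneg_right ?_ hθ) _)
      · linarith [le_max_left c d]
      · linarith [le_max_right c d]
    · rcases le_total c d with hcd | hcd
      · refine (h4.anti (h0 (max n k)) (hanti (le_max_right n k))).mono (h0 _) ?_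
        rw [sup_eq_right.2 hcd]
        exact sub_le_sub_left le_sup_right _
      · refine (h2.anti (h0 (max n k)) (hanti (le_max_left n k))).mono (h0 _) ?_
        rw [sup_eq_left.2 hcd]
        exact sub_le_sub_left le_sup_left _
  have Rθ : R θ 1 := fun ε hε => ⟨0, NonposOn.of_nonpos (h0 0) (by
      rw [show θ - (1 + ε) • θ = -(ε • θ) by module]
      exact neg_nonpos.2 (smul_nonneg hε.le hθ)), NonposOn.of_nonpos (h0 0) (by
      rw [show (1 - ε) • θ - θ = -(ε • θ) by module]
      exact neg_nonpos.2 (smul_nonneg hε.le hθ))⟩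
  have Rd : ∀ k, ∃ c, R (d k) c := by
    intro k
    have happrox : ∀ l : ℕ, ∃ (c : ℝ) (n : ℕ), NonposOn (η n).1 (d k - (c + 1 / (l + 1)) • θ) ∧
        NonposOn (η n).1 ((c - 1 / (l + 1)) • θ - d k) := by
      intro l
      obtain ⟨c, hc⟩ := hgc (Nat.pair k l) (η (Nat.pair k l))
      rw [Nat.unpair_pair] at hc
      -- Stage `n` produces the support with index `n + 1`; index `0` is `θ` itself.
      exact ⟨c, Nat.pair k l + 1, hc⟩
    -- The value at `d k` is the supremum of all lower coefficients. By `hA` each of them is at most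
    -- each upper coefficient, whatever the stages, so the supremum lies within `1 / (l + 1)` of the
    -- `l`-th approximation; this is why `1 / (l + 1) < ε / 2` is asked for.
    set A : Set ℝ := {a | ∃ n, NonposOn (η n).1 (a • θ - d k)}
    have hA : ∀ a ∈ A, ∀ (c : ℝ) (n : ℕ), NonposOn (η n).1 (d k - c • θ) → a ≤ c := by
      rintro a ⟨n', ha⟩ c n hc
      have := NonposOn.add (h0 _) (ha.anti (h0 (max n' n)) (hanti (le_max_left n' n)))
        (hc.anti (h0 (max n' n)) (hanti (le_max_right n' n)))
      rw [sub_add_sub_cancel, ← sub_smul] at this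
      have := NonposOn.coe_nonpos (h0 _) (η _).2.2.1 (η _).2.2.2 this
      linarith
    refine ⟨sSup A, fun ε hε => ?_⟩
    obtain ⟨l, hl⟩ := exists_nat_one_div_lt (half_pos hε)
    obtain ⟨c, n, h1, h2⟩ := happrox l
    have hmem : c - 1 / ((l : ℝ) + 1) ∈ A := ⟨n, h2⟩
    have hle : sSup A ≤ c + 1 / (l + 1) := csSup_le ⟨_, hmem⟩ fun a ha => hA a ha _ n h1
    have hge : c - 1 / (l + 1) ≤ sSup A := le_csSup ⟨_, fun a ha => hA a ha _ n h1⟩ hmem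
    refine ⟨n, h1.mono (h0 _) (sub_le_sub_left (smul_le_smul_of_nonneg_right ?_ hθ) _),
      h2.mono (h0 _) (sub_le_sub_right (smul_le_smul_of_nonneg_right ?_ hθ) _)⟩ <;> linarith
  let L : Submodule ℝ V :=
    { carrier := {x | ∃ c, R x c}
      add_mem' := fun ⟨_, hx⟩ ⟨_, hy⟩ => ⟨_, Radd hx hy⟩
      zero_mem' := ⟨_, Rzero⟩
      smul_mem' := fun a _ ⟨_, hx⟩ => ⟨_, Rsmul a hx⟩ }
  classical
  let ω : V → ℝ := fun x => if h : ∃ c, R x c then h.choose else 0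
  have hω : ∀ {x c}, R x c → ω x = c := by
    intro x c h
    have h' : ∃ c, R x c := ⟨c, h⟩
    simp only [ω, dif_pos h']
    exact Runique h'.choose_spec h
  refine ⟨L, ω, ⟨?_, ?_, ?_, ?_⟩, Rd, ⟨_, Rθ⟩, hω Rθ⟩
  · rintro x ⟨c, hx⟩ y ⟨d, hy⟩
    rw [hω hx, hω hy, hω (Radd hx hy)]
  · rintro a x ⟨c, hx⟩
    rw [hω hx, hω (Rsmul a hx)]
  · rintro x ⟨c, hx⟩ y ⟨d, hy⟩
    exact ⟨_, Rsup hx hy⟩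
  · rintro x ⟨c, hx⟩ y ⟨d, hy⟩
    rw [hω hx, hω hy, hω (Rsup hx hy)]

namespace IsLocalHom

variable {L : Submodule ℝ V} {ω : V → ℝ}

theorem map_zero (h : IsLocalHom L ω) : ω 0 = 0 := by
  simpa using h.map_smul 0 0 L.zero_mem

theorem map_neg (h : IsLocalHom L ω) {x : V} (hx : x ∈ L) : ω (-x) = -ω x := by
  simpa using h.map_smul (-1) x hx

theorem map_sub (h : IsLocalHom L ω) {x y : V} (hx : x ∈ L) (hy : y ∈ L) :
    ω (x - y) = ω x - ω y := by
  rw [sub_eq_add_neg, h.map_add _ hx _ (L.neg_mem hy), h.map_neg hy, sub_eq_add_neg]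

theorem map_sum (h : IsLocalHom L ω) {ι : Type*} {s : Finset ι} {f : ι → V}
    (hf : ∀ i ∈ s, f i ∈ L) : ω (∑ i ∈ s, f i) = ∑ i ∈ s, ω (f i) := by
  classical
  induction s using Finset.induction_on with
  | empty => simpa using h.map_zero
  | insert i s hi ih =>
    have h1 : ∀ j ∈ s, f j ∈ L := fun j hj => hf j (Finset.mem_insert_of_mem hj)
    rw [Finset.sum_insert hi, Finset.sum_insert hi,
      h.map_add _ (hf i (Finset.mem_insert_self i s)) _ (L.sum_mem h1), ih h1]

theorem inf_mem (h : IsLocalHom L ω) {x y : V} (hx : x ∈ L) (hy : y ∈ L) : x ⊓ y ∈ L := by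
  rw [show x ⊓ y = -(-x ⊔ -y) by rw [neg_sup, neg_neg, neg_neg]]
  exact L.neg_mem (h.sup_mem _ (L.neg_mem hx) _ (L.neg_mem hy))

theorem map_inf (h : IsLocalHom L ω) {x y : V} (hx : x ∈ L) (hy : y ∈ L) :
    ω (x ⊓ y) = ω x ⊓ ω y := by
  rw [show x ⊓ y = -(-x ⊔ -y) by rw [neg_sup, neg_neg, neg_neg],
    h.map_neg (h.sup_mem _ (L.neg_mem hx) _ (L.neg_mem hy)),
    h.map_sup _ (L.neg_mem hx) _ (L.neg_mem hy), h.map_neg hx, h.map_neg hy, neg_sup, neg_neg,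
    neg_neg]

theorem posPart_mem (h : IsLocalHom L ω) {x : V} (hx : x ∈ L) : x⁺ ∈ L :=
  h.sup_mem _ hx _ L.zero_mem

theorem map_posPart (h : IsLocalHom L ω) {x : V} (hx : x ∈ L) : ω x⁺ = (ω x)⁺ := by
  rw [posPart_def, posPart_def, h.map_sup _ hx _ L.zero_mem, h.map_zero]

theorem map_abs (h : IsLocalHom L ω) {x : V} (hx : x ∈ L) : ω |x| = |ω x| := by
  rw [abs, abs, h.map_sup _ hx _ (L.neg_mem hx), h.map_neg hx]

theorem mono (h : IsLocalHom L ω) {x y : V} (hx : x ∈ L) (hy : y ∈ L) (hxy : x ≤ y) :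
    ω x ≤ ω y := by
  have := h.map_sup _ hx _ hy
  rw [sup_eq_right.2 hxy] at this
  rw [this]
  exact le_sup_left

theorem nonneg (h : IsLocalHom L ω) {x : V} (hx : x ∈ L) (hx0 : 0 ≤ x) : 0 ≤ ω x := by
  simpa [h.map_zero] using h.mono L.zero_mem hx hx0

end IsLocalHom

/-- To prove `x ≤ 0` it is enough to prove `ω x ≤ 0` for all real-valued lattice homomorphisms on
vector sublattices that contain `x` and a given finite set. -/
theorem nonpos_of_forall_isLocalHom (hV : IsArchimedeanLattice V) {s : Set V} (hs : s.Countable)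
    {x : V} (h : ∀ (L : Submodule ℝ V) (ω : V → ℝ), IsLocalHom L ω → s ⊆ L → x ∈ L → ω x ≤ 0) :
    x ≤ 0 := by
  by_contra hx
  obtain ⟨d, hd⟩ := (hs.insert x).exists_eq_range (Set.insert_nonempty _ _)
  have hne : x⁺ ≠ 0 := fun h => hx (posPart_eq_zero.1 h)
  -- If `x ≤ 0` fails, a homomorphism normalized at `x⁺` has `ω x⁺ = 1`, while `ω x ≤ 0` gives `ω x⁺
  -- = 0`.
  obtain ⟨L, ω, hω, hL, -, h1⟩ := exists_isLocalHom hV (posPart_nonneg x) hne d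
  have hmem : insert x s ⊆ (L : Set V) := by
    rw [hd]
    rintro _ ⟨n, rfl⟩
    exact hL n
  have hxL : x ∈ L := hmem (Set.mem_insert _ _)
  rw [hω.map_posPart hxL,
    posPart_eq_zero.2 (h L ω hω ((Set.subset_insert _ _).trans hmem) hxL)] at h1
  exact zero_ne_one h1

end VectorLattice

/-! ## Partitions of a positive vector -/

section Partition

variable {V : Type u} [AddCommGroup V] [Lattice V] [IsOrderedAddMonoid V] [Module ℝ V]
  [IsOrderedModule ℝ V]

/-- After applying a local homomorphism `ω`, with `e = ∑ j, f j`, every `j` with `ω (f j) > 0`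
satisfies `ω v ≤ c j * ω e`. Averaging with weights `ω (f j)` and cancelling `ω e` gives the claim.
The bound by `M` settles the case `ω e = 0`. -/
theorem le_sum_smul_of_nonposOn (hV : IsArchimedeanLattice V) {ι : Type*} [Fintype ι] {f : ι → V}
    (hf : ∀ j, 0 ≤ f j) {c : ι → ℝ} {v : V} {M : ℝ} (hv : v ≤ M • ∑ j, f j)
    (h : ∀ j, NonposOn (f j) (v - c j • ∑ j, f j)) : v ≤ ∑ j, c j • f j := by
  rw [← sub_nonpos]
  refine nonpos_of_forall_isLocalHom hV (s := insert v (Set.range f))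
    ((Set.finite_range f).insert v).countable fun L ω hω hL _ => ?_
  have hvL : v ∈ L := hL (Set.mem_insert _ _)
  have hfL : ∀ j, f j ∈ L := fun j => hL (Set.mem_insert_of_mem _ ⟨j, rfl⟩)
  have heL : ∑ j, f j ∈ L := L.sum_mem fun j _ => hfL j
  rw [hω.map_sub hvL (L.sum_mem fun j _ => L.smul_mem _ (hfL j)),
    hω.map_sum fun j _ => L.smul_mem _ (hfL j), sub_nonpos]
  simp only [hω.map_smul _ _ (hfL _)]
  have hωf : ∀ j, 0 ≤ ω (f j) := fun j => hω.nonneg (hfL j) (hf j)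
  have hωe : ω (∑ j, f j) = ∑ j, ω (f j) := hω.map_sum fun j _ => hfL j
  have hωv := hω.mono hvL (L.smul_mem M heL) hv
  rw [hω.map_smul _ _ heL] at hωv
  have key : ∀ j, ω (f j) * ω v ≤ ω (f j) * (c j * ω (∑ j, f j)) := by
    intro j
    have hj := congrArg ω (h j)
    have hmem : v - c j • ∑ j, f j ∈ L := L.sub_mem hvL (L.smul_mem _ heL)
    rw [hω.map_inf (hω.posPart_mem hmem) (hfL j), hω.map_posPart hmem, hω.map_zero,
      hω.map_sub hvL (L.smul_mem _ heL), hω.map_smul _ _ heL] at hj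
    rcases (hωf j).eq_or_lt with h0 | h0
    · simp [← h0]
    · refine mul_le_mul_of_nonneg_left ?_ h0.le
      by_contra! hlt
      have : 0 < (ω v - c j * ω (∑ j, f j))⁺ ⊓ ω (f j) :=
        lt_inf_iff.2 ⟨posPart_pos (sub_pos.2 hlt), h0⟩
      exact this.ne' hj
  have hsum := Finset.sum_le_sum fun j (_ : j ∈ Finset.univ) => key j
  rw [← Finset.sum_mul, ← hωe] at hsum
  have he0 : 0 ≤ ω (∑ j, f j) := hωe ▸ Finset.sum_nonneg fun j _ => hωf j
  rcases he0.eq_or_lt with h0 | h0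
  · have hz : ∀ j, ω (f j) = 0 := by
      intro j
      rw [hωe] at h0
      exact (Finset.sum_eq_zero_iff_of_nonneg fun j _ => hωf j).1 h0.symm j (Finset.mem_univ j)
    rw [← h0, mul_zero] at hωv
    simpa [hz] using hωv
  · refine le_of_mul_le_mul_left (hsum.trans (le_of_eq ?_)) h0
    rw [Finset.mul_sum]
    exact Finset.sum_congr rfl fun j _ => by ring

theorem abs_sub_sum_smul_le_of_nonposOn (hV : IsArchimedeanLattice V) {ι : Type*} [Fintype ι]
    {f : ι → V} (hf : ∀ j, 0 ≤ f j) {c : ι → ℝ} {v : V} {M ε : ℝ} (hv : |v| ≤ M • ∑ j, f j)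
    (h : ∀ j, NonposOn (f j) (v - (c j + ε) • ∑ j, f j))
    (h' : ∀ j, NonposOn (f j) ((c j - ε) • ∑ j, f j - v)) :
    |v - ∑ j, c j • f j| ≤ ε • ∑ j, f j := by
  have h1 := le_sum_smul_of_nonposOn hV hf ((le_abs_self v).trans hv) h
  have h2 := le_sum_smul_of_nonposOn hV hf (v := -v) (c := fun j => -c j + ε)
    ((neg_le_abs v).trans hv) fun j => by
      have := h' j
      rwa [show (c j - ε) • ∑ j, f j - v = -v - (-c j + ε) • ∑ j, f j by module] at this
  simp only [add_smul, Finset.sum_add_distrib, ← Finset.smul_sum, neg_smul,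
    Finset.sum_neg_distrib] at h1 h2
  refine abs_le'.2 ⟨sub_le_iff_le_add'.2 h1, ?_⟩
  rw [neg_sub, sub_le_iff_le_add']
  have := add_le_add_left h2 (∑ j, c j • f j + v)
  calc ∑ j, c j • f j = -v + (∑ j, c j • f j + v) := by abel
    _ ≤ _ := this
    _ = _ := by abel

/-- A layer-cake decomposition of `θ` along the level sets of `x`, with the indicator of `{x > t e}`
replaced by the continuous ramp `G t = θ ⊓ h⁻¹ • (x - t • e)⁺`. Consecutive ramps differ only where
`x` is close to `t • e`. -/
theorem exists_partition_singleton (hV : IsArchimedeanLattice V) {θ e x : V} (hθ : 0 ≤ θ)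
    (hθe : θ ≤ e) (hx : |x| ≤ e) {ε : ℝ} (hε : 0 < ε) :
    ∃ (n : ℕ) (g : Fin n → V) (t : Fin n → ℝ), (∀ j, 0 ≤ g j) ∧ ∑ j, g j = θ ∧ ∀ j, |t j| ≤ 1 ∧
      NonposOn (g j) (x - (t j + ε) • e) ∧ NonposOn (g j) ((t j - ε) • e - x) := by
  have he : 0 ≤ e := hθ.trans hθe
  obtain ⟨n, hn⟩ := exists_nat_gt (2 / ε)
  have hn0 : (0 : ℝ) < n := (by positivity : 0 < 2 / ε).trans hn
  set h : ℝ := 2 / n with hh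
  have hh0 : 0 < h := by positivity
  have hhε : h ≤ ε := by
    rw [hh, div_le_iff₀ hn0]
    rw [div_lt_iff₀ hε] at hn
    linarith
  let G : ℝ → V := fun t => θ ⊓ h⁻¹ • (x - t • e)⁺
  have hG : ∀ {s t}, s ≤ t → G t ≤ G s := fun hst => inf_le_inf_left _ <|
    smul_le_smul_of_nonneg_left (posPart_mono (sub_le_sub_left
      (smul_le_smul_of_nonneg_right hst he) _)) (inv_nonneg.2 hh0.le)
  have hsupp : ∀ t : ℝ, NonposOn (G (t - h) - G t) (x - (t + h) • e) ∧
      NonposOn (G (t - h) - G t) ((t - h) • e - x) := by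
    intro t
    have hdiff : 0 ≤ G (t - h) - G t := sub_nonneg.2 (hG (by linarith))
    constructor <;>
    · refine le_antisymm (nonpos_of_forall_isLocalHom hV (s := {x, e, θ})
        (Set.toFinite _).countable fun L ω hω hL _ => ?_) (le_inf (posPart_nonneg _) hdiff)
      have hxL : x ∈ L := hL (by simp)
      have heL : e ∈ L := hL (by simp)
      have hθL : θ ∈ L := hL (by simp)
      have hsL : ∀ s : ℝ, x - s • e ∈ L := fun s => L.sub_mem hxL (L.smul_mem s heL)
      have hsL' : ∀ s : ℝ, s • e - x ∈ L := fun s => L.sub_mem (L.smul_mem s heL) hxL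
      have hGL : ∀ s : ℝ, G s ∈ L := fun s =>
        hω.inf_mem hθL (L.smul_mem _ (hω.posPart_mem (hsL s)))
      have hωG : ∀ s : ℝ, ω (G s) = ω θ ⊓ h⁻¹ * (ω x - s * ω e)⁺ := fun s => by
        rw [hω.map_inf hθL (L.smul_mem _ (hω.posPart_mem (hsL s))),
          hω.map_smul _ _ (hω.posPart_mem (hsL s)), hω.map_posPart (hsL s),
          hω.map_sub hxL (L.smul_mem s heL), hω.map_smul _ _ heL]
      have h1 : ω θ ≤ ω e := hω.mono hθL heL hθe
      have h2 : 0 ≤ ω θ := hω.nonneg hθL hθ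
      have h3 : 0 ≤ ω e := hω.nonneg heL he
      -- Two cases, one for each goal. Where `x > (t + h) e`, the ramp `G t` has already reached
      -- `θ`, so the difference is zero; where `x < (t - h) e`, the larger ramp `G (t - h)`
      -- vanishes.
      first
      | rw [hω.map_inf (hω.posPart_mem (hsL _)) (L.sub_mem (hGL _) (hGL _)),
          hω.map_posPart (hsL _), hω.map_sub hxL (L.smul_mem _ heL),
          hω.map_sub (hGL _) (hGL _), hω.map_smul _ _ heL, hωG, hωG, inf_le_iff]
        by_cases hcase : ω x ≤ (t + h) * ω e
        · left
          rw [posPart_eq_zero.2 (sub_nonpos.2 hcase)]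
        · right
          push Not at hcase
          have h4 : ω θ ≤ h⁻¹ * (ω x - t * ω e)⁺ := by
            rw [inv_mul_eq_div, le_div_iff₀ hh0]
            refine le_trans ?_ (le_posPart _)
            nlinarith
          rw [inf_eq_left.2 h4]
          exact sub_nonpos.2 inf_le_left
      | rw [hω.map_inf (hω.posPart_mem (hsL' _)) (L.sub_mem (hGL _) (hGL _)),
          hω.map_posPart (hsL' _), hω.map_sub (L.smul_mem _ heL) hxL,
          hω.map_sub (hGL _) (hGL _), hω.map_smul _ _ heL, hωG, hωG, inf_le_iff]
        by_cases hcase : (t - h) * ω e ≤ ω x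
        · left
          rw [posPart_eq_zero.2 (sub_nonpos.2 hcase)]
        · right
          push Not at hcase
          rw [posPart_eq_zero.2 (by linarith : ω x - (t - h) * ω e ≤ 0), mul_zero,
            inf_eq_right.2 h2, zero_sub, neg_nonpos]
          exact le_inf h2 (mul_nonneg (inv_nonneg.2 hh0.le) (posPart_nonneg _))
  -- The levels run from `-1 - h`, where the ramp equals `θ` since `x ≥ -e` and `θ ≤ e`, up to `-1 +
  -- n * h = 1`, where it is `0` since `x ≤ e`. The `n + 1` differences therefore telescope to `θ`.
  let F : ℕ → V := fun j => G (-1 + (j - 1) * h)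
  have hF : ∀ j : ℕ, F j - F (j + 1) = G (-1 + j * h - h) - G (-1 + j * h) := fun j => by
    simp only [F, Nat.cast_add, Nat.cast_one, add_sub_cancel_right]
    congr 2
    ring
  refine ⟨n + 1, fun j => F j - F (j + 1), fun j => -1 + j * h, fun j => ?_, ?_, fun j => ⟨?_, ?_⟩⟩
  · beta_reduce
    rw [hF, sub_nonneg]
    exact hG (by linarith)
  · rw [Fin.sum_univ_eq_sum_range (fun j => F j - F (j + 1)) (n + 1), Finset.sum_range_sub']
    have h0 : F 0 = θ := by
      refine inf_eq_left.2 (hθe.trans ?_)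
      rw [← inv_smul_smul₀ hh0.ne' e]
      refine smul_le_smul_of_nonneg_left (le_trans ?_ (le_posPart _)) (inv_nonneg.2 hh0.le)
      rw [inv_smul_smul₀ hh0.ne', ← sub_nonneg,
        show x - (-1 + (((0 : ℕ) : ℝ) - 1) * h) • e - h • e = x + e by push_cast; module]
      exact neg_le_iff_add_nonneg'.1 ((neg_le_abs x).trans hx)
    have h1 : F (n + 1) = 0 := by
      refine le_antisymm (inf_le_right.trans (le_of_eq ?_))
        (le_inf hθ (smul_nonneg (inv_nonneg.2 hh0.le) (posPart_nonneg _)))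
      have : -1 + (((n + 1 : ℕ) : ℝ) - 1) * h = 1 := by
        rw [hh]
        push_cast
        field_simp
        ring
      rw [this, one_smul, posPart_eq_zero.2 (sub_nonpos.2 ((le_abs_self x).trans hx)), smul_zero]
    rw [h0, h1, sub_zero]
  · have hj : ((j : ℕ) : ℝ) ≤ n := by exact_mod_cast Nat.lt_succ_iff.1 j.2
    have : (j : ℕ) * h ≤ 2 := by
      calc ((j : ℕ) : ℝ) * h ≤ n * h := mul_le_mul_of_nonneg_right hj hh0.le
        _ = 2 := by rw [hh]; field_simp
    have h0 : 0 ≤ ((j : ℕ) : ℝ) * h := by positivity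
    rw [abs_le]
    constructor <;> linarith
  · have hdiff : 0 ≤ G (-1 + j * h - h) - G (-1 + j * h) := sub_nonneg.2 (hG (by linarith))
    beta_reduce
    rw [hF]
    refine ⟨(hsupp _).1.mono hdiff ?_, (hsupp _).2.mono hdiff ?_⟩
    · exact sub_le_sub_left (smul_le_smul_of_nonneg_right (by linarith) he) _
    · exact sub_le_sub_right (smul_le_smul_of_nonneg_right (by linarith) he) _

/-- A positive vector `e` is a finite sum of positive vectors on the supports of which finitely many
given vectors are almost equal to multiples of `e`. -/
theorem exists_partition (hV : IsArchimedeanLattice V) {e : V} (he : 0 ≤ e) (s : Finset V)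
    (hs : ∀ x ∈ s, |x| ≤ e) {ε : ℝ} (hε : 0 < ε) :
    ∃ (ι : Type) (_ : Fintype ι) (f : ι → V) (c : V → ι → ℝ), (∀ j, 0 ≤ f j) ∧ ∑ j, f j = e ∧
      ∀ x ∈ s, ∀ j, |c x j| ≤ 1 ∧ NonposOn (f j) (x - (c x j + ε) • e) ∧
        NonposOn (f j) ((c x j - ε) • e - x) := by
  classical
  induction s using Finset.induction_on with
  | empty => exact ⟨Unit, inferInstance, fun _ => e, fun _ _ => 0, fun _ => he, by simp, by simp⟩
  | insert x s hxs ih =>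
    obtain ⟨ι, _, f, c, hf, hsum, hc⟩ := ih fun y hy => hs y (Finset.mem_insert_of_mem hy)
    have hle : ∀ j, f j ≤ e := fun j => hsum ▸ Finset.single_le_sum (fun i _ => hf i)
      (Finset.mem_univ j)
    -- Each old part is subdivided along the levels of the new vector; the estimates for the earlier
    -- vectors survive on smaller supports.
    choose n g t hg hgsum ht using fun j =>
      exists_partition_singleton hV (hf j) (hle j) (hs x (Finset.mem_insert_self x s)) hε
    refine ⟨Σ j, Fin (n j), inferInstance, fun p => g p.1 p.2,
      fun y p => if y = x then t p.1 p.2 else c y p.1, fun p => hg _ _, ?_, ?_⟩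
    · rw [Fintype.sum_sigma, ← hsum]
      exact Finset.sum_congr rfl fun j _ => hgsum j
    · rintro y hy ⟨j, k⟩
      have hgf : g j k ≤ f j := hgsum j ▸ Finset.single_le_sum (fun i _ => hg j i)
        (Finset.mem_univ k)
      by_cases hyx : y = x
      · subst hyx
        simpa using ht j k
      · have := hc y (Finset.mem_of_mem_insert_of_ne hy hyx) j
        simp only [hyx, if_false]
        exact ⟨this.1, this.2.1.anti (hg j k) hgf, this.2.2.anti (hg j k) hgf⟩

end Partition

/-! ## Positive multilinear operators and lattice multimorphisms -/

section Multilinear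

variable {m : ℕ} {E : Fin m → Type u} {F : Type u}
  [∀ i, AddCommGroup (E i)] [∀ i, Module ℝ (E i)] [∀ i, Lattice (E i)]
  [∀ i, IsOrderedAddMonoid (E i)] [∀ i, IsOrderedModule ℝ (E i)]
  [AddCommGroup F] [Module ℝ F] [Lattice F] [IsOrderedAddMonoid F] [IsOrderedModule ℝ F]

theorem abs_sum_le {V ι : Type*} [AddCommGroup V] [Lattice V] [IsOrderedAddMonoid V]
    (s : Finset ι) (f : ι → V) : |∑ i ∈ s, f i| ≤ ∑ i ∈ s, |f i| :=
  Finset.le_sum_of_subadditive _ abs_zero.le abs_add_le s f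

theorem update_nonneg {e : ∀ i, E i} (he : ∀ i, 0 ≤ e i) (i : Fin m) {r : E i} (hr : 0 ≤ r) :
    ∀ j, 0 ≤ Function.update e i r j := fun j => by
  rcases eq_or_ne j i with rfl | hj
  · simpa using hr
  · simpa [hj] using he j

namespace IsPositiveMultilinear

variable {T : MultilinearMap ℝ E F} (hT : IsPositiveMultilinear T)

include hT

theorem update_mono {e : ∀ i, E i} (he : ∀ i, 0 ≤ e i) (i : Fin m) {a b : E i} (hab : a ≤ b) :
    T (Function.update e i a) ≤ T (Function.update e i b) := by
  rw [← sub_nonneg, ← T.map_update_sub]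
  exact hT _ (update_nonneg he i (sub_nonneg.2 hab))

/-- Coordinates are treated one at a time: `x i = (x i)⁺ - (x i)⁻` splits the value into two terms
whose `i`-th entry is positive and can be absorbed into `y`. Hence the induction generalizes over
the positive tuple `y`. -/
theorem abs_map_piecewise_le (s : Finset (Fin m)) (x : ∀ i, E i) {y : ∀ i, E i}
    (hy : ∀ i, 0 ≤ y i) :
    |T (s.piecewise x y)| ≤ T (s.piecewise (fun i => |x i|) y) := by
  induction s using Finset.induction_on generalizing y with
  | empty => simpa using (abs_of_nonneg (hT y hy)).le
  | insert i s hi ih =>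
    rw [Finset.piecewise_insert, Finset.piecewise_insert]
    have h1 : T (Function.update (s.piecewise x y) i (x i)) =
        T (s.piecewise x (Function.update y i (x i)⁺)) -
          T (s.piecewise x (Function.update y i (x i)⁻)) := by
      rw [← s.update_piecewise_of_notMem _ _ hi, ← s.update_piecewise_of_notMem _ _ hi,
        ← T.map_update_sub, posPart_sub_negPart]
    have h2 : T (Function.update (s.piecewise (fun i => |x i|) y) i |x i|) =
        T (s.piecewise (fun i => |x i|) (Function.update y i (x i)⁺)) +
          T (s.piecewise (fun i => |x i|) (Function.update y i (x i)⁻)) := by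
      rw [← s.update_piecewise_of_notMem _ _ hi, ← s.update_piecewise_of_notMem _ _ hi,
        ← T.map_update_add, posPart_add_negPart]
    rw [h1, h2, sub_eq_add_neg]
    refine (abs_add_le _ _).trans (add_le_add (ih (update_nonneg hy i (posPart_nonneg _))) ?_)
    rw [abs_neg]
    exact ih (update_nonneg hy i (negPart_nonneg _))

theorem abs_map_le (x : ∀ i, E i) : |T x| ≤ T fun i => |x i| := by
  simpa using hT.abs_map_piecewise_le Finset.univ x (y := 0) fun i => le_rfl

theorem mono {x y : ∀ i, E i} (hx : ∀ i, 0 ≤ x i) (hxy : ∀ i, x i ≤ y i) : T x ≤ T y := by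
  have key : ∀ s : Finset (Fin m), T x ≤ T (s.piecewise y x) := by
    intro s
    induction s using Finset.induction_on with
    | empty => simp
    | insert i s hi ih =>
      refine ih.trans ?_
      have h0 : ∀ j, 0 ≤ s.piecewise y x j := fun j => by
        by_cases hj : j ∈ s
        · simpa [hj] using (hx j).trans (hxy j)
        · simpa [hj] using hx j
      have := hT.update_mono h0 i (hxy i)
      rw [Finset.piecewise_insert]
      refine le_trans (le_of_eq ?_) this
      congr 1
      rw [eq_comm, Function.update_eq_self_iff]
      simp [hi]
  simpa using key Finset.univ

theorem abs_map_le_of_abs_le {x e : ∀ i, E i} (hx : ∀ i, |x i| ≤ e i) : |T x| ≤ T e :=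
  (hT.abs_map_le x).trans (hT.mono (fun _ => abs_nonneg _) hx)

/-- Telescoping: pass from `x` to `y` by exchanging one coordinate at a time, all other coordinates
staying bounded by `e`. -/
theorem abs_map_sub_map_le {x y e : ∀ i, E i} (hx : ∀ i, |x i| ≤ e i) (hy : ∀ i, |y i| ≤ e i) :
    |T x - T y| ≤ ∑ i, T (Function.update e i |x i - y i|) := by
  have key : ∀ s : Finset (Fin m),
      |T x - T (s.piecewise y x)| ≤ ∑ i ∈ s, T (Function.update e i |x i - y i|) := by
    intro s
    induction s using Finset.induction_on with
    | empty => simp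
    | insert i s hi ih =>
      have h1 : T (s.piecewise y x) - T ((insert i s).piecewise y x) =
          T (Function.update (s.piecewise y x) i (x i - y i)) := by
        rw [Finset.piecewise_insert, T.map_update_sub]
        congr 2
        rw [eq_comm, Function.update_eq_self_iff]
        simp [hi]
      rw [Finset.sum_insert hi, ← sub_add_sub_cancel _ (T (s.piecewise y x)), add_comm, h1]
      refine (abs_add_le _ _).trans (add_le_add ?_ ih)
      refine hT.abs_map_le_of_abs_le fun j => ?_
      rcases eq_or_ne j i with rfl | hj
      · simp
      · by_cases hjs : j ∈ s
        · simpa [hj, hjs] using hy j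
        · simpa [hj, hjs] using hx j
  simpa using key Finset.univ

end IsPositiveMultilinear

namespace IsLatticeMultimorphism

variable {T : MultilinearMap ℝ E F} (hT : IsLatticeMultimorphism T)

include hT

theorem isPositiveMultilinear : IsPositiveMultilinear T := fun x hx => by
  have := hT x
  rw [show (fun i => |x i|) = x from funext fun i => abs_of_nonneg (hx i)] at this
  exact this ▸ abs_nonneg _

/-- With the other coordinates positive, `T` commutes with the absolute value in coordinate `i`, and
`2 (a ⊓ b) = a + b - |a - b|` expresses the infimum through it. -/
theorem map_update_inf {e : ∀ i, E i} (he : ∀ i, 0 ≤ e i) (i : Fin m) (a b : E i) :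
    T (Function.update e i (a ⊓ b)) = T (Function.update e i a) ⊓ T (Function.update e i b) := by
  have h1 : |T (Function.update e i (a - b))| = T (Function.update e i |a - b|) := by
    rw [hT]
    congr 1
    funext j
    rcases eq_or_ne j i with rfl | hj
    · simp
    · simpa [hj] using abs_of_nonneg (he j)
  have h2 := two_nsmul_inf (T (Function.update e i a)) (T (Function.update e i b))
  rw [← T.map_update_sub, h1, ← T.map_update_add, ← T.map_update_sub, ← two_nsmul_inf,
    ← Nat.cast_smul_eq_nsmul ℝ, ← Nat.cast_smul_eq_nsmul ℝ, T.map_update_smul] at h2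
  exact (smul_right_injective F (by norm_num : ((2 : ℕ) : ℝ) ≠ 0) h2).symm

theorem map_update_inf_map_eq_zero {e f : ∀ i, E i} (hf : ∀ i, 0 ≤ f i) (hfe : ∀ i, f i ≤ e i)
    (i : Fin m) {r : E i} (hr : 0 ≤ r) (h : r ⊓ f i = 0) :
    T (Function.update e i r) ⊓ T f = 0 := by
  have he : ∀ i, 0 ≤ e i := fun i => (hf i).trans (hfe i)
  have hpos := hT.isPositiveMultilinear
  have h1 : T f ≤ T (Function.update e i (f i)) := hpos.mono hf fun j => by
    rcases eq_or_ne j i with rfl | hj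
    · simp
    · simpa [hj] using hfe j
  refine inf_eq_zero_of_le (hpos _ (update_nonneg he i hr)) (hpos _ hf) le_rfl h1 ?_
  rw [← hT.map_update_inf he, h]
  exact T.map_update_zero e i

/-- Compare `T x` with `T (c i • e i)` by telescoping. In coordinate `i` the error is at most `δ • e
i` plus a remainder disjoint from `f i`, and the image of the remainder is disjoint from `T f`. On
the support of `T f` only the `m` terms `δ • T e` are left. -/
theorem nonposOn_abs_sub {e f x : ∀ i, E i} (hf : ∀ i, 0 ≤ f i) (hfe : ∀ i, f i ≤ e i)
    (hx : ∀ i, |x i| ≤ e i) {c : Fin m → ℝ} (hc : ∀ i, |c i| ≤ 1) {δ : ℝ}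
    (h : ∀ i, NonposOn (f i) (|x i - c i • e i| - δ • e i)) :
    NonposOn (T f) (|T x - (∏ i, c i) • T e| - (m * δ) • T e) := by
  have he : ∀ i, 0 ≤ e i := fun i => (hf i).trans (hfe i)
  have hpos := hT.isPositiveMultilinear
  have hTf := hpos f hf
  have h1 : |T x - (∏ i, c i) • T e| ≤ ∑ i, T (Function.update e i |x i - c i • e i|) := by
    rw [← T.map_smul_univ]
    refine hpos.abs_map_sub_map_le hx fun i => ?_
    rw [abs_real_smul, abs_of_nonneg (he i)]
    exact smul_le_of_le_one_left (he i) (hc i)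
  have h2 : ∑ i, T (Function.update e i |x i - c i • e i|) ≤
      ∑ i, (δ • T e + T (Function.update e i (|x i - c i • e i| - δ • e i)⁺)) := by
    refine Finset.sum_le_sum fun i _ => ?_
    have : δ • T e = T (Function.update e i (δ • e i)) := by
      rw [T.map_update_smul, Function.update_eq_self]
    rw [this, ← T.map_update_add]
    exact hpos.update_mono he i (sub_le_iff_le_add'.1 (le_posPart _))
  rw [Finset.sum_add_distrib, Finset.sum_const, Finset.card_univ, Fintype.card_fin,
    ← Nat.cast_smul_eq_nsmul ℝ, smul_smul] at h2
  refine NonposOn.mono hTf (NonposOn.sum (s := Finset.univ)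
    (f := fun i => T (Function.update e i (|x i - c i • e i| - δ • e i)⁺)) hTf fun i _ => ?_)
    (sub_le_iff_le_add'.2 (h1.trans h2))
  rw [NonposOn, posPart_of_nonneg (hpos _ (update_nonneg he i (posPart_nonneg _)))]
  exact hT.map_update_inf_map_eq_zero hf hfe i (posPart_nonneg _) (h i)

end IsLatticeMultimorphism

/-- The linear extension of a map to formal linear combinations of tuples. -/
noncomputable abbrev extendLinear (T : MultilinearMap ℝ E F) : ((∀ i, E i) →₀ ℝ) →ₗ[ℝ] F :=
  Finsupp.linearCombination ℝ T

theorem extendLinear_apply (T : MultilinearMap ℝ E F) (p : (∀ i, E i) →₀ ℝ) :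
    extendLinear T p = ∑ x ∈ p.support, p x • T x := rfl

/-- Simultaneous partitions of the factors reduce a linear combination of elementary tensors to a
linear combination of elementary tensors of the parts, up to a small error. -/
theorem exists_tensor_partition (hE : ∀ i, IsArchimedeanLattice (E i)) (p : (∀ i, E i) →₀ ℝ)
    {e : ∀ i, E i} (he : ∀ i, 0 ≤ e i) (hp : ∀ x ∈ p.support, ∀ i, |x i| ≤ e i)
    {ε : ℝ} (hε : 0 < ε) :
    ∃ (ι : Fin m → Type) (_ : ∀ i, Fintype (ι i)) (f : ∀ i, ι i → E i) (C : (∀ i, ι i) → ℝ),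
      (∀ i j, 0 ≤ f i j) ∧ (∀ i, ∑ j, f i j = e i) ∧
      (∀ (G : Type u) [AddCommGroup G] [Module ℝ G] [Lattice G] [IsOrderedAddMonoid G]
        [IsOrderedModule ℝ G] (T : MultilinearMap ℝ E G), IsLatticeMultimorphism T → ∀ J,
        NonposOn (T fun i => f i (J i)) (extendLinear T p - (C J + ε) • T e) ∧
        NonposOn (T fun i => f i (J i)) ((C J - ε) • T e - extendLinear T p)) ∧
      (∀ (G : Type u) [AddCommGroup G] [Module ℝ G] [Lattice G] [IsOrderedAddMonoid G]
        [IsOrderedModule ℝ G] (T : MultilinearMap ℝ E G), IsPositiveMultilinear T →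
        |extendLinear T p - ∑ J, C J • T fun i => f i (J i)| ≤ ε • T e) := by
  classical
  set N : ℝ := ∑ x ∈ p.support, |p x| with hN
  have hN0 : 0 ≤ N := Finset.sum_nonneg fun _ _ => abs_nonneg _
  -- Each tuple in the support of `p` contributes an error `m * δ` weighted by `|p x|`, in total `N
  -- * (m * δ) ≤ ε`.
  set δ : ℝ := ε / (N * m + 1) with hδ
  have hδ0 : 0 < δ := by positivity
  have hδε : N * (m * δ) ≤ ε := by
    rw [hδ, ← mul_assoc, mul_div_assoc', div_le_iff₀ (by positivity)]
    nlinarith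
  choose ι hι f c hf hsum hc using fun i => exists_partition (hE i) (he i)
    (p.support.image fun x => x i) (fun y hy => by
      obtain ⟨x, hx, rfl⟩ := Finset.mem_image.1 hy
      exact hp x hx i) hδ0
  have hc' : ∀ x ∈ p.support, ∀ i j, _ := fun x hx i =>
    hc i (x i) (Finset.mem_image_of_mem _ hx)
  have hle : ∀ i j, f i j ≤ e i := fun i j => hsum i ▸
    Finset.single_le_sum (fun k _ => hf i k) (Finset.mem_univ j)
  -- On the block `J` every `x i` is almost `c i (x i) (J i) • e i`, so `p` takes there almost this
  -- multiple of `T e`.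
  let C : (∀ i, ι i) → ℝ := fun J => ∑ x ∈ p.support, p x * ∏ i, c i (x i) (J i)
  refine ⟨ι, hι, f, C, hf, hsum, ?_, ?_⟩
  · intro G _ _ _ _ _ T hT J
    set θ := T fun i => f i (J i)
    have hpos := hT.isPositiveMultilinear
    have hθ : 0 ≤ θ := hpos _ fun i => hf i _
    have hTe : 0 ≤ T e := hpos _ he
    have h1 : ∀ x ∈ p.support,
        NonposOn θ (|T x - (∏ i, c i (x i) (J i)) • T e| - (m * δ) • T e) := fun x hx => by
      refine hT.nonposOn_abs_sub (fun i => hf i _) (fun i => hle i _) (hp x hx)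
        (fun i => (hc' x hx i (J i)).1) fun i => ?_
      obtain ⟨-, h2, h3⟩ := hc' x hx i (J i)
      refine (NonposOn.sup (hf i _) h2 h3).mono (hf i _) (le_of_eq ?_)
      rw [abs, sup_sub]
      congr 1 <;> module
    have h2 : NonposOn θ (|extendLinear T p - C J • T e| - ε • T e) := by
      refine (NonposOn.sum hθ fun x hx => NonposOn.smul (abs_nonneg (p x)) hθ (h1 x hx)).mono hθ ?_
      simp only [smul_sub, Finset.sum_sub_distrib, ← Finset.sum_smul, smul_smul]
      refine sub_le_sub ?_ (by
        rw [← Finset.sum_mul]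
        exact smul_le_smul_of_nonneg_right hδε hTe)
      rw [extendLinear_apply]
      simp only [C, Finset.sum_smul, ← Finset.sum_sub_distrib, mul_smul, ← smul_sub]
      refine (abs_sum_le _ _).trans (le_of_eq (Finset.sum_congr rfl fun x _ => ?_))
      rw [abs_real_smul]
    constructor
    · refine h2.mono hθ ?_
      rw [add_smul, ← sub_sub]
      exact sub_le_sub_right (le_abs_self _) _
    · refine h2.mono hθ ?_
      rw [sub_smul, sub_right_comm]
      refine sub_le_sub_right ?_ _
      rw [← neg_sub]
      exact neg_le_abs _
  · intro G _ _ _ _ _ T hpos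
    have hTe : 0 ≤ T e := hpos _ he
    -- For a merely positive `T` nothing can be localized in the target. Instead each `x i` is
    -- replaced by its step approximation within its own factor, and `T (y x)` is expanded by
    -- multilinearity.
    let y : (∀ i, E i) → ∀ i, E i := fun x i => ∑ j, c i (x i) j • f i j
    have hy : ∀ x, T (y x) = ∑ J : ∀ i, ι i, (∏ i, c i (x i) (J i)) • T fun i => f i (J i) := by
      intro x
      rw [T.map_sum]
      exact Finset.sum_congr rfl fun J _ => T.map_smul_univ _ _
    have h1 : ∀ x ∈ p.support, |T x - T (y x)| ≤ (m * δ) • T e := by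
      intro x hx
      have hye : ∀ i, |y x i| ≤ e i := fun i => by
        rw [← hsum i]
        refine (abs_sum_le _ _).trans (Finset.sum_le_sum fun j _ => ?_)
        rw [abs_real_smul, abs_of_nonneg (hf i j)]
        exact smul_le_of_le_one_left (hf i j) (hc' x hx i j).1
      have hxy : ∀ i, |x i - y x i| ≤ δ • e i := fun i => by
        have := abs_sub_sum_smul_le_of_nonposOn (hE i) (hf i) (v := x i) (c := c i (x i))
          (M := 1) (ε := δ) (by rw [one_smul, hsum]; exact hp x hx i)
          (fun j => by rw [hsum]; exact (hc' x hx i j).2.1)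
          (fun j => by rw [hsum]; exact (hc' x hx i j).2.2)
        rwa [hsum] at this
      refine (hpos.abs_map_sub_map_le (hp x hx) hye).trans ?_
      calc ∑ i, T (Function.update e i |x i - y x i|)
          ≤ ∑ i : Fin m, δ • T e := Finset.sum_le_sum fun i _ => by
            refine (hpos.update_mono he i (hxy i)).trans (le_of_eq ?_)
            rw [T.map_update_smul, Function.update_eq_self]
        _ = (m * δ) • T e := by
            rw [Finset.sum_const, Finset.card_univ, Fintype.card_fin, ← Nat.cast_smul_eq_nsmul ℝ,
              smul_smul]
    have h2 : ∑ J, C J • T (fun i => f i (J i)) = ∑ x ∈ p.support, p x • T (y x) := by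
      simp only [hy, C, Finset.sum_smul, Finset.smul_sum, mul_smul]
      exact Finset.sum_comm
    rw [h2, extendLinear_apply, ← Finset.sum_sub_distrib]
    calc |∑ x ∈ p.support, (p x • T x - p x • T (y x))|
        ≤ ∑ x ∈ p.support, |p x| • ((m * δ) • T e) := by
          refine (abs_sum_le _ _).trans (Finset.sum_le_sum fun x hx => ?_)
          rw [← smul_sub, abs_real_smul]
          exact smul_le_smul_of_nonneg_left (h1 x hx) (abs_nonneg _)
      _ = (N * (m * δ)) • T e := by rw [← Finset.sum_smul, smul_smul]
      _ ≤ ε • T e := smul_le_smul_of_nonneg_right hδε hTe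

end Multilinear

/-! ## Nonvanishing of elementary tensors -/

section Nonvanishing

variable {m : ℕ} {E : Fin m → Type u}
  [∀ i, AddCommGroup (E i)] [∀ i, Module ℝ (E i)] [∀ i, Lattice (E i)]
  [∀ i, IsOrderedAddMonoid (E i)] [∀ i, IsOrderedModule ℝ (E i)]

/-- `ω` is a lattice homomorphism on a vector sublattice containing `D` and takes the value `1`
at `θ`. -/
def IsLocalHomAt {V : Type u} [AddCommGroup V] [Module ℝ V] [Lattice V] (θ : V) (D : Set V)
    (ω : V → ℝ) : Prop :=
  ∃ L : Submodule ℝ V, IsLocalHom L ω ∧ D ⊆ L ∧ θ ∈ L ∧ ω θ = 1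

/-- The sets of tuples of real functions that contain all tuples of lattice homomorphisms on
suitable countably generated vector sublattices, normalized at `θ`. -/
def localHomFilter (θ : ∀ i, E i) : Filter (∀ i, E i → ℝ) :=
  Filter.ofCountableInter
    {S | ∃ D : ∀ i, Set (E i), (∀ i, (D i).Countable) ∧
      ∀ ω : ∀ i, E i → ℝ, (∀ i, IsLocalHomAt (θ i) (D i) (ω i)) → ω ∈ S}
    (fun 𝒮 h𝒮 h => by
      have h' : ∀ S ∈ 𝒮, ∃ D : ∀ i, Set (E i), (∀ i, (D i).Countable) ∧
        ∀ ω : ∀ i, E i → ℝ, (∀ i, IsLocalHomAt (θ i) (D i) (ω i)) → ω ∈ S := fun S hS => h hS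
      choose! D hD hDS using h'
      -- Homomorphisms defined on the union of the prescribed countable sets meet all the
      -- requirements at once, and a countable union stays countable.
      refine ⟨fun i => ⋃ S ∈ 𝒮, D S i, fun i => h𝒮.biUnion fun S hS => hD S hS i,
        fun ω hω S hS => hDS S hS ω fun i => ?_⟩
      obtain ⟨L, h1, h2, h3⟩ := hω i
      exact ⟨L, h1, (Set.subset_biUnion_of_mem (u := fun S => D S i) hS).trans h2, h3⟩)
    (fun S S' ⟨D, hD, h⟩ hSS => ⟨D, hD, fun ω hω => hSS (h ω hω)⟩)

instance (θ : ∀ i, E i) : CountableInterFilter (localHomFilter θ) := by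
  unfold localHomFilter
  infer_instance

theorem eventually_localHomFilter {θ : ∀ i, E i} {D : ∀ i, Set (E i)}
    (hD : ∀ i, (D i).Countable) :
    ∀ᶠ ω in localHomFilter θ, ∀ i, IsLocalHomAt (θ i) (D i) (ω i) :=
  ⟨D, hD, fun _ h => h⟩

theorem eventually_localHomFilter_coord {θ : ∀ i, E i} (i : Fin m) {D : Set (E i)}
    (hD : D.Countable) : ∀ᶠ ω in localHomFilter θ, IsLocalHomAt (θ i) D (ω i) := by
  classical
  have := eventually_localHomFilter (θ := θ) (D := Function.update (fun _ => ∅) i D) fun j => by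
    rcases eq_or_ne j i with rfl | hj
    · simpa using hD
    · simp [hj]
  filter_upwards [this] with ω hω
  simpa using hω i

theorem localHomFilter_neBot (hE : ∀ i, IsArchimedeanLattice (E i)) {θ : ∀ i, E i}
    (hθ : ∀ i, 0 ≤ θ i) (hne : ∀ i, θ i ≠ 0) : (localHomFilter θ).NeBot := by
  refine ⟨fun h => ?_⟩
  obtain ⟨D, hD, hS⟩ : (∅ : Set (∀ i, E i → ℝ)) ∈ localHomFilter θ := h ▸ Filter.mem_bot
  have : ∀ i, ∃ ω, IsLocalHomAt (θ i) (D i) ω := fun i => by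
    obtain ⟨d, hd⟩ := ((hD i).insert (θ i)).exists_eq_range (Set.insert_nonempty _ _)
    obtain ⟨L, ω, h1, h2, h3⟩ := exists_isLocalHom (hE i) (hθ i) (hne i) d
    refine ⟨ω, L, h1, (Set.subset_insert _ _).trans (hd.trans_subset ?_), h3⟩
    rintro _ ⟨n, rfl⟩
    exact h2 n
  choose ω hω using this
  exact hS ω hω

instance germ_isOrderedModule {α : Type*} (l : Filter α) : IsOrderedModule ℝ (l.Germ ℝ) where
  smul_le_smul_of_nonneg_left c hc a b h := by
    induction a using Filter.Germ.inductionOn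
    induction b using Filter.Germ.inductionOn
    rw [← Filter.Germ.coe_smul, ← Filter.Germ.coe_smul]
    filter_upwards [Filter.Germ.coe_le.1 h] with x hx
    exact mul_le_mul_of_nonneg_left hx hc
  smul_le_smul_of_nonneg_right b hb c d h := by
    induction b using Filter.Germ.inductionOn
    rw [← Filter.Germ.coe_smul, ← Filter.Germ.coe_smul]
    filter_upwards [Filter.Germ.coe_le.1 hb] with x hx
    exact mul_le_mul_of_nonneg_right h hx

/-- The countable intersection property makes the inequalities for all `n` hold simultaneously on
one set of the filter, which reduces the claim to the real numbers. -/
theorem germ_isArchimedeanLattice {α : Type u} (l : Filter α) [CountableInterFilter l] :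
    IsArchimedeanLattice (l.Germ ℝ) := by
  intro a b h
  induction a using Filter.Germ.inductionOn with | h f => ?_
  induction b using Filter.Germ.inductionOn with | h g => ?_
  have h' : ∀ n : ℕ, ∀ᶠ x in l, (n • f) x ≤ g x := fun n => Filter.Germ.coe_le.1 (h n)
  refine Filter.Germ.coe_le.2 ?_
  filter_upwards [eventually_countable_forall.2 h'] with x hx
  by_contra! hpos
  obtain ⟨n, hn⟩ := Archimedean.arch (g x + 1) hpos
  have := hx n
  simp only [Pi.smul_apply] at this
  linarith

theorem map_update_coord {ω : ∀ i, E i → ℝ} [DecidableEq (Fin m)] (x : ∀ i, E i) (i : Fin m)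
    (a : E i) : ∏ j, ω j (Function.update x i a j) =
      ω i a * ∏ j ∈ Finset.univ \ {i}, ω j (x j) := by
  simp_rw [Function.apply_update ω x i a]
  rw [Finset.prod_update_of_mem (Finset.mem_univ i)]

/-- The lattice multimorphism into germs given by products of local lattice homomorphisms. -/
noncomputable def germTarget (θ : ∀ i, E i) : LatticeTarget E where
  carrier := (localHomFilter θ).Germ ℝ
  archimedean := germ_isArchimedeanLattice _
  map :=
    { toFun := fun x => ((fun ω => ∏ i, ω i (x i) : (∀ i, E i → ℝ) → ℝ) :
        (localHomFilter θ).Germ ℝ)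
      map_update_add' := fun x i a b => by
        rw [← Filter.Germ.coe_add]
        refine Filter.Germ.coe_eq.2 ?_
        filter_upwards [eventually_localHomFilter_coord (θ := θ) i
          (Set.toFinite {a, b}).countable] with ω hω
        obtain ⟨L, hL, hD, -⟩ := hω
        simp only [Pi.add_apply, map_update_coord]
        rw [hL.map_add a (hD (by simp)) b (hD (by simp)), add_mul]
      map_update_smul' := fun x i c a => by
        rw [← Filter.Germ.coe_smul]
        refine Filter.Germ.coe_eq.2 ?_
        filter_upwards [eventually_localHomFilter_coord (θ := θ) i
          (Set.toFinite {a}).countable] with ω hω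
        obtain ⟨L, hL, hD, -⟩ := hω
        simp only [Pi.smul_apply, map_update_coord]
        rw [hL.map_smul c a (hD (by simp)), smul_eq_mul, mul_assoc] }
  isLatticeMultimorphism := fun x => by
    change ((_ : (localHomFilter θ).Germ ℝ) ⊔ _) = _
    refine Filter.Germ.coe_eq.2 ?_
    filter_upwards [eventually_localHomFilter (θ := θ) (D := fun i => {x i})
      fun i => Set.countable_singleton _] with ω hω
    change |∏ i, ω i (x i)| = _
    rw [Finset.abs_prod]
    refine Finset.prod_congr rfl fun i _ => ?_
    obtain ⟨L, hL, hD, -⟩ := hω i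
    rw [hL.map_abs (hD rfl)]

/-- It suffices to find one Archimedean target in which the image of `θ` is nonzero. The
homomorphisms from `exists_isLocalHom` live only on sublattices containing prescribed countable
sets; taking germs of their products along `localHomFilter` yields a lattice multimorphism on all of
`E`, and the image of `θ` is the germ of the constant `1` along a proper filter. -/
theorem tmul_ne_zero (hE : ∀ i, IsArchimedeanLattice (E i)) {θ : ∀ i, E i}
    (hθ : ∀ i, 0 ≤ θ i) (hne : ∀ i, θ i ≠ 0) : LatticeTensor.tmul θ ≠ 0 := by
  intro h
  have h1 := congrArg (LatticeTensor.lift (germTarget θ)) h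
  rw [LatticeTensor.lift_tmul, LatticeTensor.lift_zero] at h1
  have h2 : ∀ᶠ ω in localHomFilter θ, ∏ i, ω i (θ i) = 0 := Filter.Germ.coe_eq.1 h1
  have := localHomFilter_neBot hE hθ hne
  obtain ⟨ω, h3, h4⟩ := (h2.and (eventually_localHomFilter (θ := θ) (D := fun _ => ∅)
    fun _ => Set.countable_empty)).exists
  have : ∏ i, ω i (θ i) = 1 := Finset.prod_eq_one fun i _ => by
    obtain ⟨L, -, -, -, h⟩ := h4 i
    exact h
  rw [this] at h3
  exact one_ne_zero h3

end Nonvanishing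

/-! ## Positivity and density -/

section Positivity

variable {m : ℕ} {E : Fin m → Type u}
  [∀ i, AddCommGroup (E i)] [∀ i, Module ℝ (E i)] [∀ i, Lattice (E i)]
  [∀ i, IsOrderedAddMonoid (E i)] [∀ i, IsOrderedModule ℝ (E i)]

theorem isLatticeMultimorphism_tmul :
    IsLatticeMultimorphism (LatticeTensor.tmul : MultilinearMap ℝ E (LatticeTensor E)) :=
  LatticeTensor.abs_tmul

theorem exists_abs_le (p : (∀ i, E i) →₀ ℝ) :
    ∃ e : ∀ i, E i, (∀ i, 0 ≤ e i) ∧ ∀ x ∈ p.support, ∀ i, |x i| ≤ e i :=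
  ⟨fun i => ∑ x ∈ p.support, |x i|, fun _ => Finset.sum_nonneg fun _ _ => abs_nonneg _,
    fun _ hx i => Finset.single_le_sum (f := fun y : ∀ i, E i => |y i|)
      (fun _ _ => abs_nonneg _) hx⟩

/-- A positive multilinear operator is positive on linear combinations of elementary tensors that
are positive in the vector lattice tensor product. -/
theorem IsPositiveMultilinear.extendLinear_nonneg (hE : ∀ i, IsArchimedeanLattice (E i))
    {G : Type u} [AddCommGroup G] [Module ℝ G] [Lattice G] [IsOrderedAddMonoid G]
    [IsOrderedModule ℝ G] (hG : IsArchimedeanLattice G) {T : MultilinearMap ℝ E G}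
    (hT : IsPositiveMultilinear T) {p : (∀ i, E i) →₀ ℝ}
    (hp : 0 ≤ extendLinear (LatticeTensor.tmul : MultilinearMap ℝ E (LatticeTensor E)) p) :
    0 ≤ extendLinear T p := by
  obtain ⟨e, he, hpe⟩ := exists_abs_le p
  have hTe := hT e he
  have key : ∀ ε : ℝ, 0 < ε → -extendLinear T p ≤ (2 * ε) • T e := by
    intro ε hε
    obtain ⟨ι, _, f, C, hf, hsum, h1, h2⟩ := exists_tensor_partition hE p he hpe hε
    -- If all entries of the block are nonzero, its elementary tensor is a nonzero support on which
    -- the nonnegative tensor of `p` is at most `(C J + ε) • ⊗e`, so `C J ≥ -ε`. Otherwise both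
    -- sides vanish.
    have hC : ∀ J, (-ε) • T (fun i => f i (J i)) ≤ C J • T fun i => f i (J i) := by
      intro J
      by_cases hz : ∀ i, f i (J i) ≠ 0
      · refine smul_le_smul_of_nonneg_right ?_ (hT _ fun i => hf i _)
        have h3 := (h1 _ _ isLatticeMultimorphism_tmul J).1
        have hpos := (isLatticeMultimorphism_tmul (E := E)).isPositiveMultilinear
        have h0 := hpos _ fun i => hf i (J i)
        have h4 := NonposOn.coe_nonpos (c := -(C J + ε)) (θ := LatticeTensor.tmul e) h0
          (tmul_ne_zero hE (fun i => hf i _) hz)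
          (hpos.mono (fun i => hf i _) fun i => hsum i ▸
            Finset.single_le_sum (fun k _ => hf i k) (Finset.mem_univ _))
          (h3.mono h0 (by
            rw [neg_smul]
            exact neg_le_sub_iff_le_add.2 (le_add_of_nonneg_left hp)))
        linarith
      · push Not at hz
        obtain ⟨i, hi⟩ := hz
        rw [T.map_coord_zero i hi, smul_zero, smul_zero]
    have h5 : (-ε) • T e ≤ ∑ J, C J • T fun i => f i (J i) := by
      rw [show e = fun i => ∑ j, f i j from funext fun i => (hsum i).symm, T.map_sum,
        Finset.smul_sum]
      exact Finset.sum_le_sum fun J _ => hC J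
    have h6 := (neg_le_abs _).trans (h2 G T hT)
    calc -extendLinear T p = -(extendLinear T p - ∑ J, C J • T fun i => f i (J i)) -
          ∑ J, C J • T fun i => f i (J i) := by abel
      _ ≤ ε • T e - (-ε) • T e := sub_le_sub h6 h5
      _ = (2 * ε) • T e := by module
  -- With `ε = 1 / (2 (n + 1))` the bound becomes `n • (-T p) ≤ T e` for every `n`.
  refine neg_nonpos.1 (hG _ (T e) fun n => ?_)
  have h := smul_le_smul_of_nonneg_left (key (1 / (2 * (n + 1))) (by positivity))
    (by positivity : (0 : ℝ) ≤ n)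
  rw [← Nat.cast_smul_eq_nsmul ℝ]
  refine h.trans ?_
  rw [smul_smul]
  refine smul_le_of_le_one_left hTe ?_
  rw [← mul_assoc, mul_one_div, div_le_one (by positivity)]
  linarith

/-- The positive part of a linear combination of elementary tensors is approximated by positive
combinations of elementary tensors of positive vectors. -/
theorem exists_abs_posPart_sub_le (hE : ∀ i, IsArchimedeanLattice (E i))
    (p : (∀ i, E i) →₀ ℝ) : ∃ e : ∀ i, E i, (∀ i, 0 ≤ e i) ∧ ∀ ε : ℝ, 0 < ε →
      ∃ q : (∀ i, E i) →₀ ℝ, (∀ x ∈ q.support, 0 ≤ q x ∧ ∀ i, 0 ≤ x i) ∧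
        |(extendLinear (LatticeTensor.tmul : MultilinearMap ℝ E (LatticeTensor E)) p)⁺ -
          extendLinear LatticeTensor.tmul q| ≤ ε • LatticeTensor.tmul e := by
  obtain ⟨e, he, hpe⟩ := exists_abs_le p
  classical
  refine ⟨e, he, fun ε hε => ?_⟩
  obtain ⟨ι, _, f, C, hf, hsum, h1, -⟩ := exists_tensor_partition hE p he hpe hε
  set Φ : MultilinearMap ℝ E (LatticeTensor E) := LatticeTensor.tmul
  have hΦ : IsLatticeMultimorphism Φ := isLatticeMultimorphism_tmul
  have hpos := hΦ.isPositiveMultilinear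
  have he' : Φ e = ∑ J : ∀ i, ι i, Φ fun i => f i (J i) := by
    rw [show e = fun i => ∑ j, f i j from funext fun i => (hsum i).symm, Φ.map_sum]
  have hΦe := hpos e he
  have hΦf : ∀ J : ∀ i, ι i, 0 ≤ Φ fun i => f i (J i) := fun J => hpos _ fun i => hf i _
  -- On the block `J` the tensor is almost `C J • ⊗e`, so its positive part is almost `(C J)⁺ • ⊗e`.
  -- The partition estimate is now used inside the tensor product itself, with the block tensors as
  -- parts of `⊗e`.
  refine ⟨∑ J : ∀ i, ι i, Finsupp.single (fun i => f i (J i)) (C J)⁺, fun x hx => ?_, ?_⟩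
  · obtain ⟨J, -, hJ⟩ := Finset.mem_biUnion.1 (Finsupp.support_finsetSum hx)
    have hxJ := Finset.mem_singleton.1 (Finsupp.support_single_subset hJ)
    refine ⟨?_, fun i => hxJ ▸ hf i _⟩
    rw [Finsupp.finsetSum_apply]
    refine Finset.sum_nonneg fun K _ => ?_
    rw [Finsupp.single_apply]
    split_ifs
    exacts [posPart_nonneg _, le_rfl]
  · have h2 : extendLinear Φ (∑ J : ∀ i, ι i, Finsupp.single (fun i => f i (J i)) (C J)⁺) =
        ∑ J, (C J)⁺ • Φ fun i => f i (J i) := by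
      simp [extendLinear]
    rw [h2, he']
    refine abs_sub_sum_smul_le_of_nonposOn LatticeTensor.archimedean hΦf
      (M := ∑ x ∈ p.support, |p x|) ?_ (fun J => ?_) fun J => ?_
    · rw [← he', abs_of_nonneg (posPart_nonneg _), extendLinear_apply, Finset.sum_smul]
      refine sup_le (Finset.sum_le_sum fun x hx => ?_)
        (Finset.sum_nonneg fun x _ => smul_nonneg (abs_nonneg _) hΦe)
      refine (le_abs_self _).trans ?_
      rw [abs_real_smul]
      exact smul_le_smul_of_nonneg_left (hpos.abs_map_le_of_abs_le (hpe x hx)) (abs_nonneg _)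
    · rw [← he']
      refine (NonposOn.sup (hΦf J) (h1 _ Φ hΦ J).1 (NonposOn.of_nonpos (hΦf J) le_rfl)).mono
        (hΦf J) ?_
      rw [posPart_def, sup_sub]
      refine sup_le (le_sup_of_le_left (sub_le_sub_left
        (smul_le_smul_of_nonneg_right (by linarith [le_posPart (C J)]) hΦe) _))
        (le_sup_of_le_right ?_)
      rw [zero_sub, neg_nonpos]
      exact smul_nonneg (add_nonneg (posPart_nonneg _) hε.le) hΦe
    · rw [← he']
      refine (NonposOn.sup (hΦf J) (h1 _ Φ hΦ J).2 (NonposOn.of_nonpos (hΦf J) le_rfl)).mono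
        (hΦf J) ?_
      rcases le_total 0 (C J) with hC | hC
      · rw [posPart_of_nonneg hC]
        exact le_sup_of_le_left (sub_le_sub_left (le_posPart _) _)
      · rw [posPart_eq_zero.2 hC]
        refine le_sup_of_le_right (sub_nonpos.2 ?_)
        refine le_trans ?_ (posPart_nonneg _)
        exact smul_nonpos_of_nonpos_of_nonneg (by linarith) hΦe

end Positivity

/-! ## Continuity of positive operators on Banach lattices -/

section NormedLattice

variable {V : Type u} [NormedAddCommGroup V] [NormedSpace ℝ V] [Lattice V] [HasSolidNorm V]
  [IsOrderedAddMonoid V] [IsOrderedModule ℝ V]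

theorem norm_le_norm_of_nonneg_of_le {x y : V} (hx : 0 ≤ x) (hxy : x ≤ y) : ‖x‖ ≤ ‖y‖ :=
  norm_le_norm_of_abs_le_abs (by rwa [abs_of_nonneg hx, abs_of_nonneg (hx.trans hxy)])

theorem norm_posPart_le (x : V) : ‖x⁺‖ ≤ ‖x‖ := by
  rw [← norm_abs_eq_norm x]
  exact norm_le_norm_of_nonneg_of_le (posPart_nonneg x) (sup_le (le_abs_self x) (abs_nonneg x))

theorem norm_negPart_le (x : V) : ‖x⁻‖ ≤ ‖x‖ := by
  rw [← posPart_neg, ← norm_neg x]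
  exact norm_posPart_le _

variable (V) in
theorem isArchimedeanLattice_of_normed : IsArchimedeanLattice V := by
  intro x y h
  have h1 : ∀ n : ℕ, n * ‖x⁺‖ ≤ ‖y⁺‖ := fun n => by
    have h2 : (n : ℝ) • x⁺ ≤ y⁺ := by
      rw [← posPart_smul_of_nonneg n.cast_nonneg, Nat.cast_smul_eq_nsmul]
      exact posPart_mono (h n)
    have := norm_le_norm_of_nonneg_of_le
      (smul_nonneg (n.cast_nonneg : (0 : ℝ) ≤ n) (posPart_nonneg x)) h2
    rwa [norm_smul, Real.norm_natCast] at this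
  rw [← posPart_eq_zero, ← norm_eq_zero]
  by_contra hne
  obtain ⟨n, hn⟩ := exists_nat_gt (‖y⁺‖ / ‖x⁺‖)
  have hpos : 0 < ‖x⁺‖ := lt_of_le_of_ne (norm_nonneg _) (Ne.symm hne)
  rw [div_lt_iff₀ hpos] at hn
  exact absurd (h1 n) (not_le.2 hn)

end NormedLattice

section Bounded

variable {m : ℕ} {E : Fin m → Type u} {G : Type u}
  [∀ i, NormedAddCommGroup (E i)] [∀ i, NormedSpace ℝ (E i)] [∀ i, CompleteSpace (E i)]
  [∀ i, Lattice (E i)] [∀ i, HasSolidNorm (E i)] [∀ i, IsOrderedAddMonoid (E i)]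
  [∀ i, IsOrderedModule ℝ (E i)]
  [NormedAddCommGroup G] [NormedSpace ℝ G] [Lattice G] [HasSolidNorm G] [IsOrderedAddMonoid G]
  [IsOrderedModule ℝ G]

/-- If `‖T (x n)‖ > n * 2 ^ (n * m)` for positive `x n` in the unit balls, the sums `s i = ∑ 2 ^
(-n) • x n i` converge by completeness and dominate each term, so monotonicity gives `‖T s‖ ≥ n` for
all `n`. -/
theorem IsPositiveMultilinear.exists_bound_of_norm_le_one {T : MultilinearMap ℝ E G}
    (hT : IsPositiveMultilinear T) :
    ∃ C : ℝ, ∀ x : ∀ i, E i, (∀ i, 0 ≤ x i) → (∀ i, ‖x i‖ ≤ 1) → ‖T x‖ ≤ C := by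
  by_contra! hcon
  choose x hx hx1 hxT using fun n : ℕ => hcon (n * (2 ^ n) ^ m)
  have hnorm : ∀ i n, ‖((1 / 2 : ℝ) ^ n) • x n i‖ ≤ (1 / 2 : ℝ) ^ n := fun i n => by
    rw [norm_smul, norm_pow, Real.norm_of_nonneg (by norm_num : (0 : ℝ) ≤ 1 / 2)]
    exact mul_le_of_le_one_right (by positivity) (hx1 n i)
  have hsum : ∀ i, Summable fun n => ((1 / 2 : ℝ) ^ n) • x n i := fun i =>
    Summable.of_norm_bounded summable_geometric_two (hnorm i)
  set s : ∀ i, E i := fun i => ∑' n, ((1 / 2 : ℝ) ^ n) • x n i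
  have hnn : ∀ n i, 0 ≤ ((1 / 2 : ℝ) ^ n) • x n i := fun n i =>
    smul_nonneg (by positivity) (hx n i)
  have key : ∀ n : ℕ, (n : ℝ) ≤ ‖T s‖ := by
    intro n
    have h1 : T (fun i => ((1 / 2 : ℝ) ^ n) • x n i) ≤ T s :=
      hT.mono (hnn n) fun i => (hsum i).le_tsum n fun k _ => hnn k i
    have h2 := norm_le_norm_of_nonneg_of_le (hT _ (hnn n)) h1
    rw [T.map_smul_univ, Finset.prod_const, Finset.card_univ, Fintype.card_fin, norm_smul,
      norm_pow, norm_pow, Real.norm_of_nonneg (by norm_num : (0 : ℝ) ≤ 1 / 2)] at h2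
    refine le_trans ?_ h2
    have h3 := mul_le_mul_of_nonneg_left (hxT n).le (by positivity : (0 : ℝ) ≤ ((1 / 2) ^ n) ^ m)
    refine le_trans (le_of_eq ?_) h3
    rw [mul_left_comm, ← mul_pow, ← mul_pow]
    norm_num
  obtain ⟨n, hn⟩ := exists_nat_gt ‖T s‖
  exact absurd (key n) (not_le.2 hn)

/-- Positive multilinear operators on Banach lattices are bounded. -/
theorem IsPositiveMultilinear.exists_bound {T : MultilinearMap ℝ E G}
    (hT : IsPositiveMultilinear T) :
    ∃ C : ℝ, 0 ≤ C ∧ ∀ x : ∀ i, E i, (∀ i, 0 ≤ x i) → ‖T x‖ ≤ C * ∏ i, ‖x i‖ := by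
  obtain ⟨C, hC⟩ := hT.exists_bound_of_norm_le_one
  refine ⟨max C 0, le_max_right _ _, fun x hx => ?_⟩
  have hxy : x = fun i => ‖x i‖ • (‖x i‖⁻¹ • x i) := by
    funext i
    by_cases h : x i = 0
    · simp [h]
    · rw [smul_inv_smul₀ (norm_ne_zero_iff.2 h)]
  have h1 : ‖T fun i => ‖x i‖⁻¹ • x i‖ ≤ C :=
    hC _ (fun i => smul_nonneg (inv_nonneg.2 (norm_nonneg _)) (hx i)) fun i => by
      rw [norm_smul, norm_inv, norm_norm]
      exact inv_mul_le_one
  have h2 : T x = (∏ i, ‖x i‖) • T fun i => ‖x i‖⁻¹ • x i := by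
    conv_lhs => rw [hxy]
    exact T.map_smul_univ _ _
  rw [h2, norm_smul, Real.norm_of_nonneg (Finset.prod_nonneg fun i _ => norm_nonneg _), mul_comm]
  exact mul_le_mul_of_nonneg_right (h1.trans (le_max_left _ _))
    (Finset.prod_nonneg fun i _ => norm_nonneg _)

end Bounded

section BoundedLinear

variable {X Y : Type u} [NormedAddCommGroup X] [NormedSpace ℝ X] [CompleteSpace X] [Lattice X]
  [HasSolidNorm X] [IsOrderedAddMonoid X] [IsOrderedModule ℝ X]
  [NormedAddCommGroup Y] [NormedSpace ℝ Y] [Lattice Y] [HasSolidNorm Y] [IsOrderedAddMonoid Y]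
  [IsOrderedModule ℝ Y]

/-- Positive linear operators on Banach lattices are bounded. -/
theorem IsPositiveLinear.exists_bound {S : X →ₗ[ℝ] Y} (hS : IsPositiveLinear S) :
    ∃ C : ℝ, 0 ≤ C ∧ ∀ x, ‖S x‖ ≤ C * ‖x‖ := by
  have hT : IsPositiveMultilinear (MultilinearMap.ofSubsingleton ℝ X Y (0 : Fin 1) S) :=
    fun x hx => hS _ (hx 0)
  obtain ⟨C, hC0, hC⟩ := hT.exists_bound
  have hC' : ∀ x : X, 0 ≤ x → ‖S x‖ ≤ C * ‖x‖ := fun x hx => by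
    simpa using hC (fun _ => x) fun _ => hx
  refine ⟨2 * C, by positivity, fun x => ?_⟩
  calc ‖S x‖ = ‖S x⁺ - S x⁻‖ := by rw [← map_sub, posPart_sub_negPart]
    _ ≤ ‖S x⁺‖ + ‖S x⁻‖ := norm_sub_le _ _
    _ ≤ C * ‖x‖ + C * ‖x‖ := add_le_add
        ((hC' _ (posPart_nonneg x)).trans (mul_le_mul_of_nonneg_left (norm_posPart_le x) hC0))
        ((hC' _ (negPart_nonneg x)).trans (mul_le_mul_of_nonneg_left (norm_negPart_le x) hC0))
    _ = 2 * C * ‖x‖ := by ring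

theorem IsRegularLinear.exists_bound {S : X →ₗ[ℝ] Y} (hS : IsRegularLinear S) :
    ∃ C : ℝ, 0 ≤ C ∧ ∀ x, ‖S x‖ ≤ C * ‖x‖ := by
  obtain ⟨S₁, S₂, h₁, h₂, rfl⟩ := hS
  obtain ⟨C₁, h1, hC₁⟩ := h₁.exists_bound
  obtain ⟨C₂, h2, hC₂⟩ := h₂.exists_bound
  refine ⟨C₁ + C₂, add_nonneg h1 h2, fun x => ?_⟩
  rw [LinearMap.sub_apply, add_mul]
  exact (norm_sub_le _ _).trans (add_le_add (hC₁ x) (hC₂ x))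

theorem IsRegularLinear.continuous {S : X →ₗ[ℝ] Y} (hS : IsRegularLinear S) : Continuous S := by
  obtain ⟨C, -, hC⟩ := hS.exists_bound
  exact (S.mkContinuous C hC).continuous

end BoundedLinear

/-! ## Linearization -/

section Linearization

variable {m : ℕ} [NeZero m] {E : Fin m → Type u}
  [∀ i, NormedAddCommGroup (E i)] [∀ i, NormedSpace ℝ (E i)] [∀ i, CompleteSpace (E i)]
  [∀ i, Lattice (E i)] [∀ i, HasSolidNorm (E i)] [∀ i, IsOrderedAddMonoid (E i)]
  [∀ i, IsOrderedModule ℝ (E i)]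

variable (E) in
/-- The linear map from formal combinations of tuples to the vector lattice tensor product. -/
noncomputable abbrev tensorMap : ((∀ i, E i) →₀ ℝ) →ₗ[ℝ] LatticeTensor E :=
  extendLinear LatticeTensor.tmul

theorem LatticeTensor.norm_le_smul_norm_tmul {u : LatticeTensor E} {e : ∀ i, E i}
    (he : ∀ i, 0 ≤ e i) {ε : ℝ} (hε : 0 ≤ ε) (h : |u| ≤ ε • LatticeTensor.tmul e) :
    ‖u‖ ≤ ε * ‖(LatticeTensor.tmul e : LatticeTensor E)‖ := by
  have h0 := (isLatticeMultimorphism_tmul (E := E)).isPositiveMultilinear e he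
  have := LatticeTensor.norm_le_of_abs_le (u := u) (v := ε • LatticeTensor.tmul e)
    (by rwa [abs_of_nonneg (smul_nonneg hε h0)])
  rwa [norm_smul, Real.norm_of_nonneg hε] at this

theorem LatticeTensor.norm_posPart_sub_posPart_le (u v : LatticeTensor E) :
    ‖u⁺ - v⁺‖ ≤ ‖u - v‖ := by
  have := LatticeTensor.norm_sup_sub_sup_le u 0 v 0
  rwa [sub_zero, norm_zero, add_zero] at this

theorem exists_norm_posPart_tensorMap_sub_le (p : (∀ i, E i) →₀ ℝ) {ε : ℝ} (hε : 0 < ε) :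
    ∃ q : (∀ i, E i) →₀ ℝ, (∀ x ∈ q.support, 0 ≤ q x ∧ ∀ i, 0 ≤ x i) ∧
      ‖(tensorMap E p)⁺ - tensorMap E q‖ ≤ ε := by
  obtain ⟨e, he, h⟩ := exists_abs_posPart_sub_le
    (fun i => isArchimedeanLattice_of_normed (E i)) p
  set N := ‖(LatticeTensor.tmul e : LatticeTensor E)‖
  have hN : 0 ≤ N := norm_nonneg _
  obtain ⟨q, hq, hle⟩ := h (ε / (N + 1)) (by positivity)
  refine ⟨q, hq, (LatticeTensor.norm_le_smul_norm_tmul he (by positivity) hle).trans ?_⟩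
  rw [div_mul_eq_mul_div, div_le_iff₀ (by positivity)]
  nlinarith

/-- Elements are built with suprema, whereas combinations of elementary tensors form only a linear
subspace; that this subspace is nevertheless norm dense follows from the approximation of positive
parts. -/
theorem exists_norm_sub_tensorMap_le (u : LatticeTensor E) :
    ∀ ε : ℝ, 0 < ε → ∃ p, ‖u - tensorMap E p‖ ≤ ε := by
  induction u using LatticeTensor.induction with
  | tmul x => exact fun ε hε => ⟨Finsupp.single x 1, by simpa using hε.le⟩
  | zero => exact fun ε hε => ⟨0, by simpa using hε.le⟩
  | add a b ha hb =>
    intro ε hε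
    obtain ⟨p, hp⟩ := ha (ε / 2) (half_pos hε)
    obtain ⟨q, hq⟩ := hb (ε / 2) (half_pos hε)
    refine ⟨p + q, ?_⟩
    rw [map_add, add_sub_add_comm]
    exact (norm_add_le _ _).trans (by linarith)
  | smul c a ha =>
    intro ε hε
    obtain ⟨p, hp⟩ := ha (ε / (|c| + 1)) (by positivity)
    refine ⟨c • p, ?_⟩
    rw [map_smul, ← smul_sub, norm_smul, Real.norm_eq_abs]
    calc |c| * ‖a - tensorMap E p‖ ≤ |c| * (ε / (|c| + 1)) :=
          mul_le_mul_of_nonneg_left hp (abs_nonneg c)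
      _ ≤ ε := by
          rw [mul_div_assoc', div_le_iff₀ (by positivity)]
          nlinarith [abs_nonneg c]
  | sup a b ha hb =>
    intro ε hε
    obtain ⟨p, hp⟩ := ha (ε / 4) (by positivity)
    obtain ⟨q, hq⟩ := hb (ε / 4) (by positivity)
    obtain ⟨r, -, hr⟩ := exists_norm_posPart_tensorMap_sub_le (q - p) (half_pos hε)
    refine ⟨p + r, ?_⟩
    -- The identity `a ⊔ b = a + (b - a)⁺` reduces suprema to positive parts.
    have h1 : tensorMap E p ⊔ tensorMap E q = tensorMap E p + (tensorMap E (q - p))⁺ := by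
      rw [map_sub, posPart_def, add_sup, add_zero, add_sub_cancel, sup_comm]
    have h2 := LatticeTensor.norm_sup_sub_sup_le a b (tensorMap E p) (tensorMap E q)
    calc ‖a ⊔ b - tensorMap E (p + r)‖
        = ‖(a ⊔ b - tensorMap E p ⊔ tensorMap E q) +
            ((tensorMap E (q - p))⁺ - tensorMap E r)‖ := by
          rw [h1, map_add]
          congr 1
          abel
      _ ≤ _ := norm_add_le _ _
      _ ≤ ε := by linarith

theorem exists_norm_sub_tensorMap_le_of_nonneg {u : LatticeTensor E} (hu : 0 ≤ u) {ε : ℝ}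
    (hε : 0 < ε) : ∃ q : (∀ i, E i) →₀ ℝ, (∀ x ∈ q.support, 0 ≤ q x ∧ ∀ i, 0 ≤ x i) ∧
      ‖u - tensorMap E q‖ ≤ ε := by
  obtain ⟨p, hp⟩ := exists_norm_sub_tensorMap_le u (ε / 2) (half_pos hε)
  obtain ⟨q, hq, h⟩ := exists_norm_posPart_tensorMap_sub_le p (half_pos hε)
  refine ⟨q, hq, ?_⟩
  have h1 := LatticeTensor.norm_posPart_sub_posPart_le u (tensorMap E p)
  rw [posPart_of_nonneg hu] at h1
  calc ‖u - tensorMap E q‖ = ‖(u - (tensorMap E p)⁺) + ((tensorMap E p)⁺ - tensorMap E q)‖ := by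
        rw [sub_add_sub_cancel]
    _ ≤ _ := norm_add_le _ _
    _ ≤ ε := by linarith

variable (E) in
/-- The linear map from formal combinations of tuples to the positive projective tensor product. -/
noncomputable def projTensorMap : ((∀ i, E i) →₀ ℝ) →ₗ[ℝ] PosProjTensor E :=
  PosProjTensor.ofLatticeTensor.toLinearMap ∘ₗ tensorMap E

theorem projTensorMap_apply (p : (∀ i, E i) →₀ ℝ) :
    projTensorMap E p = PosProjTensor.ofLatticeTensor (tensorMap E p) := rfl

theorem projTensorMap_single (x : ∀ i, E i) :
    projTensorMap E (Finsupp.single x 1) = PosProjTensor.tmul x := by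
  rw [projTensorMap_apply, Finsupp.linearCombination_single, one_smul]
  rfl

theorem denseRange_projTensorMap : DenseRange (projTensorMap E) := by
  have h : Set.range (PosProjTensor.ofLatticeTensor (E := E)) ⊆
      closure (Set.range (projTensorMap E)) := by
    rintro _ ⟨u, rfl⟩
    refine Metric.mem_closure_iff.2 fun ε hε => ?_
    obtain ⟨p, hp⟩ := exists_norm_sub_tensorMap_le u (ε / 2) (half_pos hε)
    refine ⟨_, ⟨p, rfl⟩, ?_⟩
    rw [dist_eq_norm, projTensorMap_apply, ← map_sub, LinearIsometry.norm_map]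
    linarith
  exact PosProjTensor.denseRange_of.mono h |>.of_closure

/-- Continuous linear maps on the positive projective tensor product are determined by their values
at elementary tensors. -/
theorem PosProjTensor.ext_of_continuous {G : Type u} [NormedAddCommGroup G] [NormedSpace ℝ G]
    {S S' : PosProjTensor E →ₗ[ℝ] G} (hS : Continuous S) (hS' : Continuous S')
    (h : ∀ x : ∀ i, E i, S (PosProjTensor.tmul x) = S' (PosProjTensor.tmul x)) : S = S' := by
  have h1 : S ∘ₗ projTensorMap E = S' ∘ₗ projTensorMap E := by
    refine Finsupp.lhom_ext' fun x => LinearMap.ext_ring ?_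
    simpa [projTensorMap_single] using h x
  refine LinearMap.ext fun a => congrFun (denseRange_projTensorMap.equalizer hS hS' ?_) a
  funext p
  exact LinearMap.congr_fun h1 p

/-- Every positive vector is a limit of positive combinations of elementary tensors of positive
vectors. -/
theorem PosProjTensor.mem_closure_of_nonneg {a : PosProjTensor E} (ha : 0 ≤ a) :
    a ∈ closure (projTensorMap E '' {q | ∀ x ∈ q.support, 0 ≤ q x ∧ ∀ i, 0 ≤ x i}) := by
  refine Metric.mem_closure_iff.2 fun ε hε => ?_
  obtain ⟨_, ⟨u, rfl⟩, hu⟩ := Metric.mem_closure_iff.1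
    (PosProjTensor.denseRange_of (E := E) a) (ε / 2) (half_pos hε)
  obtain ⟨q, hq, h⟩ := exists_norm_sub_tensorMap_le_of_nonneg (posPart_nonneg u)
    (by positivity : 0 < ε / 4)
  refine ⟨_, ⟨q, hq, rfl⟩, ?_⟩
  have h1 : ‖a - PosProjTensor.ofLatticeTensor u⁺‖ ≤ ‖a - PosProjTensor.ofLatticeTensor u‖ := by
    have h2 : PosProjTensor.ofLatticeTensor u⁺ = (PosProjTensor.ofLatticeTensor u)⁺ := by
      rw [posPart_def, posPart_def, PosProjTensor.of_sup, map_zero]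
    have := norm_sup_sub_sup_le_norm a (PosProjTensor.ofLatticeTensor u) 0
    rwa [sup_eq_left.2 ha, ← posPart_def, ← h2] at this
  rw [dist_eq_norm] at hu ⊢
  have h3 : ‖PosProjTensor.ofLatticeTensor u⁺ - projTensorMap E q‖ ≤ ε / 4 := by
    rwa [projTensorMap_apply, ← map_sub, LinearIsometry.norm_map]
  calc ‖a - projTensorMap E q‖ = ‖(a - PosProjTensor.ofLatticeTensor u⁺) +
        (PosProjTensor.ofLatticeTensor u⁺ - projTensorMap E q)‖ := by rw [sub_add_sub_cancel]
    _ ≤ _ := norm_add_le _ _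
    _ < ε := by linarith

variable {G : Type u} [NormedAddCommGroup G] [NormedSpace ℝ G] [CompleteSpace G] [Lattice G]
  [HasSolidNorm G] [IsOrderedAddMonoid G] [IsOrderedModule ℝ G]

/-- A majorant `|u| ≤ ∑ x k` by positive elementary tensors is carried to `|T p| ≤ ∑ T (x k)` by
applying `extendLinear_nonneg` to both `q - p` and `q + p`; then take the infimum. In particular
`extendLinear T p` depends only on the tensor of `p`. -/
theorem IsPositiveMultilinear.norm_extendLinear_le {T : MultilinearMap ℝ E G}
    (hT : IsPositiveMultilinear T) {C : ℝ} (hC0 : 0 ≤ C)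
    (hC : ∀ x : ∀ i, E i, (∀ i, 0 ≤ x i) → ‖T x‖ ≤ C * ∏ i, ‖x i‖) (p : (∀ i, E i) →₀ ℝ) :
    ‖extendLinear T p‖ ≤ C * ‖tensorMap E p‖ := by
  have hE := fun i => isArchimedeanLattice_of_normed (E i)
  have hG := isArchimedeanLattice_of_normed G
  have key : ∀ r ∈ LatticeTensor.normSet (tensorMap E p), ‖extendLinear T p‖ ≤ C * r := by
    rintro _ ⟨n, x, hx, hle, rfl⟩
    set q : (∀ i, E i) →₀ ℝ := ∑ k, Finsupp.single (x k) 1 with hq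
    have hqE : tensorMap E q = ∑ k, LatticeTensor.tmul (x k) := by simp [hq]
    have hqT : extendLinear T q = ∑ k, T (x k) := by simp [hq]
    obtain ⟨h1, h2⟩ := abs_le'.1 (hle.trans hqE.ge)
    have h3 : 0 ≤ extendLinear T (q - p) := hT.extendLinear_nonneg hE hG (by
      rw [map_sub]; exact sub_nonneg.2 h1)
    have h4 : 0 ≤ extendLinear T (q + p) := hT.extendLinear_nonneg hE hG (by
      rw [map_add]; exact neg_le_iff_add_nonneg.1 h2)
    have h5 : |extendLinear T p| ≤ ∑ k, T (x k) := by
      rw [← hqT]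
      rw [map_sub] at h3
      rw [map_add] at h4
      exact abs_le'.2 ⟨sub_nonneg.1 h3, neg_le_iff_add_nonneg.2 h4⟩
    calc ‖extendLinear T p‖ ≤ ‖∑ k, T (x k)‖ := norm_le_norm_of_abs_le_abs
          (h5.trans (le_abs_self _))
      _ ≤ ∑ k, ‖T (x k)‖ := norm_sum_le _ _
      _ ≤ ∑ k, C * ∏ i, ‖x k i‖ := Finset.sum_le_sum fun k _ => hC _ (hx k)
      _ = _ := (Finset.mul_sum _ _ _).symm
  rw [LatticeTensor.norm_def, LatticeTensor.projNorm, ← smul_eq_mul,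
    ← Real.sInf_smul_of_nonneg hC0]
  refine le_csInf (LatticeTensor.normSet_nonempty _).smul_set ?_
  rintro _ ⟨r, hr, rfl⟩
  exact key r hr

/-- A positive multilinear operator has a positive linearization. -/
theorem IsPositiveMultilinear.exists_linearization {T : MultilinearMap ℝ E G}
    (hT : IsPositiveMultilinear T) : ∃ S : PosProjTensor E →ₗ[ℝ] G, IsPositiveLinear S ∧
      ∀ x : ∀ i, E i, S (PosProjTensor.tmul x) = T x := by
  obtain ⟨C, hC0, hC⟩ := hT.exists_bound
  have hbound : ∀ p, ‖extendLinear T p‖ ≤ C * ‖projTensorMap E p‖ := fun p => by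
    rw [projTensorMap_apply, LinearIsometry.norm_map]
    exact hT.norm_extendLinear_le hC0 hC p
  set S := (extendLinear T).extendOfNorm (projTensorMap E) with hS
  have hSp : ∀ p, S (projTensorMap E p) = extendLinear T p :=
    LinearMap.extendOfNorm_eq denseRange_projTensorMap ⟨C, hbound⟩
  refine ⟨S, fun a ha => ?_, fun x => ?_⟩
  · have hcl : IsClosed {a | 0 ≤ S a} := isClosed_le continuous_const S.continuous
    refine closure_minimal ?_ hcl (PosProjTensor.mem_closure_of_nonneg ha)
    rintro _ ⟨q, hq, rfl⟩
    change 0 ≤ S _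
    rw [hSp, extendLinear_apply]
    exact Finset.sum_nonneg fun x hx => smul_nonneg (hq x hx).1 (hT x (hq x hx).2)
  · change S _ = _
    rw [← projTensorMap_single, hSp, Finsupp.linearCombination_single, one_smul]

/-- A regular multilinear operator has exactly one linearization. -/
theorem IsRegularMultilinear.existsUnique_linearization {T : MultilinearMap ℝ E G}
    (hT : IsRegularMultilinear T) : ∃! S : PosProjTensor E →ₗ[ℝ] G, IsLinearization T S := by
  obtain ⟨T₁, T₂, h₁, h₂, rfl⟩ := hT
  obtain ⟨S₁, hS₁, hT₁⟩ := h₁.exists_linearization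
  obtain ⟨S₂, hS₂, hT₂⟩ := h₂.exists_linearization
  have hreg : IsRegularLinear (S₁ - S₂) := ⟨S₁, S₂, hS₁, hS₂, rfl⟩
  have hval : ∀ x : ∀ i, E i, (S₁ - S₂) (PosProjTensor.tmul x) = (T₁ - T₂) x := fun x => by
    rw [LinearMap.sub_apply, hT₁, hT₂, sub_apply]
  refine ⟨S₁ - S₂, ⟨hreg, hval⟩, fun S hS => ?_⟩
  exact PosProjTensor.ext_of_continuous hS.1.continuous hreg.continuous fun x => by
    rw [hS.2, hval]

theorem PosProjTensor.isPositiveMultilinear_tmul :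
    IsPositiveMultilinear (PosProjTensor.tmul : MultilinearMap ℝ E (PosProjTensor E)) := by
  intro x hx
  have h := (isLatticeMultimorphism_tmul (E := E)).isPositiveMultilinear x hx
  have h1 := PosProjTensor.of_abs (LatticeTensor.tmul x : LatticeTensor E)
  rw [abs_of_nonneg h] at h1
  change 0 ≤ PosProjTensor.ofLatticeTensor _
  rw [h1]
  exact abs_nonneg _

end Linearization

/-! ## Functionals on normed vector lattices -/

section Functionals

variable {V : Type u} [NormedAddCommGroup V] [NormedSpace ℝ V] [Lattice V] [HasSolidNorm V]
  [IsOrderedAddMonoid V] [IsOrderedModule ℝ V]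

/-- An additive and positively homogeneous function on the positive cone extends to a linear
functional. -/
theorem exists_linearMap_eq_of_cone {φ : V → ℝ}
    (hadd : ∀ x y, 0 ≤ x → 0 ≤ y → φ (x + y) = φ x + φ y)
    (hsmul : ∀ (c : ℝ) x, 0 < c → 0 ≤ x → φ (c • x) = c * φ x) :
    ∃ g : V →ₗ[ℝ] ℝ, ∀ x, 0 ≤ x → g x = φ x := by
  have h0 : φ 0 = 0 := by
    have := hadd 0 0 le_rfl le_rfl
    rw [add_zero] at this
    linarith
  -- `φ a - φ b` depends only on `a - b`; linearity of `x ↦ φ x⁺ - φ x⁻` follows from this.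
  have key : ∀ a b : V, 0 ≤ a → 0 ≤ b → φ (a - b)⁺ - φ (a - b)⁻ = φ a - φ b := by
    intro a b ha hb
    have h := posPart_sub_negPart (a - b)
    have h1 : (a - b)⁺ + b = a + (a - b)⁻ := by
      rw [← sub_eq_sub_iff_add_eq_add, h]
    have h2 := congrArg φ h1
    rw [hadd _ _ (posPart_nonneg _) hb, hadd _ _ ha (negPart_nonneg _)] at h2
    linarith
  refine ⟨{ toFun := fun x => φ x⁺ - φ x⁻, map_add' := fun x y => ?_, map_smul' := fun c x => ?_ },
    fun x hx => ?_⟩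
  · have h := key (x⁺ + y⁺) (x⁻ + y⁻) (add_nonneg (posPart_nonneg _) (posPart_nonneg _))
      (add_nonneg (negPart_nonneg _) (negPart_nonneg _))
    rw [add_sub_add_comm, posPart_sub_negPart, posPart_sub_negPart,
      hadd _ _ (posPart_nonneg _) (posPart_nonneg _),
      hadd _ _ (negPart_nonneg _) (negPart_nonneg _)] at h
    rw [h]
    ring
  · rw [RingHom.id_apply, smul_eq_mul]
    rcases lt_trichotomy c 0 with hc | rfl | hc
    · have hc' : 0 < -c := neg_pos.2 hc
      have h := key ((-c) • x⁻) ((-c) • x⁺) (smul_nonneg hc'.le (negPart_nonneg _))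
        (smul_nonneg hc'.le (posPart_nonneg _))
      rw [← smul_sub, ← neg_sub x⁺ x⁻, posPart_sub_negPart, smul_neg, neg_smul, neg_neg,
        hsmul _ _ hc' (negPart_nonneg _), hsmul _ _ hc' (posPart_nonneg _)] at h
      rw [h]
      ring
    · simp
    · have h := key (c • x⁺) (c • x⁻) (smul_nonneg hc.le (posPart_nonneg _))
        (smul_nonneg hc.le (negPart_nonneg _))
      rw [← smul_sub, posPart_sub_negPart, hsmul _ _ hc (posPart_nonneg _),
        hsmul _ _ hc (negPart_nonneg _)] at h
      rw [h]
      ring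
  · change φ x⁺ - φ x⁻ = φ x
    rw [posPart_of_nonneg hx, negPart_eq_zero.2 hx, h0, sub_zero]

theorem inf_add_posPart_sub (a b : V) : a ⊓ b + (a - b)⁺ = a := by
  rw [inf_eq_sub_posPart_sub, sub_add_cancel]

/-- Every continuous functional is the difference of two positive continuous functionals. -/
theorem exists_positive_sub_positive (f : V →L[ℝ] ℝ) :
    ∃ g h : V →L[ℝ] ℝ, (∀ x, 0 ≤ x → 0 ≤ g x) ∧ (∀ x, 0 ≤ x → 0 ≤ h x) ∧ f = g - h := by
  -- The Riesz–Kantorovich formula: the positive part of `f` at `x ≥ 0` is the supremum of `f` on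
  -- `[0, x]`. Additivity comes from the splitting `z = z ⊓ x + (z - x)⁺` of any `0 ≤ z ≤ x + y`.
  let A : V → Set ℝ := fun x => f '' Set.Icc 0 x
  have hbound : ∀ x, ∀ r ∈ A x, r ≤ ‖f‖ * ‖x‖ := by
    rintro x _ ⟨y, hy, rfl⟩
    exact (le_abs_self _).trans ((f.le_opNorm y).trans (mul_le_mul_of_nonneg_left
      (norm_le_norm_of_nonneg_of_le hy.1 hy.2) (norm_nonneg _)))
  have hbdd : ∀ x, BddAbove (A x) := fun x => ⟨_, hbound x⟩
  have hne : ∀ x, 0 ≤ x → (A x).Nonempty := fun x hx => ⟨_, 0, ⟨le_rfl, hx⟩, rfl⟩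
  let φ : V → ℝ := fun x => sSup (A x)
  have hle : ∀ x y, 0 ≤ y → y ≤ x → f y ≤ φ x := fun x y hy hyx =>
    le_csSup (hbdd x) ⟨y, ⟨hy, hyx⟩, rfl⟩
  obtain ⟨g, hg⟩ := exists_linearMap_eq_of_cone (φ := φ) (fun x y hx hy => by
    refine le_antisymm (csSup_le (hne _ (add_nonneg hx hy)) ?_) ?_
    · rintro _ ⟨z, hz, rfl⟩
      rw [← inf_add_posPart_sub z x, map_add]
      refine add_le_add (hle _ _ (le_inf hz.1 hx) inf_le_right) (hle _ _ (posPart_nonneg _) ?_)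
      exact sup_le (sub_le_iff_le_add'.2 hz.2) hy
    · rw [← le_sub_iff_add_le]
      refine csSup_le (hne _ hx) ?_
      rintro _ ⟨a, ha, rfl⟩
      rw [le_sub_comm]
      refine csSup_le (hne _ hy) ?_
      rintro _ ⟨b, hb, rfl⟩
      rw [le_sub_iff_add_le', ← map_add]
      exact hle _ _ (add_nonneg ha.1 hb.1) (add_le_add ha.2 hb.2)) (fun c x hc hx => by
    have h1 : ∀ (c : ℝ) x, 0 < c → 0 ≤ x → c * φ x ≤ φ (c • x) := fun c x hc hx => by
      rw [← le_div_iff₀' hc]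
      refine csSup_le (hne _ hx) ?_
      rintro _ ⟨a, ha, rfl⟩
      rw [le_div_iff₀' hc, ← smul_eq_mul, ← map_smul]
      exact hle _ _ (smul_nonneg hc.le ha.1) (smul_le_smul_of_nonneg_left ha.2 hc.le)
    refine le_antisymm ?_ (h1 c x hc hx)
    have h2 := h1 c⁻¹ (c • x) (inv_pos.2 hc) (smul_nonneg hc.le hx)
    rwa [inv_smul_smul₀ hc.ne', inv_mul_le_iff₀ hc] at h2)
  have hgpos : ∀ x, 0 ≤ x → 0 ≤ g x := fun x hx => by
    rw [hg x hx]
    simpa using hle x 0 le_rfl hx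
  have hgb : ∀ x, 0 ≤ x → |g x| ≤ ‖f‖ * ‖x‖ := fun x hx => by
    rw [abs_of_nonneg (hgpos x hx), hg x hx]
    exact csSup_le (hne x hx) (hbound x)
  have hgc : ∀ x, ‖g x‖ ≤ 2 * ‖f‖ * ‖x‖ := fun x => by
    calc ‖g x‖ = |g x⁺ - g x⁻| := by rw [← map_sub, posPart_sub_negPart, Real.norm_eq_abs]
      _ ≤ |g x⁺| + |g x⁻| := abs_sub _ _
      _ ≤ ‖f‖ * ‖x‖ + ‖f‖ * ‖x‖ := add_le_add
        ((hgb _ (posPart_nonneg x)).trans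
          (mul_le_mul_of_nonneg_left (norm_posPart_le x) (norm_nonneg _)))
        ((hgb _ (negPart_nonneg x)).trans
          (mul_le_mul_of_nonneg_left (norm_negPart_le x) (norm_nonneg _)))
      _ = 2 * ‖f‖ * ‖x‖ := by ring
  refine ⟨g.mkContinuous _ hgc, g.mkContinuous _ hgc - f, hgpos, fun x hx => ?_, by simp⟩
  have := hle x x hx le_rfl
  rw [← hg x hx] at this
  simpa using this

theorem weaklyNull_of_forall_positive {x : ℕ → V}
    (h : ∀ f : V →L[ℝ] ℝ, (∀ x, 0 ≤ x → 0 ≤ f x) → Tendsto (fun n => f (x n)) atTop (𝓝 0)) :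
    WeaklyNull x := by
  intro f
  obtain ⟨g, k, hg, hk, rfl⟩ := exists_positive_sub_positive f
  simpa using (h g hg).sub (h k hk)

theorem WeaklyNull.of_le {x y : ℕ → V} (hx : WeaklyNull x) (hy : ∀ n, 0 ≤ y n)
    (hyx : ∀ n, y n ≤ x n) : WeaklyNull y :=
  weaklyNull_of_forall_positive fun f hf => squeeze_zero (fun n => hf _ (hy n))
    (fun n => by
      have := hf _ (sub_nonneg.2 (hyx n))
      rwa [map_sub, sub_nonneg] at this) (hx f)

theorem WeaklyNull.comp {x : ℕ → V} (hx : WeaklyNull x) {f : ℕ → ℕ} (hf : StrictMono f) :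
    WeaklyNull (x ∘ f) := fun φ => (hx φ).comp hf.tendsto_atTop

theorem WeaklyNull.exists_norm_le {x : ℕ → V} (hx : WeaklyNull x) : ∃ C, ∀ n, ‖x n‖ ≤ C := by
  obtain ⟨C, hC⟩ := banach_steinhaus
    (g := fun n => NormedSpace.inclusionInDoubleDual ℝ V (x n)) fun f => by
      obtain ⟨B, hB⟩ := (hx f).norm.bddAbove_range
      exact ⟨B, fun n => hB ⟨n, rfl⟩⟩
  refine ⟨C, fun n => ?_⟩
  rw [← (NormedSpace.inclusionInDoubleDualLi ℝ (E := V)).norm_map (x n)]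
  exact hC n

/-- A sublinear functional dominates a linear functional that agrees with it at a given point. -/
theorem exists_linearMap_le_sublinear {W : Type*} [AddCommGroup W] [Module ℝ W] {N : W → ℝ}
    (hsmul : ∀ c : ℝ, 0 < c → ∀ x, N (c • x) = c * N x) (hadd : ∀ x y, N (x + y) ≤ N x + N y)
    (y : W) : ∃ g : W →ₗ[ℝ] ℝ, (∀ x, g x ≤ N x) ∧ g y = N y := by
  have h0 : N 0 = 0 := by
    have := hsmul 2 two_pos 0
    rw [smul_zero] at this
    linarith
  by_cases hy : y = 0
  · obtain ⟨g, -, hg⟩ := exists_extension_of_le_sublinear (⊥ : W →ₗ.[ℝ] ℝ) N hsmul hadd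
      (fun x => by
        have hx : (x : W) = 0 := (Submodule.mem_bot ℝ).1 x.2
        have hx' : x = 0 := Subtype.ext hx
        subst hx'
        rw [LinearPMap.map_zero, Submodule.coe_zero, h0])
    exact ⟨g, hg, by rw [hy, map_zero, h0]⟩
  · obtain ⟨g, hgy, hg⟩ := exists_extension_of_le_sublinear
      (LinearPMap.mkSpanSingleton (K := ℝ) y (N y) hy) N hsmul hadd (by
        rintro ⟨x, hx⟩
        obtain ⟨c, rfl⟩ := Submodule.mem_span_singleton.1 hx
        refine (LinearPMap.mkSpanSingleton'_apply y (N y) _ c hx).trans_le ?_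
        rw [RingHom.id_apply, smul_eq_mul]
        rcases lt_trichotomy c 0 with hc | rfl | hc
        · have h1 := hadd (c • y) (-(c • y))
          rw [add_neg_cancel, h0, ← neg_smul, hsmul _ (neg_pos.2 hc)] at h1
          linarith
        · simp [h0]
        · exact (hsmul c hc y).ge)
    refine ⟨g, hg, ?_⟩
    have := hgy ⟨y, Submodule.mem_span_singleton_self y⟩
    rw [LinearPMap.mkSpanSingleton_apply] at this
    exact this

/-- A pointwise bounded sequence of linear functionals has a pointwise limit along an
ultrafilter. -/
theorem exists_linearMap_tendsto {W : Type*} [AddCommGroup W] [Module ℝ W] (U : Ultrafilter ℕ)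
    {φ : ℕ → W →ₗ[ℝ] ℝ} {B : W → ℝ} (hB : ∀ n x, |φ n x| ≤ B x) :
    ∃ g : W →ₗ[ℝ] ℝ, ∀ x, Tendsto (fun n => φ n x) U (𝓝 (g x)) := by
  have h : ∀ x, ∃ a, Tendsto (fun n => φ n x) U (𝓝 a) := fun x => by
    obtain ⟨a, -, ha⟩ := (isCompact_Icc (a := -B x) (b := B x)).ultrafilter_le_nhds
      (U.map fun n => φ n x) (by
        rw [le_principal_iff]
        exact Filter.mem_map.2 (Filter.univ_mem' fun n => abs_le.1 (hB n x)))
    exact ⟨a, ha⟩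
  choose g hg using h
  exact ⟨{ toFun := g
           map_add' := fun x y => tendsto_nhds_unique (hg (x + y)) (by
            simpa using (hg x).add (hg y))
           map_smul' := fun c x => tendsto_nhds_unique (hg (c • x)) (by
            simpa using (hg x).const_mul c) }, hg⟩

/-! ## Disjoint sequences -/

/-- Disjointness gives `|a| + |b| = ||a| - |b||`, and the right-hand side is at most `|a + b|`. -/
theorem abs_add_eq_of_disjoint {a b : V} (h : |a| ⊓ |b| = 0) : |a + b| = |a| + |b| := by
  refine le_antisymm (abs_add_le a b) ?_
  have h1 := two_nsmul_inf |a| |b|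
  rw [h, smul_zero] at h1
  have h2 := abs_abs_sub_abs_le a (-b)
  rw [abs_neg, sub_neg_eq_add, ← sub_eq_zero.1 h1.symm] at h2
  exact h2

theorem abs_sum_eq_of_disjoint {x : ℕ → V} (hx : ∀ k l, k ≠ l → |x k| ⊓ |x l| = 0) (N : ℕ) :
    |∑ n ∈ Finset.range N, x n| = ∑ n ∈ Finset.range N, |x n| := by
  induction N with
  | zero => simp
  | succ N ih =>
    have h : (∑ n ∈ Finset.range N, |x n|) ⊓ |x N| = 0 := by
      have h1 : ∀ s : Finset ℕ, (∀ n ∈ s, n ≠ N) → (∑ n ∈ s, |x n|) ⊓ |x N| = 0 := by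
        intro s
        induction s using Finset.induction_on with
        | empty => intro _; simp
        | insert n s hn ih' =>
          intro hs
          rw [Finset.sum_insert hn]
          refine le_antisymm ?_ (le_inf (add_nonneg (abs_nonneg _)
            (Finset.sum_nonneg fun _ _ => abs_nonneg _)) (abs_nonneg _))
          refine (add_inf_le_add_inf (abs_nonneg _)
            (Finset.sum_nonneg fun _ _ => abs_nonneg _) (abs_nonneg _)).trans ?_
          rw [hx n N (hs n (Finset.mem_insert_self n s)),
            ih' fun k hk => hs k (Finset.mem_insert_of_mem hk), add_zero]
      exact h1 _ fun n hn => (Finset.mem_range.1 hn).ne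
    rw [Finset.sum_range_succ, Finset.sum_range_succ, abs_add_eq_of_disjoint (by rwa [ih]), ih]

theorem eq_of_sum_eq_of_le {N : ℕ} {a b : ℕ → ℝ} (hle : ∀ n, a n ≤ b n)
    (h : ∑ n ∈ Finset.range N, a n = ∑ n ∈ Finset.range N, b n) {n : ℕ} (hn : n < N) :
    a n = b n :=
  (Finset.sum_eq_sum_iff_of_le fun k _ => hle k).1 h n (Finset.mem_range.2 hn)

/-- The absolute values of a disjoint weakly null sequence form a weakly null sequence. -/
theorem WeaklyNull.abs_of_disjoint {x : ℕ → V} (hx : WeaklyNull x)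
    (hd : ∀ k l, k ≠ l → |x k| ⊓ |x l| = 0) : WeaklyNull fun n => |x n| := by
  refine weaklyNull_of_forall_positive fun f hf => ?_
  have hmono : ∀ {a b : V}, a ≤ b → f a ≤ f b := fun {a b} hab => by
    have := hf _ (sub_nonneg.2 hab)
    rwa [map_sub, sub_nonneg] at this
  -- Hahn–Banach for the sublinear functional `x ↦ f |x|`, touching it at `∑ n < N, x n`. By
  -- disjointness its value there is `∑ f |x n|`, and since `g N (x n) ≤ f |x n|` for each term,
  -- equality of the sums forces equality term by term.
  choose g hgle hg using fun N => exists_linearMap_le_sublinear (N := fun x : V => f |x|)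
    (fun c hc x => by rw [abs_smul_of_nonneg hc.le, map_smul, smul_eq_mul])
    (fun x y => by rw [← map_add]; exact hmono (abs_add_le x y)) (∑ n ∈ Finset.range N, x n)
  have hgabs : ∀ N x, |g N x| ≤ f |x| := fun N x => abs_le'.2 ⟨hgle N x, by
    have := hgle N (-x)
    rwa [map_neg, abs_neg] at this⟩
  have hgx : ∀ N n, n < N → g N (x n) = f |x n| := fun N n hn => by
    have h1 := hg N
    rw [abs_sum_eq_of_disjoint hd, map_sum, map_sum] at h1
    exact eq_of_sum_eq_of_le (fun k => hgle N (x k)) h1 hn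
  -- The limit is one continuous functional with `G (x n) = f |x n|` for all `n`, so weak nullity of
  -- `x` tested on `G` is the claim for `f`.
  obtain ⟨G, hG⟩ := exists_linearMap_tendsto (hyperfilter ℕ) hgabs
  have hGabs : ∀ x, ‖G x‖ ≤ ‖f‖ * ‖x‖ := fun x => by
    refine le_of_tendsto (hG x).norm (Filter.Eventually.of_forall fun N => ?_)
    refine (hgabs N x).trans ((le_abs_self _).trans ((f.le_opNorm _).trans ?_))
    rw [norm_abs_eq_norm]
  have hGx : ∀ n, G (x n) = f |x n| := fun n => by
    refine tendsto_nhds_unique (hG (x n)) (tendsto_const_nhds.congr' ?_)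
    have h1 : ∀ᶠ N in atTop, f |x n| = g N (x n) := by
      filter_upwards [eventually_gt_atTop n] with N hN
      exact (hgx N n hN).symm
    exact h1.filter_mono Nat.hyperfilter_le_atTop
  have := hx (G.mkContinuous _ hGabs)
  refine this.congr fun n => ?_
  exact hGx n

/-- For `i < j` the `j`-th vector is at most `(w j - M j • w i)⁺`, and the `i`-th is at most `(M
j)⁻¹` times the negative part of the same vector, because subtracting `r i` subtracts at least `(M
j)⁻¹ • w j`. -/
theorem disjoint_posPart_sub {w r : ℕ → V} {M : ℕ → ℝ} (hM : ∀ n, 0 < M n) (hw : ∀ n, 0 ≤ w n)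
    (hr : ∀ n, 0 ≤ r n) (h : ∀ i j, i < j → w j ≤ M j • r i) :
    ∀ k l, k ≠ l → |(w k - M k • ∑ i ∈ Finset.range k, w i - r k)⁺| ⊓
      |(w l - M l • ∑ i ∈ Finset.range l, w i - r l)⁺| = 0 := by
  set z : ℕ → V := fun k => (w k - M k • ∑ i ∈ Finset.range k, w i - r k)⁺
  have hz : ∀ k, 0 ≤ z k := fun k => posPart_nonneg _
  have key : ∀ i j, i < j → z i ⊓ z j = 0 := by
    intro i j hij
    have h1 : z j ≤ (w j - M j • w i)⁺ := by
      refine posPart_mono ((sub_le_self _ (hr j)).trans (sub_le_sub_left ?_ _))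
      exact smul_le_smul_of_nonneg_left (Finset.single_le_sum (fun k _ => hw k)
        (Finset.mem_range.2 hij)) (hM j).le
    have h2 : z i ≤ (M j)⁻¹ • (w j - M j • w i)⁻ := by
      rw [← posPart_neg, ← posPart_smul_of_nonneg (inv_nonneg.2 (hM j).le)]
      refine posPart_mono ?_
      rw [neg_sub, smul_sub, inv_smul_smul₀ (hM j).ne']
      refine sub_le_sub (sub_le_self _ (smul_nonneg (hM i).le
        (Finset.sum_nonneg fun k _ => hw k))) ?_
      rw [inv_smul_le_iff_of_pos (hM j)]
      exact h i j hij
    refine inf_eq_zero_of_le (hz i) (hz j) h2 h1 (smul_inf_eq_zero (inv_nonneg.2 (hM j).le)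
      (negPart_nonneg _) (posPart_nonneg _) ?_)
    rw [inf_comm]
    exact posPart_inf_negPart_eq_zero _
  intro k l hkl
  change |z k| ⊓ |z l| = 0
  rw [abs_of_nonneg (hz k), abs_of_nonneg (hz l)]
  rcases hkl.lt_or_gt with hlt | hlt
  · exact key k l hlt
  · rw [inf_comm]
    exact key l k hlt

theorem exists_strictMono_of_forall_finset {P : Finset ℕ → ℕ → Prop}
    (h : ∀ s : Finset ℕ, ∃ n, (∀ k ∈ s, k < n) ∧ P s n) :
    ∃ f : ℕ → ℕ, StrictMono f ∧ ∀ j, P ((Finset.range j).image f) (f j) := by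
  choose next hlt hP using h
  let g : ℕ → Finset ℕ := fun j => Nat.rec ∅ (fun _ s => insert (next s) s) j
  let f : ℕ → ℕ := fun j => next (g j)
  have hg : ∀ j, g j = (Finset.range j).image f := by
    intro j
    induction j with
    | zero => simp [g]
    | succ j ih =>
      rw [Finset.range_add_one, Finset.image_insert, ← ih]
  refine ⟨f, strictMono_nat_of_lt_succ fun j => ?_, fun j => ?_⟩
  · exact hlt (g (j + 1)) _ (Finset.mem_insert_self _ _)
  · rw [← hg]
    exact hP (g j)

end Functionals

/-! ## Lattice seminorms and weakly null sequences of positive vectors -/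

section Seminorm

variable {V : Type u} [NormedAddCommGroup V] [NormedSpace ℝ V] [Lattice V] [HasSolidNorm V]
  [IsOrderedAddMonoid V] [IsOrderedModule ℝ V]

/-- A continuous monotone seminorm on a normed vector lattice. -/
structure IsLatticeSeminorm (q : V → ℝ) : Prop where
  add_le : ∀ x y, q (x + y) ≤ q x + q y
  smul : ∀ (c : ℝ), 0 < c → ∀ x, q (c • x) = c * q x
  mono : ∀ x y, |x| ≤ |y| → q x ≤ q y
  bound : ∃ C, 0 ≤ C ∧ ∀ x, q x ≤ C * ‖x‖

namespace IsLatticeSeminorm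

variable {q : V → ℝ} (hq : IsLatticeSeminorm q)

include hq

theorem map_zero : q 0 = 0 := by
  have := hq.smul 2 two_pos 0
  rw [smul_zero] at this
  linarith

theorem nonneg (x : V) : 0 ≤ q x := by
  rw [← hq.map_zero]
  exact hq.mono _ _ (by rw [abs_zero]; exact abs_nonneg x)

theorem mono_of_nonneg {x y : V} (hx : 0 ≤ x) (hxy : x ≤ y) : q x ≤ q y :=
  hq.mono _ _ (by rwa [abs_of_nonneg hx, abs_of_nonneg (hx.trans hxy)])

/-- Hahn–Banach is applied to `x ↦ q x⁺` instead of `q`: this sublinear functional vanishes on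
negative vectors, so whatever it dominates is positive. -/
theorem exists_positive_functional {y : V} (hy : 0 ≤ y) :
    ∃ φ : V →ₗ[ℝ] ℝ, (∀ x, 0 ≤ x → 0 ≤ φ x) ∧ (∀ x, |φ x| ≤ q x) ∧ φ y = q y := by
  obtain ⟨φ, hφ, hφy⟩ := exists_linearMap_le_sublinear (N := fun x => q x⁺)
    (fun c hc x => by rw [posPart_smul_of_nonneg hc.le, hq.smul c hc])
    (fun x z => (hq.mono_of_nonneg (posPart_nonneg _) (posPart_add_le x z)).trans
      (hq.add_le _ _)) y
  have hpp : ∀ x, q x⁺ ≤ q x := fun x => hq.mono _ _ (by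
    rw [abs_of_nonneg (posPart_nonneg x)]
    exact sup_le (le_abs_self x) (abs_nonneg x))
  have hneg : ∀ x, q (-x) = q x := fun x =>
    le_antisymm (hq.mono _ _ (abs_neg x).le) (hq.mono _ _ (abs_neg x).ge)
  refine ⟨φ, fun x hx => ?_, fun x => abs_le'.2 ⟨(hφ x).trans (hpp x), ?_⟩, ?_⟩
  · have := hφ (-x)
    rw [_root_.map_neg, posPart_eq_zero.2 (neg_nonpos.2 hx), hq.map_zero] at this
    linarith
  · rw [← _root_.map_neg, ← hneg x]
    exact (hφ _).trans (hpp _)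
  · rw [hφy, posPart_of_nonneg hy]

/-- If `q` tends to `0` along disjoint positive weakly null sequences, then order bounded positive
weakly null sequences are not bounded away from `0` for `q`. -/
theorem false_of_orderBounded
    (hdisj : ∀ z : ℕ → V, (∀ n, 0 ≤ z n) → (∀ k l, k ≠ l → |z k| ⊓ |z l| = 0) → WeaklyNull z →
      Tendsto (fun n => q (z n)) atTop (𝓝 0))
    {u : V} {w : ℕ → V} (hw0 : ∀ n, 0 ≤ w n) (hwu : ∀ n, w n ≤ u) (hw : WeaklyNull w) {δ : ℝ}
    (hδ : 0 < δ) (hqw : ∀ n, δ ≤ q (w n)) : False := by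
  have hu : 0 ≤ u := (hw0 0).trans (hwu 0)
  obtain ⟨C, -, hC⟩ := hq.bound
  choose φ hφ0 hφq hφw using fun n => hq.exists_positive_functional (hw0 n)
  -- The functionals `φ n` attain `q` at `w n`. Their limit `g` is continuous, so `g (w n)` tends to
  -- `0`; it controls `φ n` on any fixed vector for suitable large `n`.
  obtain ⟨g, hg⟩ := exists_linearMap_tendsto (hyperfilter ℕ) hφq
  have hgb : ∀ x, ‖g x‖ ≤ C * ‖x‖ := fun x =>
    le_of_tendsto (hg x).norm (Filter.Eventually.of_forall fun n => (hφq n x).trans (hC x))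
  have hgw : Tendsto (fun n => g (w n)) atTop (𝓝 0) := hw (g.mkContinuous C hgb)
  have hqu : 0 ≤ q u := hq.nonneg u
  -- `α` and `η` make each of the two terms subtracted below, `α • u` and `α⁻¹ • ∑ w (f i)`, cost at
  -- most `δ / 4` under `φ (f j)`.
  set α : ℝ := δ / (4 * (q u + 1)) with hα
  have hα0 : 0 < α := by positivity
  have hαu : α * q u ≤ δ / 4 := by
    rw [hα, div_mul_eq_mul_div, div_le_div_iff₀ (by positivity) (by norm_num)]
    nlinarith
  set η : ℝ := α * (δ / 4) with hη
  have hη0 : 0 < η := by positivity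
  -- Keeping `∑ g (w k)` strictly below `η` is the invariant: it makes `φ n (∑ w k) < η` along the
  -- ultrafilter and leaves room for the next index. For sets `s` that violate it the requirement is
  -- vacuous.
  obtain ⟨f, hf, hP⟩ := exists_strictMono_of_forall_finset
    (P := fun s n => ∑ k ∈ s, g (w k) < η →
      φ n (∑ k ∈ s, w k) < η ∧ ∑ k ∈ s, g (w k) + g (w n) < η) (fun s => by
    have h1 : ∀ᶠ n in (hyperfilter ℕ : Filter ℕ), ∀ k ∈ s, k < n := by
      refine Filter.Eventually.filter_mono Nat.hyperfilter_le_atTop ?_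
      refine (Finset.eventually_all s).2 fun k _ => eventually_gt_atTop k
    by_cases hs : ∑ k ∈ s, g (w k) < η
    · have h2 : ∀ᶠ n in (hyperfilter ℕ : Filter ℕ), φ n (∑ k ∈ s, w k) < η := by
        refine (hg _).eventually_lt_const ?_
        rwa [map_sum]
      have h3 : ∀ᶠ n in (hyperfilter ℕ : Filter ℕ), g (w n) < η - ∑ k ∈ s, g (w k) :=
        Filter.Eventually.filter_mono Nat.hyperfilter_le_atTop
          (hgw.eventually_lt_const (sub_pos.2 hs))
      obtain ⟨n, h1, h2, h3⟩ := (h1.and (h2.and h3)).exists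
      exact ⟨n, h1, fun _ => ⟨h2, by linarith⟩⟩
    · obtain ⟨n, hn⟩ := h1.exists
      exact ⟨n, hn, fun h => absurd h hs⟩)
  have hsum : ∀ j, ∑ k ∈ (Finset.range j).image f, g (w k) =
      ∑ i ∈ Finset.range j, g (w (f i)) := fun j =>
    Finset.sum_image fun a _ b _ hab => hf.injective hab
  have hsum' : ∀ j, ∑ k ∈ (Finset.range j).image f, w k =
      ∑ i ∈ Finset.range j, w (f i) := fun j =>
    Finset.sum_image fun a _ b _ hab => hf.injective hab
  have hlt : ∀ j, ∑ i ∈ Finset.range j, g (w (f i)) < η := by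
    intro j
    induction j with
    | zero => simpa using hη0
    | succ j ih =>
      have := hP j
      rw [hsum] at this
      rw [Finset.sum_range_succ]
      exact (this ih).2
  have hφsmall : ∀ j, φ (f j) (∑ i ∈ Finset.range j, w (f i)) < η := fun j => by
    have := hP j
    rw [hsum, hsum'] at this
    exact (this (hlt j)).1
  set z : ℕ → V := fun j =>
    (w (f j) - α⁻¹ • ∑ i ∈ Finset.range j, w (f i) - α • u)⁺ with hz
  have hz0 : ∀ j, 0 ≤ z j := fun j => posPart_nonneg _
  have hzw : ∀ j, z j ≤ w (f j) := fun j => by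
    refine sup_le ?_ (hw0 _)
    refine (sub_le_self _ (smul_nonneg hα0.le hu)).trans (sub_le_self _ ?_)
    exact smul_nonneg (inv_nonneg.2 hα0.le) (Finset.sum_nonneg fun _ _ => hw0 _)
  have hzd := disjoint_posPart_sub (w := fun j => w (f j)) (r := fun _ => α • u)
    (M := fun _ => α⁻¹) (fun _ => inv_pos.2 hα0) (fun j => hw0 _)
    (fun _ => smul_nonneg hα0.le hu) (fun i j _ => by
      rw [inv_smul_smul₀ hα0.ne']
      exact hwu _)
  have hlim := hdisj z hz0 hzd ((hw.comp hf).of_le hz0 hzw)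
  -- Since `φ (f j)` is positive and dominated by `q`, `q (z j) ≥ q (w (f j)) - δ / 4 - δ / 4`, so
  -- the disjoint sequence `z` stays away from `0`.
  have hge : ∀ j, δ / 4 ≤ q (z j) := by
    intro j
    have h1 : φ (f j) (w (f j) - α⁻¹ • ∑ i ∈ Finset.range j, w (f i) - α • u) ≤
        φ (f j) (z j) := by
      have := hφ0 (f j) _ (sub_nonneg.2 (le_posPart
        (w (f j) - α⁻¹ • ∑ i ∈ Finset.range j, w (f i) - α • u)))
      rwa [map_sub, sub_nonneg] at this
    rw [map_sub, map_sub, map_smul, map_smul, hφw, smul_eq_mul, smul_eq_mul] at h1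
    have h2 : α⁻¹ * φ (f j) (∑ i ∈ Finset.range j, w (f i)) ≤ δ / 4 := by
      rw [inv_mul_le_iff₀ hα0]
      exact (hφsmall j).le
    have h3 : α * φ (f j) u ≤ δ / 4 :=
      (mul_le_mul_of_nonneg_left ((le_abs_self _).trans (hφq _ u)) hα0.le).trans hαu
    have h4 := (le_abs_self _).trans (hφq (f j) (z j))
    have h5 := hqw (f j)
    linarith
  have := ge_of_tendsto' hlim hge
  linarith

/-- If `q` tends to `0` along disjoint positive weakly null sequences, then positive weakly null
sequences are almost order bounded for `q`. -/
theorem exists_eventually_posPart_sub_le [CompleteSpace V]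
    (hdisj : ∀ z : ℕ → V, (∀ n, 0 ≤ z n) → (∀ k l, k ≠ l → |z k| ⊓ |z l| = 0) → WeaklyNull z →
      Tendsto (fun n => q (z n)) atTop (𝓝 0))
    {y : ℕ → V} (hy0 : ∀ n, 0 ≤ y n) (hy : WeaklyNull y) {ε : ℝ} (hε : 0 < ε) :
    ∃ u, 0 ≤ u ∧ ∀ᶠ n in atTop, q (y n - u)⁺ ≤ ε := by
  by_contra! hcon
  obtain ⟨B, hB⟩ := hy.exists_norm_le
  have hB0 : 0 ≤ B := (norm_nonneg _).trans (hB 0)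
  -- By contradiction, no multiple of the sum of the vectors chosen so far absorbs the tail. The
  -- cardinality of the chosen set supplies the exponent `j`.
  obtain ⟨f, hf, hP⟩ := exists_strictMono_of_forall_finset
    (P := fun s n => ε < q (y n - ((4 : ℝ) ^ s.card) • ∑ k ∈ s, y k)⁺) (fun s => by
    have h1 : ∀ᶠ n in atTop, ∀ k ∈ s, k < n :=
      (Finset.eventually_all s).2 fun k _ => eventually_gt_atTop k
    obtain ⟨n, h2, h3⟩ := ((hcon (((4 : ℝ) ^ s.card) • ∑ k ∈ s, y k)
      (smul_nonneg (by positivity) (Finset.sum_nonneg fun k _ => hy0 k))).and_eventually h1).exists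
    exact ⟨n, h3, h2⟩)
  have hP' : ∀ j, ε < q (y (f j) - ((4 : ℝ) ^ j) • ∑ i ∈ Finset.range j, y (f i))⁺ := fun j => by
    have := hP j
    rwa [Finset.card_image_of_injective _ hf.injective, Finset.card_range,
      Finset.sum_image fun a _ b _ hab => hf.injective hab] at this
  have hsumm : Summable fun j => ((1 / 2 : ℝ) ^ j) • y (f j) := by
    refine Summable.of_norm_bounded (summable_geometric_two.mul_right B) fun j => ?_
    rw [norm_smul, norm_pow, Real.norm_of_nonneg (by norm_num : (0 : ℝ) ≤ 1 / 2)]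
    exact mul_le_mul_of_nonneg_left (hB _) (by positivity)
  set v : V := ∑' j, ((1 / 2 : ℝ) ^ j) • y (f j)
  have hnn : ∀ j, 0 ≤ ((1 / 2 : ℝ) ^ j) • y (f j) := fun j => smul_nonneg (by positivity) (hy0 _)
  have hv0 : 0 ≤ v := tsum_nonneg hnn
  have hvj : ∀ j, ((1 / 2 : ℝ) ^ j) • y (f j) ≤ v := fun j => hsumm.le_tsum j fun k _ => hnn k
  -- Subtracting `2 ^ (-j) • v` makes the sequence disjoint, because `y (f j) ≤ 2 ^ j • v ≤ 4 ^ j •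
  -- r i` for `i < j`, and it is harmless for `q` in the limit.
  set r : ℕ → V := fun j => ((1 / 2 : ℝ) ^ j) • v
  have hr0 : ∀ j, 0 ≤ r j := fun j => smul_nonneg (by positivity) hv0
  have hzd := disjoint_posPart_sub (w := fun j => y (f j)) (r := r) (M := fun j => (4 : ℝ) ^ j)
    (fun j => by positivity) (fun j => hy0 _) hr0 (fun i j hij => by
      calc y (f j) = ((2 : ℝ) ^ j) • ((1 / 2 : ℝ) ^ j) • y (f j) := by
            rw [smul_smul, ← mul_pow]
            norm_num
        _ ≤ ((2 : ℝ) ^ j) • v := smul_le_smul_of_nonneg_left (hvj j) (by positivity)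
        _ ≤ ((4 : ℝ) ^ j) • r i := by
            rw [smul_smul]
            refine smul_le_smul_of_nonneg_right ?_ hv0
            rw [show (4 : ℝ) = 2 * 2 by norm_num, mul_pow, mul_assoc]
            refine le_mul_of_one_le_right (by positivity) ?_
            rw [one_div, inv_pow, ← div_eq_mul_inv, one_le_div (by positivity)]
            exact pow_le_pow_right₀ (by norm_num) hij.le)
  set z : ℕ → V := fun j =>
    (y (f j) - ((4 : ℝ) ^ j) • ∑ i ∈ Finset.range j, y (f i) - r j)⁺
  have hz0 : ∀ j, 0 ≤ z j := fun j => posPart_nonneg _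
  have hzy : ∀ j, z j ≤ y (f j) := fun j => by
    refine sup_le ?_ (hy0 _)
    refine (sub_le_self _ (hr0 j)).trans (sub_le_self _ ?_)
    exact smul_nonneg (by positivity) (Finset.sum_nonneg fun _ _ => hy0 _)
  have hlim := hdisj z hz0 hzd ((hy.comp hf).of_le hz0 hzy)
  have hge : ∀ j, ε - (1 / 2 : ℝ) ^ j * q v ≤ q (z j) := by
    intro j
    have h1 : (y (f j) - ((4 : ℝ) ^ j) • ∑ i ∈ Finset.range j, y (f i))⁺ ≤ z j + r j := by
      refine sup_le ?_ (add_nonneg (hz0 j) (hr0 j))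
      rw [← sub_le_iff_le_add]
      exact le_posPart _
    have h2 := (hq.mono_of_nonneg (posPart_nonneg _) h1).trans (hq.add_le _ _)
    rw [hq.smul _ (by positivity)] at h2
    linarith [hP' j]
  have hlim' : Tendsto (fun j : ℕ => ε - (1 / 2 : ℝ) ^ j * q v) atTop (𝓝 (ε - 0 * q v)) :=
    tendsto_const_nhds.sub ((tendsto_pow_atTop_nhds_zero_of_lt_one (by norm_num)
      (by norm_num)).mul_const _)
  have := le_of_tendsto_of_tendsto' hlim' hlim hge
  linarith

/-- A lattice seminorm that tends to `0` along disjoint positive weakly null sequences tends to `0`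
along all positive weakly null sequences. -/
theorem tendsto_zero_of_disjoint [CompleteSpace V]
    (hdisj : ∀ z : ℕ → V, (∀ n, 0 ≤ z n) → (∀ k l, k ≠ l → |z k| ⊓ |z l| = 0) → WeaklyNull z →
      Tendsto (fun n => q (z n)) atTop (𝓝 0))
    {y : ℕ → V} (hy0 : ∀ n, 0 ≤ y n) (hy : WeaklyNull y) :
    Tendsto (fun n => q (y n)) atTop (𝓝 0) := by
  rw [Metric.tendsto_atTop']
  by_contra! hcon
  obtain ⟨ε, hε, hcon⟩ := hcon
  obtain ⟨u, hu, hev⟩ := hq.exists_eventually_posPart_sub_le hdisj hy0 hy (half_pos hε)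
  have hfreq : ∃ᶠ n in atTop, ε ≤ q (y n) := by
    rw [frequently_atTop']
    intro N
    obtain ⟨n, hn, h⟩ := hcon N
    rw [Real.dist_eq, sub_zero, abs_of_nonneg (hq.nonneg _)] at h
    exact ⟨n, hn, h⟩
  -- In `y n = y n ⊓ u + (y n - u)⁺` the second term is eventually at most `ε / 2`, so the order
  -- bounded first term carries the rest.
  have hfreq' : ∃ᶠ n in atTop, ε / 2 ≤ q (y n ⊓ u) := by
    refine (hfreq.and_eventually hev).mono fun n hn => ?_
    have := hq.add_le (y n ⊓ u) (y n - u)⁺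
    rw [inf_add_posPart_sub] at this
    linarith [hn.1, hn.2]
  obtain ⟨f, hf, h⟩ := extraction_of_frequently_atTop hfreq'
  have hw0 : ∀ n, 0 ≤ y n ⊓ u := fun n => le_inf (hy0 n) hu
  have hw : WeaklyNull fun n => y n ⊓ u := hy.of_le hw0 fun n => inf_le_left
  exact hq.false_of_orderBounded hdisj (w := fun n => y (f n) ⊓ u) (fun n => hw0 _)
    (fun n => inf_le_right) (hw.comp hf) (half_pos hε) h

end IsLatticeSeminorm

/-! ### Almost Dunford–Pettis operators on positive weakly null sequences -/

/-- The lattice seminorm `x ↦ sup {‖T y‖ : 0 ≤ y ≤ |x|}`. -/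
noncomputable def solidSeminorm {W : Type*} [NormedAddCommGroup W] [NormedSpace ℝ W]
    (T : V →ₗ[ℝ] W) (x : V) : ℝ := sSup ((fun y => ‖T y‖) '' Set.Icc 0 |x|)

section SolidSeminorm

variable {W : Type*} [NormedAddCommGroup W] [NormedSpace ℝ W] {T : V →ₗ[ℝ] W} {C : ℝ}

theorem solidSeminorm_nonempty (x : V) : ((fun y => ‖T y‖) '' Set.Icc 0 |x|).Nonempty :=
  ⟨_, 0, ⟨le_rfl, abs_nonneg x⟩, rfl⟩

theorem solidSeminorm_mem_le (hC0 : 0 ≤ C) (hC : ∀ x, ‖T x‖ ≤ C * ‖x‖) {x : V} {r : ℝ}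
    (hr : r ∈ (fun y => ‖T y‖) '' Set.Icc 0 |x|) : r ≤ C * ‖x‖ := by
  obtain ⟨y, hy, rfl⟩ := hr
  refine (hC y).trans (mul_le_mul_of_nonneg_left ?_ hC0)
  rw [← norm_abs_eq_norm x]
  exact norm_le_norm_of_nonneg_of_le hy.1 hy.2

theorem norm_le_solidSeminorm (hC0 : 0 ≤ C) (hC : ∀ x, ‖T x‖ ≤ C * ‖x‖) {x y : V} (hy : 0 ≤ y)
    (hyx : y ≤ |x|) : ‖T y‖ ≤ solidSeminorm T x :=
  le_csSup ⟨_, fun _ hr => solidSeminorm_mem_le hC0 hC hr⟩ ⟨y, ⟨hy, hyx⟩, rfl⟩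

theorem isLatticeSeminorm_solidSeminorm (hC0 : 0 ≤ C) (hC : ∀ x, ‖T x‖ ≤ C * ‖x‖) :
    IsLatticeSeminorm (solidSeminorm T) where
  add_le a b := by
    refine csSup_le (solidSeminorm_nonempty _) ?_
    rintro _ ⟨y, hy, rfl⟩
    change ‖T y‖ ≤ _
    rw [← inf_add_posPart_sub y |a|, map_add]
    refine (norm_add_le _ _).trans (add_le_add
      (norm_le_solidSeminorm hC0 hC (le_inf hy.1 (abs_nonneg a)) inf_le_right)
      (norm_le_solidSeminorm hC0 hC (posPart_nonneg _) (sup_le ?_ (abs_nonneg b))))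
    rw [sub_le_iff_le_add']
    exact hy.2.trans (abs_add_le a b)
  smul c hc x := by
    have h1 : ∀ (c : ℝ) (x : V), 0 < c → c * solidSeminorm T x ≤ solidSeminorm T (c • x) := by
      intro c x hc
      rw [← le_div_iff₀' hc]
      refine csSup_le (solidSeminorm_nonempty _) ?_
      rintro _ ⟨y, hy, rfl⟩
      rw [le_div_iff₀' hc]
      have := norm_le_solidSeminorm hC0 hC (x := c • x) (smul_nonneg hc.le hy.1)
        (by rw [abs_smul_of_nonneg hc.le]; exact smul_le_smul_of_nonneg_left hy.2 hc.le)
      rwa [map_smul, norm_smul, Real.norm_of_nonneg hc.le] at this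
    refine le_antisymm ?_ (h1 c x hc)
    have h2 := h1 c⁻¹ (c • x) (inv_pos.2 hc)
    rwa [inv_smul_smul₀ hc.ne', inv_mul_le_iff₀ hc] at h2
  mono x y hxy := csSup_le_csSup ⟨_, fun _ hr => solidSeminorm_mem_le hC0 hC hr⟩
    (solidSeminorm_nonempty _) (Set.image_mono (Set.Icc_subset_Icc_right hxy))
  bound := ⟨C, hC0, fun _ => csSup_le (solidSeminorm_nonempty _)
    fun _ hr => solidSeminorm_mem_le hC0 hC hr⟩

end SolidSeminorm

/-- A bounded almost Dunford–Pettis operator on a Banach lattice maps weakly null sequences of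
positive vectors to norm null sequences. -/
theorem IsAlmostDunfordPettis.tendsto_of_nonneg [CompleteSpace V] {W : Type u}
    [NormedAddCommGroup W] [NormedSpace ℝ W] {T : V →ₗ[ℝ] W} (hT : IsAlmostDunfordPettis T)
    {C : ℝ} (hC0 : 0 ≤ C) (hC : ∀ x, ‖T x‖ ≤ C * ‖x‖) {y : ℕ → V} (hy0 : ∀ n, 0 ≤ y n)
    (hy : WeaklyNull y) : Tendsto (fun n => ‖T (y n)‖) atTop (𝓝 0) := by
  have hq := isLatticeSeminorm_solidSeminorm hC0 hC
  refine squeeze_zero (fun n => norm_nonneg _)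
    (fun n => norm_le_solidSeminorm hC0 hC (hy0 n) (le_abs_self _))
    (hq.tendsto_zero_of_disjoint (fun z hz hzd hzw => ?_) hy0 hy)
  -- `x ↦ ‖T x‖` is not monotone, hence the solid seminorm. Near-maximizers `t n` in `[0, z n]`
  -- inherit disjointness and weak nullity from `z`, so the hypothesis on `T` applies to them.
  have hex : ∀ n : ℕ, ∃ t, 0 ≤ t ∧ t ≤ z n ∧
      solidSeminorm T (z n) - 1 / ((n : ℝ) + 1) < ‖T t‖ := fun n => by
    obtain ⟨_, ⟨t, ht, rfl⟩, h⟩ := exists_lt_of_lt_csSup (solidSeminorm_nonempty (T := T) (z n))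
      (sub_lt_self (solidSeminorm T (z n)) (by positivity : (0 : ℝ) < 1 / ((n : ℝ) + 1)))
    exact ⟨t, ht.1, ht.2.trans_eq (abs_of_nonneg (hz n)), h⟩
  choose t ht0 htz ht using hex
  have h1 : Tendsto (fun n => ‖T (t n)‖) atTop (𝓝 0) :=
    hT t (fun k l hkl => inf_eq_zero_of_le (abs_nonneg _) (abs_nonneg _)
      (by rw [abs_of_nonneg (ht0 k), abs_of_nonneg (hz k)]; exact htz k)
      (by rw [abs_of_nonneg (ht0 l), abs_of_nonneg (hz l)]; exact htz l) (hzd k l hkl))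
      (hzw.of_le ht0 htz)
  have h2 := h1.add (tendsto_one_div_add_atTop_nhds_zero_nat (𝕜 := ℝ))
  rw [add_zero] at h2
  exact squeeze_zero (fun n => hq.nonneg _) (fun n => by linarith [ht n]) h2

end Seminorm

end BanachLatticeTensor

/-! ### The equivalence -/

open BanachLatticeTensor in
theorem theorem2p1 {m : ℕ} [NeZero m] (E : Fin m → Type u)
    [∀ i, NormedAddCommGroup (E i)] [∀ i, NormedSpace ℝ (E i)] [∀ i, CompleteSpace (E i)]
    [∀ i, Lattice (E i)] [∀ i, HasSolidNorm (E i)] [∀ i, IsOrderedAddMonoid (E i)]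
    [∀ i, IsOrderedModule ℝ (E i)] :
    List.TFAE
      [ HasPositiveSchurProperty (PosProjTensor E),
        ∀ (G : Type u) [NormedAddCommGroup G] [NormedSpace ℝ G] [CompleteSpace G] [Lattice G]
          [HasSolidNorm G] [IsOrderedAddMonoid G] [IsOrderedModule ℝ G]
          (T : MultilinearMap ℝ E G), IsRegularMultilinear T →
          (∃! S : PosProjTensor E →ₗ[ℝ] G, IsLinearization T S) ∧
            ∀ S : PosProjTensor E →ₗ[ℝ] G, IsLinearization T S → IsAlmostDunfordPettis S,
        ∀ (G : Type u) [NormedAddCommGroup G] [NormedSpace ℝ G] [CompleteSpace G] [Lattice G]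
          [HasSolidNorm G] [IsOrderedAddMonoid G] [IsOrderedModule ℝ G]
          (T : MultilinearMap ℝ E G), IsRegularMultilinear T →
          ∃ (H : Type u) (_ : NormedAddCommGroup H) (_ : NormedSpace ℝ H) (_ : CompleteSpace H)
            (_ : Lattice H) (_ : HasSolidNorm H) (_ : IsOrderedAddMonoid H)
            (_ : IsOrderedModule ℝ H) (A : MultilinearMap ℝ E H) (v : H →ₗ[ℝ] G),
            IsRegularMultilinear A ∧ IsRegularLinear v ∧ IsAlmostDunfordPettis v ∧
              T = v.compMultilinearMap A ] := by
  tfae_have 1 → 2 := by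
    intro hP G _ _ _ _ _ _ _ T hT
    refine ⟨hT.existsUnique_linearization, fun S hS x hd hx => ?_⟩
    obtain ⟨C, -, hC⟩ := hS.1.exists_bound
    have h := hP (fun n => |x n|) (fun n => abs_nonneg _) (hx.abs_of_disjoint hd)
    refine squeeze_zero (fun n => norm_nonneg _) (fun n => hC (x n)) ?_
    simpa [norm_abs_eq_norm] using h.const_mul C
  tfae_have 2 → 3 := by
    intro h G _ _ _ _ _ _ _ T hT
    obtain ⟨⟨S, hS, -⟩, hDP⟩ := h G T hT
    refine ⟨PosProjTensor E, inferInstance, inferInstance, inferInstance, inferInstance,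
      inferInstance, inferInstance, inferInstance, PosProjTensor.tmul, S, ?_, hS.1, hDP S hS, ?_⟩
    · exact ⟨_, 0, PosProjTensor.isPositiveMultilinear_tmul, fun _ _ => le_rfl, by simp⟩
    · exact MultilinearMap.ext fun x => (hS.2 x).symm
  tfae_have 3 → 1 := by
    intro h x hx0 hx
    -- The factorization is applied to the canonical map `⊗` itself.
    obtain ⟨H, _, _, _, _, _, _, _, A, v, hA, hv, hDP, hT⟩ := h (PosProjTensor E)
      PosProjTensor.tmul ⟨_, 0, PosProjTensor.isPositiveMultilinear_tmul, fun _ _ => le_rfl,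
        by simp⟩
    obtain ⟨A₁, A₂, hA₁, hA₂, rfl⟩ := hA
    obtain ⟨S₁, hS₁, hT₁⟩ := hA₁.exists_linearization
    obtain ⟨S₂, hS₂, hT₂⟩ := hA₂.exists_linearization
    have hreg : ∀ {S : PosProjTensor E →ₗ[ℝ] H}, IsPositiveLinear S → IsRegularLinear S :=
      fun {S} hS => ⟨S, 0, hS, fun _ _ => le_rfl, by simp⟩
    have hc₁ := (hreg hS₁).continuous
    have hc₂ := (hreg hS₂).continuous
    -- Both sides are continuous and agree on elementary tensors. `S₁` and `S₂` are kept apart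
    -- because only positive operators preserve positivity of the sequence.
    have hid : v ∘ₗ (S₁ - S₂) = LinearMap.id := by
      refine PosProjTensor.ext_of_continuous (hv.continuous.comp (hc₁.sub hc₂)) continuous_id
        fun y => ?_
      rw [LinearMap.comp_apply, LinearMap.sub_apply, hT₁, hT₂, LinearMap.id_apply, hT]
      rfl
    obtain ⟨C, hC0, hC⟩ := hv.exists_bound
    have key : ∀ {S : PosProjTensor E →ₗ[ℝ] H}, IsPositiveLinear S → Continuous S →
        Tendsto (fun n => ‖v (S (x n))‖) atTop (𝓝 0) := fun {S} hS hc =>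
      hDP.tendsto_of_nonneg hC0 hC (fun n => hS _ (hx0 n)) fun f =>
        hx (f.comp ⟨S, hc⟩)
    have hsum := (key hS₁ hc₁).add (key hS₂ hc₂)
    rw [add_zero] at hsum
    refine squeeze_zero (fun n => norm_nonneg _) (fun n => ?_) hsum
    have hxn := LinearMap.congr_fun hid (x n)
    rw [LinearMap.comp_apply, LinearMap.sub_apply, map_sub, LinearMap.id_apply] at hxn
    conv_lhs => rw [← hxn]
    exact norm_sub_le _ _
  tfae_finish
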